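/- **Setting.** There are $L$ linear plants $x_{k+1,\ell}=F_\ell x_{k,\ell}+w_{k,\ell}$ with measurements $y_{k,\ell}=H_\ell x_{k,\ell}+v_{k,\ell}$ ($k\ge 0$, $x_{k,\ell}\in\mathbb R^n$, $y_{k,\ell}\in\mathbb R^m$), where $x_{0,\ell}\sim\mathcal N(m_{0,\ell},R_{0,\ell})$, $w_{k,\ell}\sim\mathcal N(0,R_{1,\ell})$, $v_{k,\ell}\sim\mathcal N(0,R_{2,\ell})$ are mutually independent and $R_{1,\ell},R_{2,\ell}\succ0$. The sensors share a channel with coefficients $q_{i,j}\ge 0$ from transmitter $i$ to receiver $j$, $q_{\ell,\ell}>0$, and noise powers $n_{k,\ell}>0$. A power vector $p\in\mathcal P=[0,p_{\max}]^L$ produces at time $k$ the SINRs and packet success ratios (PSRs) $$\gamma_\ell=\frac{p_\ell q_{\ell,\ell}}{\sum_{i\ne\ell}p_iq_{i,\ell}+n_{k,\ell}},\qquad \kappa_\ell=f(\gamma_\ell)=\bigl[1-Q(4\sqrt{\gamma_\ell})\bigr]^W ,$$ where $Q$ is the standard Gaussian tail function and $W\ge1$ the packet length. The Foschini–Miljanic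 map at time $k$ is $\Psi_k(\kappa)=(I-D(\gamma)T)^{-1}u_k$ with $\gamma_\ell=f^{-1}(\kappa_\ell)\ge0$, $D(\gamma)=\mathrm{diag}(\gamma)$, $T_{\ell,i}=q_{i,\ell}/q_{\ell,\ell}$ for $i\neq\ell$, $T_{\ell,\ell}=0$, $u_{k,\ell}=n_{k,\ell}\gamma_\ell/q_{\ell,\ell}$; $\Lambda_k$ is the set of $\kappa$ with entries in $f([0,\infty))$, $I-D(\gamma)T$ nonsingular and $\Psi_k(\kappa)\in\mathcal P$. Packet $k$ on link $\ell$ arrives iff $\beta_{k,\ell}=1$. Given all initial states and noises of the plants and all arrivals before $k$, the $\beta_{k,\ell}$, $\ell=1,\dots,L$, are independent Bernoulli variables whose means are the PSRs produced by $p_k$. The information $\mathcal I_{k,\ell}$ of estimator $\ell$ consists of $\beta_{t,\ell}$ and $\beta_{t,\ell}y_{t,\ell}$, $t<k$. An admissible power schedule takes values in $\mathcal P$, and $p_k$ is a measurable function of $\mathcal I_{k,1},\dots,\mathcal I_{k,L}$; in an admissible estimator $\hat x_{k,\ell}$ is a measurable function of $\mathcal I_{k,\ell}$. A PSR schedule is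 admissible if $\kappa_k\in\Lambda_k$ has the same causality and is the vector of conditional means of $\beta_k$. With $\alpha\in(0,1)$, $\lambda_\ell>0$, $\Theta_{k,\ell}\succ0$, the joint problem is to minimize over power schedules and estimators $$\lim_{N\to\infty}\mathbb E\sum_{k=0}^N\sum_{\ell=1}^L\alpha^k\bigl(p_{k,\ell}+\lambda_\ell\|x_{k,\ell}-\hat x_{k,\ell}\|^2_{\Theta_{k,\ell}}\bigr)\in[0,\infty].$$ The underlying probability space is assumed rich enough to carry independent uniform variables $U_{k,\ell}$ that are independent of the plants. **Theorem 1.** The designs of the optimal estimate and of the optimal power schedule separate: 1. *(Estimate.)* For every admissible power schedule and all $k,\ell$, $x_{k,\ell}$ is square integrable, and the recursion $$\hat x_{k+1,\ell}=F_\ell\hat x_{k,\ell}+\beta_{k,\ell}K_{k,\ell}(y_{k,\ell}-H_\ell\hat x_{k,\ell}),\quad P_{k+1,\ell}=F_\ell P_{k,\ell}F_\ell^\top+R_{1,\ell}-\beta_{k,\ell}K_{k,\ell}H_\ell P_{k,\ell}F_\ell^\top,$$ $K_{k,\ell}=F_\ell P_{k,\ell}H_\ell^\top(H_\ell P_{k,\ell}H_\ell^\top+R_{2,\ell})^{-1}$,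 $\hat x_{0,\ell}=m_{0,\ell}$, $P_{0,\ell}=R_{0,\ell}$, yields an admissible estimator with $\hat x_{k,\ell}=\mathbb E[x_{k,\ell}\mid\mathcal I_{k,\ell}]$ and $P_{k,\ell}=\mathrm{Cov}[x_{k,\ell}\mid\mathcal I_{k,\ell}]$ almost surely. It is the almost surely unique minimizer of $\mathbb E\|x_{k,\ell}-e\|^2_{\Theta_{k,\ell}}$ over the $\mathcal I_{k,\ell}$-measurable $e$, with minimum $\mathbb E\,\mathrm{tr}(\Theta_{k,\ell}P_{k,\ell})$. Hence, for each admissible power schedule, the joint cost with this estimator equals the covariance-based cost $$\lim_{N\to\infty}\mathbb E\sum_{k=0}^N\sum_{\ell=1}^L\alpha^k\bigl(p_{k,\ell}+\lambda_\ell\,\mathrm{tr}(\Theta_{k,\ell}P_{k,\ell})\bigr),$$ and the joint cost with any other admissible estimator is at least this. 2. *(PSR form.)* For each $k$, $\Psi_k$ maps $\Lambda_k$ bijectively onto $\mathcal P$, and its inverse sends a power vector to the PSRs it produces. By $p_k=\Psi_k(\kappa_k)$ admissible power schedules correspond to admissible PSR schedules, and the covariance-based cost becomes the discounted cost with stage cost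 $\rho_k(S,\kappa)=\sum_\ell\bigl(\Psi_{k,\ell}(\kappa)+\lambda_\ell\mathrm{tr}(\Theta_{k,\ell}S_\ell)\bigr)$ at $S_k=(P_{k,1},\dots,P_{k,L})$. 3. *(MDP.)* Consider the Markov decision process with states $S=(P_1,\dots,P_L)$, initial state $(R_{0,1},\dots,R_{0,L})$, actions $\kappa\in\Lambda_k$, stage costs $\rho_k$, discount factor $\alpha$, and transition, with probability $\prod_\ell\bigl(b_\ell\kappa_\ell+(1-b_\ell)(1-\kappa_\ell)\bigr)$ for each $b\in\{0,1\}^L$, to the state obtained from the covariance recursion with $\beta=b$. Every deterministic Markov policy $\kappa_k=\nu_k(S_k)$ of it is realized by an admissible PSR schedule, and any such schedule has as its covariance-based cost the MDP cost of $\nu$. The joint problem, the covariance-based problem over power schedules, the same problem over PSR schedules, and the MDP over deterministic Markov policies all attain their minima, and these have a common value $V\in[0,\infty]$. If $\nu$ is optimal for the MDP, then $p_k=\Psi_k(\nu_k(S_k))$ together with the recursive estimator of part 1 is optimal for the joint problem. If $V<\infty$, a power schedule and an estimator are jointly optimal if and only if the schedule minimizes the covariance-based cost and the estimator agrees almost surely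 with that of part 1 for all $k,\ell$. -/

import Mathlib

open MeasureTheory ProbabilityTheory Matrix
open scoped ENNReal

noncomputable section

namespace RemoteEst

/-- The Gaussian `Q`-function: the probability that a standard normal variable exceeds `x`. -/
def gaussianQ (x : ℝ) : ℝ := (gaussianReal 0 1).real (Set.Ioi x)

/-- Packet success ratio of a packet of `W` bits as a function of the SINR. -/
def psrOfSinr (W : ℕ) (γ : ℝ) : ℝ := (1 - gaussianQ (4 * √γ)) ^ W

/-- Inverse of `psrOfSinr W` on the nonnegative SINRs (a junk value off the range). -/
def sinrOfPsr (W : ℕ) (κ : ℝ) : ℝ := Function.invFunOn (psrOfSinr W) (Set.Ici 0) κ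

/-- The squared norm `‖e‖²` with weight matrix `Θ`. -/
def wnormSq {n : ℕ} (Θ : Matrix (Fin n) (Fin n) ℝ) (e : EuclideanSpace ℝ (Fin n)) : ℝ :=
  e.ofLp ⬝ᵥ (Θ *ᵥ e.ofLp)

/-- Data of a network of `L` plants (states in `ℝⁿ`, measurements in `ℝᵐ`) whose sensors share one
interference channel. -/
structure Net (L n m : ℕ) where
  /-- `q i j`: channel coefficient from transmitter `i` to receiver `j` -/
  q : Fin L → Fin L → ℝ
  q_nonneg : ∀ i j, 0 ≤ q i j
  q_diag_pos : ∀ i, 0 < q i i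
  /-- power of the channel noise at time `k`, receiver `l` -/
  noisePow : ℕ → Fin L → ℝ
  noisePow_pos : ∀ k l, 0 < noisePow k l
  /-- maximum transmission power -/
  pmax : ℝ
  pmax_nonneg : 0 ≤ pmax
  /-- packet length in bits -/
  W : ℕ
  W_pos : 1 ≤ W
  /-- state matrices -/
  F : Fin L → Matrix (Fin n) (Fin n) ℝ
  /-- output matrices -/
  H : Fin L → Matrix (Fin m) (Fin n) ℝ
  /-- covariances of the state noises -/
  R₁ : Fin L → Matrix (Fin n) (Fin n) ℝ
  R₁_posDef : ∀ l, (R₁ l).PosDef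
  /-- covariances of the measurement noises -/
  R₂ : Fin L → Matrix (Fin m) (Fin m) ℝ
  R₂_posDef : ∀ l, (R₂ l).PosDef
  /-- means of the initial states -/
  m₀ : Fin L → EuclideanSpace ℝ (Fin n)
  /-- covariances of the initial states -/
  R₀ : Fin L → Matrix (Fin n) (Fin n) ℝ
  R₀_posSemidef : ∀ l, (R₀ l).PosSemidef
  /-- weights of the estimation error -/
  Θ : ℕ → Fin L → Matrix (Fin n) (Fin n) ℝ
  Θ_posDef : ∀ k l, (Θ k l).PosDef
  /-- trade-off between estimation error and power -/
  lam : Fin L → ℝ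
  lam_pos : ∀ l, 0 < lam l
  /-- discount factor -/
  α : ℝ
  α_pos : 0 < α
  α_lt_one : α < 1

/-- Labels of the primitive random variables: initial states, state noises, measurement noises, and
the auxiliary uniform variables that make the probability space rich enough. -/
inductive PrimIdx (L : ℕ)
  | init (l : Fin L)
  | state (k : ℕ) (l : Fin L)
  | meas (k : ℕ) (l : Fin L)
  | unif (k : ℕ) (l : Fin L)

/-- Primitive random variables. -/
structure Prim (Ω : Type*) (L n m : ℕ) where
  x₀ : Fin L → Ω → EuclideanSpace ℝ (Fin n)
  w : ℕ → Fin L → Ω → EuclideanSpace ℝ (Fin n)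
  v : ℕ → Fin L → Ω → EuclideanSpace ℝ (Fin m)
  U : ℕ → Fin L → Ω → ℝ

namespace Prim

variable {Ω : Type*} {L n m : ℕ}

/-- The σ-algebra generated by one primitive random variable. -/
abbrev sigma (X : Prim Ω L n m) : PrimIdx L → MeasurableSpace Ω
  | .init l => MeasurableSpace.comap (X.x₀ l) inferInstance
  | .state k l => MeasurableSpace.comap (X.w k l) inferInstance
  | .meas k l => MeasurableSpace.comap (X.v k l) inferInstance
  | .unif k l => MeasurableSpace.comap (X.U k l) inferInstance

/-- The σ-algebra generated by the initial states and by all state and measurement noises. -/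
abbrev plantSigma (X : Prim Ω L n m) : MeasurableSpace Ω :=
  (⨆ l, X.sigma (.init l)) ⊔ (⨆ k, ⨆ l, X.sigma (.state k l)) ⊔ ⨆ k, ⨆ l, X.sigma (.meas k l)

/-- The primitive variables have the prescribed Gaussian (resp. uniform on `[0, 1]`) laws and are
mutually independent. -/
structure HasLaws [MeasurableSpace Ω] (X : Prim Ω L n m) (N : Net L n m) (μ : Measure Ω) :
    Prop where
  meas_x₀ : ∀ l, Measurable (X.x₀ l)
  meas_w : ∀ k l, Measurable (X.w k l)
  meas_v : ∀ k l, Measurable (X.v k l)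
  meas_U : ∀ k l, Measurable (X.U k l)
  law_x₀ : ∀ l, μ.map (X.x₀ l) = multivariateGaussian (N.m₀ l) (N.R₀ l)
  law_w : ∀ k l, μ.map (X.w k l) = multivariateGaussian 0 (N.R₁ l)
  law_v : ∀ k l, μ.map (X.v k l) = multivariateGaussian 0 (N.R₂ l)
  law_U : ∀ k l, μ.map (X.U k l) = (volume : Measure ℝ).restrict (Set.Icc 0 1)
  indep : iIndep X.sigma μ

end Prim

namespace Net

variable {L n m : ℕ} (N : Net L n m)

/-! ### Wireless channel -/

/-- Signal-to-interference-and-noise ratio at receiver `l` under the power vector `p`. -/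
def sinr (k : ℕ) (p : Fin L → ℝ) (l : Fin L) : ℝ :=
  p l * N.q l l / (∑ i ∈ Finset.univ.erase l, p i * N.q i l + N.noisePow k l)

/-- The vector of packet success ratios (PSRs) produced by the power vector `p`. -/
def psr (k : ℕ) (p : Fin L → ℝ) : Fin L → ℝ := fun l => psrOfSinr N.W (N.sinr k p l)

/-- Feasible power vectors. -/
def powers : Set (Fin L → ℝ) := {p | ∀ l, 0 ≤ p l ∧ p l ≤ N.pmax}

/-- Normalized gain matrix. -/
def gain : Matrix (Fin L) (Fin L) ℝ :=
  Matrix.of fun l i => if i = l then 0 else N.q i l / N.q l l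

/-- The matrix `I - D(γ) T` of the linear system that determines the powers. -/
def fmMatrix (γ : Fin L → ℝ) : Matrix (Fin L) (Fin L) ℝ := 1 - Matrix.diagonal γ * N.gain

/-- Powers as a function of the SINR requirements. -/
def powerOfSinr (k : ℕ) (γ : Fin L → ℝ) : Fin L → ℝ :=
  (N.fmMatrix γ)⁻¹ *ᵥ fun l => N.noisePow k l * γ l / N.q l l

/-- The Foschini–Miljanic map: powers as a function of the PSR requirements. -/
def Ψ (k : ℕ) (κ : Fin L → ℝ) : Fin L → ℝ := N.powerOfSinr k fun l => sinrOfPsr N.W (κ l)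

/-- Feasible PSR requirements: each one is the PSR of a nonnegative SINR, the linear system for the
powers is nonsingular, and its solution is a feasible power vector. -/
def psrRegion (k : ℕ) : Set (Fin L → ℝ) :=
  {κ | (∀ l, κ l ∈ psrOfSinr N.W '' Set.Ici 0) ∧
    IsUnit (N.fmMatrix fun l => sinrOfPsr N.W (κ l)).det ∧ N.Ψ k κ ∈ N.powers}

/-- Probability of the arrival pattern `b` when links succeed independently with probabilities
`κ l`. -/
def outcomeProb (κ : Fin L → ℝ) (b : Fin L → Bool) : ℝ := ∏ l, if b l then κ l else 1 - κ l

/-! ### Kalman recursion and covariance dynamics -/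

/-- Kalman gain at covariance `P`. -/
def kalmanGain (l : Fin L) (P : Matrix (Fin n) (Fin n) ℝ) : Matrix (Fin n) (Fin m) ℝ :=
  N.F l * P * (N.H l)ᵀ * (N.H l * P * (N.H l)ᵀ + N.R₂ l)⁻¹

/-- One step of the error covariance of system `l`, with arrival indicator `b`. -/
def covStep (l : Fin L) (P : Matrix (Fin n) (Fin n) ℝ) (b : Bool) : Matrix (Fin n) (Fin n) ℝ :=
  N.F l * P * (N.F l)ᵀ + N.R₁ l -
    (if b then (1 : ℝ) else 0) • (N.kalmanGain l P * N.H l * P * (N.F l)ᵀ)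

/-- Transition of the joint covariance state `S = (P_1, …, P_L)`. -/
def stateStep (S : Fin L → Matrix (Fin n) (Fin n) ℝ) (b : Fin L → Bool) :
    Fin L → Matrix (Fin n) (Fin n) ℝ :=
  fun l => N.covStep l (S l) (b l)

variable {Ω : Type*}

/-- The covariance state at time `k` along the arrival process `β`. -/
def covState (β : ℕ → Ω → Fin L → Bool) : ℕ → Ω → Fin L → Matrix (Fin n) (Fin n) ℝ
  | 0, _ => N.R₀
  | k + 1, ω => N.stateStep (covState β k ω) (β k ω)

/-- Plant states. -/
def state (X : Prim Ω L n m) : ℕ → Fin L → Ω → EuclideanSpace ℝ (Fin n)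
  | 0, l, ω => X.x₀ l ω
  | k + 1, l, ω => (N.F l).toEuclideanLin (state X k l ω) + X.w k l ω

/-- Measurements. -/
def output (X : Prim Ω L n m) (k : ℕ) (l : Fin L) (ω : Ω) : EuclideanSpace ℝ (Fin m) :=
  (N.H l).toEuclideanLin (N.state X k l ω) + X.v k l ω

/-- The measurement that reaches estimator `l` (`0` if the packet is lost). -/
def received (X : Prim Ω L n m) (β : ℕ → Ω → Fin L → Bool) (k : ℕ) (l : Fin L) (ω : Ω) :
    EuclideanSpace ℝ (Fin m) :=
  if β k ω l then N.output X k l ω else 0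

/-- The Kalman-type estimates with arrival indicators `β`. -/
def kalman (X : Prim Ω L n m) (β : ℕ → Ω → Fin L → Bool) :
    ℕ → Fin L → Ω → EuclideanSpace ℝ (Fin n)
  | 0, l, _ => N.m₀ l
  | k + 1, l, ω =>
    (N.F l).toEuclideanLin (kalman X β k l ω) +
      (if β k ω l then (1 : ℝ) else 0) •
        (N.kalmanGain l (N.covState β k ω l)).toEuclideanLin
          (N.output X k l ω - (N.H l).toEuclideanLin (kalman X β k l ω))

/-! ### Information and admissible designs -/

/-- Information of estimator `l` at time `k`: arrival indicators and received measurements of its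
own link at the times before `k`. -/
abbrev estInfo (X : Prim Ω L n m) (β : ℕ → Ω → Fin L → Bool) (k : ℕ) (l : Fin L) :
    MeasurableSpace Ω :=
  ⨆ t : Fin k, MeasurableSpace.comap (fun ω => β t ω l) inferInstance ⊔
    MeasurableSpace.comap (N.received X β t l) inferInstance

/-- Information of the network coordinator at time `k`: that of all the estimators together. -/
abbrev coordInfo (X : Prim Ω L n m) (β : ℕ → Ω → Fin L → Bool) (k : ℕ) : MeasurableSpace Ω :=
  ⨆ l, N.estInfo X β k l

/-- The σ-algebra generated by everything in the plants and by the arrivals before time `k`. -/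
abbrev fullPast (X : Prim Ω L n m) (β : ℕ → Ω → Fin L → Bool) (k : ℕ) : MeasurableSpace Ω :=
  X.plantSigma ⊔ ⨆ t : Fin k, MeasurableSpace.comap (β t) inferInstance

variable [MeasurableSpace Ω]

/-- The arrivals at time `k` are independent Bernoulli variables with means `κ k l`, conditionally
on the plants and on the earlier arrivals. -/
structure IsErasure (X : Prim Ω L n m) (μ : Measure Ω) (κ : ℕ → Ω → Fin L → ℝ)
    (β : ℕ → Ω → Fin L → Bool) : Prop where
  meas : ∀ k, Measurable (β k)
  law : ∀ k b, μ[{ω | β k ω = b}.indicator (fun _ => (1 : ℝ)) | fullPast X β k] =ᵐ[μ]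
    fun ω => outcomeProb (κ k ω) b

/-- An admissible power schedule `p` with its arrival process `β`: the powers are feasible and
depend causally on the coordinator's information; arrivals follow the PSRs that `p` produces. -/
structure IsPowerSchedule (X : Prim Ω L n m) (μ : Measure Ω) (p : ℕ → Ω → Fin L → ℝ)
    (β : ℕ → Ω → Fin L → Bool) : Prop where
  causal : ∀ k, Measurable[N.coordInfo X β k] (p k)
  feasible : ∀ k ω, p k ω ∈ N.powers
  erasure : IsErasure X μ (fun k ω => N.psr k (p k ω)) β

/-- An admissible schedule `κ` of PSR requirements with its arrival process `β`. -/
structure IsPsrSchedule (X : Prim Ω L n m) (μ : Measure Ω) (κ : ℕ → Ω → Fin L → ℝ)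
    (β : ℕ → Ω → Fin L → Bool) : Prop where
  causal : ∀ k, Measurable[N.coordInfo X β k] (κ k)
  feasible : ∀ k ω, κ k ω ∈ N.psrRegion k
  erasure : IsErasure X μ κ β

/-- An admissible estimator: `est k l` is a function of the information of estimator `l`. -/
def IsEstimator (X : Prim Ω L n m) (β : ℕ → Ω → Fin L → Bool)
    (est : ℕ → Fin L → Ω → EuclideanSpace ℝ (Fin n)) : Prop :=
  ∀ k l, Measurable[N.estInfo X β k l] (est k l)

/-! ### Costs -/

/-- Expected weighted squared error of an estimate `e` of the state of system `l` at time `k`. -/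
def meanSqErr (X : Prim Ω L n m) (μ : Measure Ω) (k : ℕ) (l : Fin L)
    (e : Ω → EuclideanSpace ℝ (Fin n)) : ℝ≥0∞ :=
  ∫⁻ ω, ENNReal.ofReal (wnormSq (N.Θ k l) (N.state X k l ω - e ω)) ∂μ

/-- Expected discounted cost over the times `0, …, K` of (nonnegative) stage costs `c`. -/
def finiteCost (μ : Measure Ω) (c : ℕ → Ω → ℝ) (K : ℕ) : ℝ≥0∞ :=
  ∫⁻ ω, ∑ k ∈ Finset.range (K + 1), ENNReal.ofReal (N.α ^ k * c k ω) ∂μ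

/-- Infinite-horizon expected discounted cost, the limit of `finiteCost`
(see `tendsto_finiteCost`). -/
def discCost (μ : Measure Ω) (c : ℕ → Ω → ℝ) : ℝ≥0∞ := ⨆ K, N.finiteCost μ c K

lemma tendsto_finiteCost (μ : Measure Ω) (c : ℕ → Ω → ℝ) :
    Filter.Tendsto (N.finiteCost μ c) Filter.atTop (nhds (N.discCost μ c)) := by
  refine tendsto_atTop_iSup fun a b hab => lintegral_mono fun ω => ?_
  exact Finset.sum_le_sum_of_subset (Finset.range_mono (by omega))

/-- Cost of the joint problem: powers plus weighted squared estimation errors. -/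
def jointCost (X : Prim Ω L n m) (μ : Measure Ω) (p : ℕ → Ω → Fin L → ℝ)
    (est : ℕ → Fin L → Ω → EuclideanSpace ℝ (Fin n)) : ℝ≥0∞ :=
  N.discCost μ fun k ω =>
    ∑ l, (p k ω l + N.lam l * wnormSq (N.Θ k l) (N.state X k l ω - est k l ω))

/-- Stage cost of powers `p` at covariance state `S`. -/
def powerStage (k : ℕ) (S : Fin L → Matrix (Fin n) (Fin n) ℝ) (p : Fin L → ℝ) : ℝ :=
  ∑ l, (p l + N.lam l * (N.Θ k l * S l).trace)

/-- Stage cost of PSR requirements `κ` at covariance state `S`. -/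
def psrStage (k : ℕ) (S : Fin L → Matrix (Fin n) (Fin n) ℝ) (κ : Fin L → ℝ) : ℝ :=
  ∑ l, (N.Ψ k κ l + N.lam l * (N.Θ k l * S l).trace)

/-- Covariance-based cost of a power schedule. -/
def powerCost (μ : Measure Ω) (p : ℕ → Ω → Fin L → ℝ) (β : ℕ → Ω → Fin L → Bool) : ℝ≥0∞ :=
  N.discCost μ fun k ω => N.powerStage k (N.covState β k ω) (p k ω)

/-- Covariance-based cost of a schedule of PSR requirements. -/
def psrCost (μ : Measure Ω) (κ : ℕ → Ω → Fin L → ℝ) (β : ℕ → Ω → Fin L → Bool) : ℝ≥0∞ :=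
  N.discCost μ fun k ω => N.psrStage k (N.covState β k ω) (κ k ω)

/-! ### The Markov decision process on covariances -/

/-- Deterministic policies of the MDP: at time `k` and state `S`, a feasible vector of PSRs. -/
def mdpPolicies : Set (ℕ → (Fin L → Matrix (Fin n) (Fin n) ℝ) → Fin L → ℝ) :=
  {ν | ∀ k S, ν k S ∈ N.psrRegion k}

/-- Expected discounted cost of `K` stages of the MDP under the policy `ν`, starting at time `k` in
state `S`; the next state is `stateStep S b` with probability `outcomeProb (ν k S) b`. -/
def mdpFiniteCost (ν : ℕ → (Fin L → Matrix (Fin n) (Fin n) ℝ) → Fin L → ℝ) :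
    ℕ → ℕ → (Fin L → Matrix (Fin n) (Fin n) ℝ) → ℝ≥0∞
  | 0, _, _ => 0
  | K + 1, k, S => ENNReal.ofReal (N.psrStage k S (ν k S)) +
      ENNReal.ofReal N.α * ∑ b : Fin L → Bool,
        ENNReal.ofReal (outcomeProb (ν k S) b) * mdpFiniteCost ν K (k + 1) (N.stateStep S b)

/-- Infinite-horizon cost of the MDP from the initial state `(R₀ l)_l` (limit in `K`, a supremum
because stage costs are nonnegative). -/
def mdpCost (ν : ℕ → (Fin L → Matrix (Fin n) (Fin n) ℝ) → Fin L → ℝ) : ℝ≥0∞ :=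
  ⨆ K, N.mdpFiniteCost ν K 0 N.R₀

/-- The schedule `κ` is generated by the covariance-feedback policy `ν`. -/
def Follows (ν : ℕ → (Fin L → Matrix (Fin n) (Fin n) ℝ) → Fin L → ℝ)
    (κ : ℕ → Ω → Fin L → ℝ) (β : ℕ → Ω → Fin L → Bool) : Prop :=
  ∀ k ω, κ k ω = ν k (N.covState β k ω)

end Net

end RemoteEst

end

namespace RemoteEst

/-! ### The packet success ratio as a function of the SINR -/

-- The power schedule sees the received measurements, so the arrivals carry information about the
-- plants. The separation holds because this does not change the law of the filtering error. Fix an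
-- arrival pattern `b` up to time `k`. By causality each arrival factor `outcomeProb (κ t) (b t)`
-- is, on the event of this pattern, a function of the measurements received under `b`. The product
-- of these factors is therefore a density that depends on those measurements alone
-- (`exists_density_agree`). Under a deterministic pattern the classical Kalman argument applies:
-- the error is a centered Gaussian vector, its covariance follows the Riccati recursion, and it is
-- independent of the own information and of all other links (`filterErr_fixed`). Reweighting by a
-- function of an independent quantity preserves its law, so on every event of the coordinator
-- within the pattern the true error has that same Gaussian law (`map_filterErr_restrict`).
--
-- Only finitely many patterns exist up to time `k`. Summing over them gives the conditional mean
-- and covariance, and Pythagoras' theorem gives optimality and uniqueness (`meanSqErr_eq_add`). The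
-- joint cost with the Kalman estimate is thus the covariance-based cost, whatever the schedule.
--
-- Powers and PSRs correspond because the SINR equations are linear in the powers. The matrix of the
-- system is nonsingular at every SINR vector that nonnegative powers produce: the positive channel
-- noise makes the powers a strict supersolution of the homogeneous system on the active links
-- (`isUnit_det_fmMatrix_sinr`).
--
-- The covariances are a function of the arrivals, and given the past these depend on the PSRs
-- alone, so what remains is an MDP with nonnegative stage costs. Its value is the limit of the
-- optimal finite-horizon costs. Compactness of the power set provides actions that are optimal for
-- the limit (`exists_actionCost_le_value`), and the resulting policy attains the value. The value
-- bounds the cost of every causal schedule from below, history-dependent ones included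
-- (`value_le_psrCost`). Thresholding independent uniform variables realizes any policy as a
-- schedule (`isPsrSchedule_simArrival`), so all four problems have the same attained minimum.

lemma one_sub_gaussianQ (x : ℝ) : 1 - gaussianQ x = cdf (gaussianReal 0 1) x := by
  rw [cdf_eq_real, gaussianQ, ← Set.compl_Iic, probReal_compl_eq_one_sub measurableSet_Iic]
  ring

lemma strictMono_cdf_gaussianReal : StrictMono (cdf (gaussianReal 0 1)) := by
  intro x y hxy
  -- Lebesgue measure is absolutely continuous with respect to the Gaussian, so a null interval
  -- would have length zero.
  have h0 : gaussianReal 0 1 (Set.Ioc x y) ≠ 0 := by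
    intro h
    have := (gaussianReal_absolutelyContinuous' 0 (one_ne_zero)) h
    simp [hxy.not_ge] at this
  have h1 : 0 < (gaussianReal 0 1).real (Set.Ioc x y) :=
    ENNReal.toReal_pos h0 (measure_ne_top _ _)
  have h2 := measureReal_union (μ := gaussianReal 0 1) (s₁ := Set.Iic x) (s₂ := Set.Ioc x y)
    (Set.disjoint_left.2 fun z hz hz' => not_lt.2 hz hz'.1) measurableSet_Ioc
  rw [Set.Iic_union_Ioc_eq_Iic hxy.le] at h2
  rw [cdf_eq_real, cdf_eq_real, h2]
  linarith

/-- A distribution function is right continuous, and its left jump at a point is the mass of that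
point, which vanishes here. -/
lemma continuous_cdf_gaussianReal : Continuous (cdf (gaussianReal 0 1)) := by
  have := nullSingletonClass_gaussianReal (μ := 0) (v := 1) one_ne_zero
  rw [continuous_iff_continuousAt]
  intro x
  rw [continuousAt_iff_continuous_left'_right']
  refine ⟨?_, ((cdf (gaussianReal 0 1)).right_continuous x).mono Set.Ioi_subset_Ici_self⟩
  rw [Monotone.continuousWithinAt_Iio_iff_leftLim_eq (cdf (gaussianReal 0 1)).mono]
  have h := (cdf (gaussianReal 0 1)).measure_singleton x
  rw [measure_cdf, measure_singleton] at h
  have h1 := ENNReal.ofReal_eq_zero.1 h.symm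
  exact le_antisymm ((cdf (gaussianReal 0 1)).mono.leftLim_le le_rfl) (by linarith)

lemma psrOfSinr_eq (W : ℕ) (γ : ℝ) :
    psrOfSinr W γ = cdf (gaussianReal 0 1) (4 * √γ) ^ W := by
  rw [psrOfSinr, one_sub_gaussianQ]

lemma continuous_psrOfSinr (W : ℕ) : Continuous (psrOfSinr W) := by
  have : psrOfSinr W = fun γ => cdf (gaussianReal 0 1) (4 * √γ) ^ W :=
    funext (psrOfSinr_eq W)
  rw [this]
  exact (continuous_cdf_gaussianReal.comp (by fun_prop)).pow W

lemma strictMonoOn_psrOfSinr {W : ℕ} (hW : 1 ≤ W) :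
    StrictMonoOn (psrOfSinr W) (Set.Ici 0) := by
  intro x hx y hy hxy
  rw [psrOfSinr_eq, psrOfSinr_eq]
  refine pow_lt_pow_left₀ (strictMono_cdf_gaussianReal ?_) (cdf_nonneg _ _) (by omega)
  exact mul_lt_mul_of_pos_left (Real.sqrt_lt_sqrt hx hxy) (by norm_num)

lemma psrOfSinr_nonneg (W : ℕ) (γ : ℝ) : 0 ≤ psrOfSinr W γ := by
  rw [psrOfSinr_eq]
  exact pow_nonneg (cdf_nonneg _ _) _

lemma psrOfSinr_le_one (W : ℕ) (γ : ℝ) : psrOfSinr W γ ≤ 1 := by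
  rw [psrOfSinr_eq]
  exact pow_le_one₀ (cdf_nonneg _ _) (cdf_le_one _ _)

lemma sinrOfPsr_psrOfSinr {W : ℕ} (hW : 1 ≤ W) {γ : ℝ} (hγ : 0 ≤ γ) :
    sinrOfPsr W (psrOfSinr W γ) = γ :=
  (strictMonoOn_psrOfSinr hW).injOn.leftInvOn_invFunOn hγ

lemma sinrOfPsr_nonneg {W : ℕ} {κ : ℝ} (hκ : κ ∈ psrOfSinr W '' Set.Ici 0) :
    0 ≤ sinrOfPsr W κ :=
  Function.invFunOn_mem hκ

lemma psrOfSinr_sinrOfPsr {W : ℕ} {κ : ℝ} (hκ : κ ∈ psrOfSinr W '' Set.Ici 0) :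
    psrOfSinr W (sinrOfPsr W κ) = κ :=
  Function.invFunOn_eq hκ

/-- By strict monotonicity a sublevel set of the inverse is the preimage of a sublevel set of `κ`.
The range hypothesis keeps `κ` away from the junk values of `sinrOfPsr`. -/
lemma measurable_sinrOfPsr_comp {Ω : Type*} [MeasurableSpace Ω] {W : ℕ} (hW : 1 ≤ W)
    {κ : Ω → ℝ} (hκ : Measurable κ) (hr : ∀ ω, κ ω ∈ psrOfSinr W '' Set.Ici 0) :
    Measurable fun ω => sinrOfPsr W (κ ω) := by
  refine measurable_of_Iic fun a => ?_
  by_cases ha : 0 ≤ a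
  · have : (fun ω => sinrOfPsr W (κ ω)) ⁻¹' Set.Iic a = κ ⁻¹' Set.Iic (psrOfSinr W a) := by
      ext ω
      have := (strictMonoOn_psrOfSinr hW).le_iff_le (sinrOfPsr_nonneg (hr ω)) ha
      rw [psrOfSinr_sinrOfPsr (hr ω)] at this
      exact this.symm
    rw [this]
    exact hκ measurableSet_Iic
  · have : (fun ω => sinrOfPsr W (κ ω)) ⁻¹' Set.Iic a = ∅ := by
      ext ω
      simpa using (not_le.1 ha).trans_le (sinrOfPsr_nonneg (hr ω))
    rw [this]
    exact MeasurableSet.empty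

namespace Net

variable {L n m : ℕ} (N : Net L n m)

/-! ### The Foschini–Miljanic map -/

lemma interference_pos (k : ℕ) {p : Fin L → ℝ} (hp : ∀ l, 0 ≤ p l) (l : Fin L) :
    0 < ∑ i ∈ Finset.univ.erase l, p i * N.q i l + N.noisePow k l :=
  add_pos_of_nonneg_of_pos
    (Finset.sum_nonneg fun i _ => mul_nonneg (hp i) (N.q_nonneg i l)) (N.noisePow_pos k l)

lemma sinr_nonneg (k : ℕ) {p : Fin L → ℝ} (hp : ∀ l, 0 ≤ p l) (l : Fin L) :
    0 ≤ N.sinr k p l :=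
  div_nonneg (mul_nonneg (hp l) (N.q_diag_pos l).le) (N.interference_pos k hp l).le

lemma gain_mulVec (p : Fin L → ℝ) (l : Fin L) :
    (N.gain *ᵥ p) l = (∑ i ∈ Finset.univ.erase l, p i * N.q i l) / N.q l l := by
  rw [Matrix.mulVec, dotProduct, ← Finset.add_sum_erase _ _ (Finset.mem_univ l), Finset.sum_div]
  simp only [gain, Matrix.of_apply, if_true, zero_mul, zero_add]
  refine Finset.sum_congr rfl fun i hi => ?_
  rw [if_neg (Finset.ne_of_mem_erase hi)]
  ring

lemma fmMatrix_mulVec (γ p : Fin L → ℝ) (l : Fin L) :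
    (N.fmMatrix γ *ᵥ p) l =
      p l - γ l * ((∑ i ∈ Finset.univ.erase l, p i * N.q i l) / N.q l l) := by
  rw [fmMatrix, Matrix.sub_mulVec, Matrix.one_mulVec, ← Matrix.mulVec_mulVec, Pi.sub_apply,
    Matrix.mulVec_diagonal, gain_mulVec]

/-- Row `l`, multiplied by `q l l`, is the definition of the SINR cleared of its positive
denominator. Hence `Ψ` and `psr` are mutually inverse as soon as the matrix is nonsingular. -/
lemma fmMatrix_mulVec_eq_iff (k : ℕ) {γ p : Fin L → ℝ} (hp : ∀ l, 0 ≤ p l) :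
    (N.fmMatrix γ *ᵥ p = fun l => N.noisePow k l * γ l / N.q l l) ↔ N.sinr k p = γ := by
  rw [funext_iff, funext_iff]
  refine forall_congr' fun l => ?_
  have h1 := N.interference_pos k hp l
  have h2 := N.q_diag_pos l
  rw [fmMatrix_mulVec, sinr, div_eq_iff h1.ne']
  constructor
  · intro h
    field_simp at h
    linarith
  · intro h
    field_simp
    linarith

/-- A maximum principle. A kernel vector `z` satisfies the same equations as `p` but without the
noise term. At the link where `|z l| / p l` attains its maximum `c`, this forces `|z l|` to be
strictly below `c * p l`. -/
lemma isUnit_det_fmMatrix_sinr (k : ℕ) {p : Fin L → ℝ} (hp : ∀ l, 0 ≤ p l) :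
    IsUnit (N.fmMatrix (N.sinr k p)).det := by
  rw [isUnit_iff_ne_zero]
  intro hdet
  obtain ⟨z, hz, hz0⟩ := Matrix.exists_mulVec_eq_zero_iff.2 hdet
  obtain ⟨l₀, hl₀⟩ : ∃ l, z l ≠ 0 := by
    by_contra! h
    exact hz (funext h)
  have heq := (N.fmMatrix_mulVec_eq_iff k (γ := N.sinr k p) hp).2 rfl
  have hpl : ∀ l, p l = N.sinr k p l * ((∑ i ∈ Finset.univ.erase l, p i * N.q i l) / N.q l l)
      + N.noisePow k l * N.sinr k p l / N.q l l := fun l => by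
    have := congrFun heq l
    rw [fmMatrix_mulVec] at this
    linarith
  have hzl : ∀ l, z l = N.sinr k p l * ((∑ i ∈ Finset.univ.erase l, z i * N.q i l) / N.q l l) :=
    fun l => by
      have := congrFun hz0 l
      rw [fmMatrix_mulVec] at this
      simp only [Pi.zero_apply] at this
      linarith
  have hzero : ∀ l, p l = 0 → z l = 0 := fun l h => by
    rw [hzl l, sinr, h]
    simp
  -- A link with zero power has ratio `0` by the convention for division; nothing is lost, since `z`
  -- vanishes there by `hzero`.
  obtain ⟨l, -, hl⟩ := Finset.exists_max_image Finset.univ (fun l => |z l| / p l)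
      ⟨l₀, Finset.mem_univ _⟩
  set c := |z l| / p l with hc
  have hle : ∀ i, |z i| ≤ c * p i := fun i => by
    rcases (hp i).eq_or_lt with h | h
    · rw [hzero i h.symm, ← h]
      simp
    · exact (div_le_iff₀ h).1 (hl i (Finset.mem_univ i))
  have hc0 : 0 < c := by
    by_contra! h
    have := hle l₀
    have h2 : c * p l₀ ≤ 0 := mul_nonpos_of_nonpos_of_nonneg h (hp l₀)
    exact hl₀ (abs_nonpos_iff.1 (this.trans h2))
  have hpl0 : 0 < p l := by
    rcases (hp l).eq_or_lt with h | h
    · rw [hc, ← h] at hc0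
      simp at hc0
    · exact h
  have hγ : 0 < N.sinr k p l :=
    div_pos (mul_pos hpl0 (N.q_diag_pos l)) (N.interference_pos k hp l)
  have h1 : |z l| = c * p l := by
    rw [hc]
    field_simp
  have h2 : |z l| ≤ N.sinr k p l *
      ((∑ i ∈ Finset.univ.erase l, (c * p i) * N.q i l) / N.q l l) := by
    conv_lhs => rw [hzl l]
    rw [abs_mul, abs_of_pos hγ, abs_div, abs_of_pos (N.q_diag_pos l)]
    gcongr
    · exact (N.q_diag_pos l).le
    · refine (Finset.abs_sum_le_sum_abs _ _).trans (Finset.sum_le_sum fun i _ => ?_)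
      rw [abs_mul, abs_of_nonneg (N.q_nonneg i l)]
      exact mul_le_mul_of_nonneg_right (hle i) (N.q_nonneg i l)
  have h3 : N.sinr k p l *
      ((∑ i ∈ Finset.univ.erase l, (c * p i) * N.q i l) / N.q l l) =
      c * (p l - N.noisePow k l * N.sinr k p l / N.q l l) := by
    simp only [mul_assoc]
    rw [← Finset.mul_sum]
    linear_combination (-c) * hpl l
  -- The noise contribution is strictly positive, which contradicts `h1`, `h2` and `h3` together.
  have h4 : 0 < c * (N.noisePow k l * N.sinr k p l / N.q l l) :=
    mul_pos hc0 (div_pos (mul_pos (N.noisePow_pos k l) hγ) (N.q_diag_pos l))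
  rw [h3] at h2
  linarith

lemma sinrOfPsr_psr (k : ℕ) {p : Fin L → ℝ} (hp : ∀ l, 0 ≤ p l) :
    (fun l => sinrOfPsr N.W (N.psr k p l)) = N.sinr k p :=
  funext fun l => sinrOfPsr_psrOfSinr N.W_pos (N.sinr_nonneg k hp l)

lemma Ψ_psr (k : ℕ) {p : Fin L → ℝ} (hp : ∀ l, 0 ≤ p l) : N.Ψ k (N.psr k p) = p := by
  rw [Ψ, sinrOfPsr_psr N k hp, powerOfSinr, ← (N.fmMatrix_mulVec_eq_iff k hp).2 rfl,
    Matrix.mulVec_mulVec, Matrix.nonsing_inv_mul _ (N.isUnit_det_fmMatrix_sinr k hp),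
    Matrix.one_mulVec]

lemma psr_Ψ (k : ℕ) {κ : Fin L → ℝ} (hκ : κ ∈ N.psrRegion k) : N.psr k (N.Ψ k κ) = κ := by
  obtain ⟨h1, h2, h3⟩ := hκ
  have : N.sinr k (N.Ψ k κ) = fun l => sinrOfPsr N.W (κ l) := by
    rw [← N.fmMatrix_mulVec_eq_iff k fun l => (h3 l).1, Ψ, powerOfSinr, Matrix.mulVec_mulVec,
      Matrix.mul_nonsing_inv _ h2, Matrix.one_mulVec]
  funext l
  rw [psr, this]
  exact psrOfSinr_sinrOfPsr (h1 l)

lemma psr_mem_psrRegion (k : ℕ) {p : Fin L → ℝ} (hp : p ∈ N.powers) :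
    N.psr k p ∈ N.psrRegion k := by
  have hp0 : ∀ l, 0 ≤ p l := fun l => (hp l).1
  refine ⟨fun l => ⟨_, N.sinr_nonneg k hp0 l, rfl⟩, ?_, ?_⟩
  · rw [N.sinrOfPsr_psr k hp0]
    exact N.isUnit_det_fmMatrix_sinr k hp0
  · rw [N.Ψ_psr k hp0]
    exact hp

lemma mapsTo_Ψ (k : ℕ) : Set.MapsTo (N.Ψ k) (N.psrRegion k) N.powers := fun _ h => h.2.2

lemma mapsTo_psr (k : ℕ) : Set.MapsTo (N.psr k) N.powers (N.psrRegion k) :=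
  fun _ h => N.psr_mem_psrRegion k h

lemma invOn_psr_Ψ (k : ℕ) : Set.InvOn (N.psr k) (N.Ψ k) (N.psrRegion k) N.powers :=
  ⟨fun _ h => N.psr_Ψ k h, fun _ h => N.Ψ_psr k fun l => (h l).1⟩

lemma mem_Icc_of_mem_psrRegion {k : ℕ} {κ : Fin L → ℝ} (hκ : κ ∈ N.psrRegion k) (l : Fin L) :
    κ l ∈ Set.Icc (0 : ℝ) 1 := by
  obtain ⟨γ, -, h⟩ := hκ.1 l
  rw [← h]
  exact ⟨psrOfSinr_nonneg _ _, psrOfSinr_le_one _ _⟩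

lemma isCompact_powers : IsCompact N.powers := by
  have : N.powers = Set.univ.pi fun _ => Set.Icc 0 N.pmax := by
    ext p
    simp only [powers, Set.mem_ofPred_eq, Set.mem_univ_pi, Set.mem_Icc]
  rw [this]
  exact isCompact_univ_pi fun _ => isCompact_Icc

lemma zero_mem_powers : (0 : Fin L → ℝ) ∈ N.powers := fun _ => ⟨le_rfl, N.pmax_nonneg⟩

lemma continuousOn_psr (k : ℕ) : ContinuousOn (N.psr k) N.powers := by
  refine continuousOn_pi.2 fun l => (continuous_psrOfSinr N.W).comp_continuousOn ?_
  refine ContinuousOn.div (by fun_prop) (by fun_prop) fun p hp => ?_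
  exact (N.interference_pos k (fun l => (hp l).1) l).ne'

lemma measurable_psr (k : ℕ) : Measurable (N.psr k) := by
  refine measurable_pi_lambda _ fun l => (continuous_psrOfSinr N.W).measurable.comp ?_
  unfold sinr
  fun_prop

/-- The inverse is the adjugate, polynomial in the entries, times the inverse of the determinant.
Real inversion is measurable with its value at `0`, so singular matrices need no exception. -/
lemma measurable_inv_matrix {ι : Type*} [Fintype ι] [DecidableEq ι] :
    Measurable fun A : ι → ι → ℝ => fun i j => (Matrix.of A)⁻¹ i j := by
  have hdet : Measurable fun A : ι → ι → ℝ => (Matrix.of A).det :=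
    (Continuous.matrix_det (by fun_prop)).measurable
  have hadj : ∀ i j, Measurable fun A : ι → ι → ℝ => (Matrix.of A).adjugate i j := fun i j => by
    refine Continuous.measurable (Continuous.matrix_elem (Continuous.matrix_adjugate ?_) i j)
    fun_prop
  refine measurable_pi_lambda _ fun i => measurable_pi_lambda _ fun j => ?_
  simp only [Matrix.inv_def, Matrix.smul_apply, smul_eq_mul, Ring.inverse_eq_inv']
  exact hdet.inv.mul (hadj i j)

lemma measurable_powerOfSinr (k : ℕ) : Measurable (N.powerOfSinr k) := by
  have h1 : Measurable fun γ : Fin L → ℝ => fun i j => (N.fmMatrix γ)⁻¹ i j := by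
    refine measurable_inv_matrix.comp (g := fun A i j => (Matrix.of A)⁻¹ i j)
      (f := fun γ i j => N.fmMatrix γ i j) ?_
    refine measurable_pi_lambda _ fun i => measurable_pi_lambda _ fun j => ?_
    simp only [fmMatrix, Matrix.sub_apply, Matrix.diagonal_mul]
    fun_prop
  refine measurable_pi_lambda _ fun l => ?_
  simp only [powerOfSinr, Matrix.mulVec, dotProduct]
  refine Finset.measurable_sum _ fun i _ => ?_
  refine (((measurable_pi_apply i).comp (measurable_pi_apply l)).comp h1).mul ?_
  fun_prop

lemma measurable_Ψ_comp {Ω : Type*} [MeasurableSpace Ω] (k : ℕ) {κ : Ω → Fin L → ℝ}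
    (hκ : Measurable κ) (hr : ∀ ω, κ ω ∈ N.psrRegion k) : Measurable fun ω => N.Ψ k (κ ω) := by
  refine (N.measurable_powerOfSinr k).comp (measurable_pi_lambda _ fun l => ?_)
  exact measurable_sinrOfPsr_comp N.W_pos ((measurable_pi_apply l).comp hκ) fun ω => (hr ω).1 l

end Net

/-! ### Auxiliary measure theory -/

lemma measurable_toEuclideanLin {Ω : Type*} {mΩ : MeasurableSpace Ω} {a b : ℕ}
    (A : Matrix (Fin a) (Fin b) ℝ) {f : Ω → EuclideanSpace ℝ (Fin b)} (hf : Measurable f) :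
    Measurable fun ω => A.toEuclideanLin (f ω) :=
  (LinearMap.continuous_of_finiteDimensional A.toEuclideanLin).measurable.comp hf

/-- The defining property of conditional probability, extended from sets to nonnegative functions by
the monotone class argument. It lets the arrival law of `IsErasure` act on costs that may be
infinite. -/
lemma setLIntegral_eq_of_condExp_indicator {Ω : Type*} {m m0 : MeasurableSpace Ω} (hm : m ≤ m0)
    {μ : Measure Ω} [IsFiniteMeasure μ] {A : Set Ω} (hA : MeasurableSet A) {q : Ω → ℝ}
    (hq : μ[A.indicator (fun _ => (1 : ℝ)) | m] =ᵐ[μ] q) {f : Ω → ℝ≥0∞} (hf : Measurable[m] f) :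
    ∫⁻ ω in A, f ω ∂μ = ∫⁻ ω, ENNReal.ofReal (q ω) * f ω ∂μ := by
  set g := μ[A.indicator (fun _ => (1 : ℝ)) | m] with hg
  have hgm : Measurable g := (stronglyMeasurable_condExp.mono hm).measurable
  have hint : Integrable (A.indicator fun _ => (1 : ℝ)) μ := (integrable_const 1).indicator hA
  have hg0 : 0 ≤ᵐ[μ] g := condExp_nonneg
    (Filter.Eventually.of_forall fun ω => Set.indicator_nonneg (fun _ _ => zero_le_one) ω)
  suffices h : ∫⁻ ω in A, f ω ∂μ = ∫⁻ ω, ENNReal.ofReal (g ω) * f ω ∂μ by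
    rw [h]
    refine lintegral_congr_ae ?_
    filter_upwards [hq] with ω hω
    rw [hω]
  refine @Measurable.ennreal_induction Ω m
    (fun f => ∫⁻ ω in A, f ω ∂μ = ∫⁻ ω, ENNReal.ofReal (g ω) * f ω ∂μ) ?_ ?_ ?_ f hf
  · intro c S hS
    have hS0 : MeasurableSet S := hm S hS
    have e : (fun ω => ENNReal.ofReal (g ω) * S.indicator (fun _ => c) ω)
        = S.indicator fun ω => c * ENNReal.ofReal (g ω) := by
      ext ω
      by_cases h : ω ∈ S <;> simp [h, mul_comm]
    rw [e, lintegral_indicator hS0 fun _ => c, lintegral_indicator hS0 fun ω => _,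
      lintegral_const_mul _ hgm.ennreal_ofReal,
      ← ofReal_integral_eq_lintegral_ofReal integrable_condExp.integrableOn
        (ae_restrict_of_ae hg0), setIntegral_condExp hm hint hS, setLIntegral_const,
            setIntegral_indicator hA, Measure.restrict_apply hS0]
    simp
  · intro f g' _ hf hg' h1 h2
    simp only [Pi.add_apply, mul_add]
    rw [lintegral_add_left (hf.mono hm le_rfl), h1, h2,
      lintegral_add_left (f := fun ω => ENNReal.ofReal (g ω) * f ω)
        (hgm.ennreal_ofReal.mul (hf.mono hm le_rfl))]
  · intro f hf hmono h
    simp only [ENNReal.mul_iSup]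
    rw [lintegral_iSup (fun i => (hf i).mono hm le_rfl) hmono, lintegral_iSup]
    · exact iSup_congr h
    · exact fun i => hgm.ennreal_ofReal.mul ((hf i).mono hm le_rfl)
    · intro i j hij ω
      exact mul_le_mul_right (hmono hij ω) _

/-! ### Measurability of the basic processes -/

namespace Prim

variable {Ω : Type*} {L n m : ℕ} (X : Prim Ω L n m)

lemma measurable_x₀_plantSigma (l : Fin L) : Measurable[X.plantSigma] (X.x₀ l) :=
  (comap_measurable (X.x₀ l)).mono
    (le_sup_of_le_left (le_sup_of_le_left (le_iSup (fun l => X.sigma (.init l)) l))) le_rfl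

lemma measurable_w_plantSigma (k : ℕ) (l : Fin L) : Measurable[X.plantSigma] (X.w k l) :=
  (comap_measurable (X.w k l)).mono
    (le_sup_of_le_left (le_sup_of_le_right
      (le_iSup_of_le k (le_iSup (fun l => X.sigma (.state k l)) l)))) le_rfl

lemma measurable_v_plantSigma (k : ℕ) (l : Fin L) : Measurable[X.plantSigma] (X.v k l) :=
  (comap_measurable (X.v k l)).mono
    (le_sup_of_le_right
      (le_iSup_of_le k (le_iSup (fun l => X.sigma (.meas k l)) l))) le_rfl

lemma HasLaws.sigma_le [MeasurableSpace Ω] {X : Prim Ω L n m} {N : Net L n m} {μ : Measure Ω}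
    (hX : X.HasLaws N μ) (i : PrimIdx L) : X.sigma i ≤ ‹MeasurableSpace Ω› := by
  cases i with
  | init l => exact (hX.meas_x₀ l).comap_le
  | state k l => exact (hX.meas_w k l).comap_le
  | meas k l => exact (hX.meas_v k l).comap_le
  | unif k l => exact (hX.meas_U k l).comap_le

lemma HasLaws.plantSigma_le [MeasurableSpace Ω] {X : Prim Ω L n m} {N : Net L n m} {μ : Measure Ω}
    (hX : X.HasLaws N μ) : X.plantSigma ≤ ‹MeasurableSpace Ω› :=
  sup_le (sup_le (iSup_le fun _ => hX.sigma_le _) (iSup_le fun _ => iSup_le fun _ => hX.sigma_le _))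
    (iSup_le fun _ => iSup_le fun _ => hX.sigma_le _)

end Prim

namespace Net

variable {L n m : ℕ} (N : Net L n m) {Ω : Type*} (X : Prim Ω L n m)

/-- The σ-algebra is left free, for use with the ambient one, `plantSigma`, and those generated by
the past or by the other links. -/
lemma measurable_state {mΩ : MeasurableSpace Ω} {l : Fin L} {k : ℕ}
    (h0 : Measurable (X.x₀ l)) (hw : ∀ t < k, Measurable (X.w t l)) :
    Measurable (N.state X k l) := by
  induction k with
  | zero => exact h0
  | succ k ih =>
    exact (measurable_toEuclideanLin _ (ih fun t ht => hw t (by omega))).add (hw k (by omega))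

lemma measurable_output {mΩ : MeasurableSpace Ω} {l : Fin L} {k : ℕ}
    (h0 : Measurable (X.x₀ l)) (hw : ∀ t < k, Measurable (X.w t l)) (hv : Measurable (X.v k l)) :
    Measurable (N.output X k l) :=
  (measurable_toEuclideanLin _ (N.measurable_state X h0 hw)).add hv

lemma measurable_output_plantSigma (k : ℕ) (l : Fin L) :
    Measurable[X.plantSigma] (N.output X k l) :=
  @measurable_output L n m N Ω X X.plantSigma l k (X.measurable_x₀_plantSigma l)
    (fun t _ => X.measurable_w_plantSigma t l) (X.measurable_v_plantSigma k l)

lemma measurable_received {mΩ : MeasurableSpace Ω} {β : ℕ → Ω → Fin L → Bool} {l : Fin L} {k : ℕ}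
    (hβ : Measurable fun ω => β k ω l) (hy : Measurable (N.output X k l)) :
    Measurable (N.received X β k l) :=
  Measurable.ite (hβ (measurableSet_singleton true)) hy measurable_const

variable (β : ℕ → Ω → Fin L → Bool)

lemma measurable_arrival_estInfo {t k : ℕ} (h : t < k) (l : Fin L) :
    Measurable[N.estInfo X β k l] fun ω => β t ω l :=
  (comap_measurable _).mono (le_iSup_of_le (⟨t, h⟩ : Fin k) le_sup_left) le_rfl

lemma measurable_received_estInfo {t k : ℕ} (h : t < k) (l : Fin L) :
    Measurable[N.estInfo X β k l] (N.received X β t l) :=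
  (comap_measurable _).mono (le_iSup_of_le (⟨t, h⟩ : Fin k) le_sup_right) le_rfl

lemma estInfo_le_coordInfo (k : ℕ) (l : Fin L) : N.estInfo X β k l ≤ N.coordInfo X β k :=
  le_iSup (fun l => N.estInfo X β k l) l

lemma measurable_arrival_coordInfo {t k : ℕ} (h : t < k) :
    Measurable[N.coordInfo X β k] (β t) :=
  @measurable_pi_lambda _ _ _ (N.coordInfo X β k) _ _ fun l =>
    (N.measurable_arrival_estInfo X β h l).mono (N.estInfo_le_coordInfo X β k l) le_rfl

lemma measurable_arrival_fullPast {t k : ℕ} (h : t < k) :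
    Measurable[fullPast X β k] (β t) :=
  (comap_measurable _).mono (le_sup_of_le_right
    (le_iSup (fun t : Fin k => MeasurableSpace.comap (β t) inferInstance) ⟨t, h⟩)) le_rfl

lemma coordInfo_le_fullPast (k : ℕ) : N.coordInfo X β k ≤ fullPast X β k := by
  refine iSup_le fun l => iSup_le fun t => ?_
  have h1 : Measurable[fullPast X β k] fun ω => β t ω l :=
    (measurable_pi_apply l).comp (measurable_arrival_fullPast X β t.2)
  refine sup_le h1.comap_le ?_
  refine (@measurable_received L n m N Ω X (fullPast X β k) β l t h1 ?_).comap_le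
  exact (N.measurable_output_plantSigma X t l).mono le_sup_left le_rfl

lemma fullPast_le [MeasurableSpace Ω] {μ : Measure Ω} {N : Net L n m} {X : Prim Ω L n m}
    (hX : X.HasLaws N μ) {β : ℕ → Ω → Fin L → Bool} (hβ : ∀ k, Measurable (β k)) (k : ℕ) :
    fullPast X β k ≤ ‹MeasurableSpace Ω› :=
  sup_le hX.plantSigma_le (iSup_le fun t => (hβ t).comap_le)

/-! ### Deterministic arrival patterns -/

/-- The event that the arrivals before time `k` follow the pattern `b`. -/
def agree (k : ℕ) (b : ℕ → Fin L → Bool) : Set Ω := {ω | ∀ t < k, β t ω = b t}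

/-- The arrival process that follows a deterministic pattern. -/
abbrev fixed (b : ℕ → Fin L → Bool) : ℕ → Ω → Fin L → Bool := fun t _ => b t

lemma measurableSet_agree (k : ℕ) (b : ℕ → Fin L → Bool) :
    MeasurableSet[N.coordInfo X β k] (agree β k b) := by
  have : agree β k b = ⋂ t : Fin k, β t ⁻¹' {b t} := by
    ext ω
    simp only [agree, Set.mem_ofPred_eq, Set.mem_iInter, Set.mem_preimage, Set.mem_singleton_iff]
    exact ⟨fun h t => h t t.2, fun h t ht => h ⟨t, ht⟩⟩
  rw [this]
  exact @MeasurableSet.iInter _ _ (N.coordInfo X β k) _ _ fun t =>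
    N.measurable_arrival_coordInfo X β t.2 (measurableSet_singleton _)

/-- Two sample spaces are allowed so that a random trajectory can be compared with `covSeq`, which
lives on `Unit`. -/
lemma covState_congr {Ω' : Type*} {β : ℕ → Ω → Fin L → Bool} {β' : ℕ → Ω' → Fin L → Bool} {k : ℕ}
    {ω : Ω} {ω' : Ω'}
    (h : ∀ t < k, β t ω = β' t ω') : N.covState β k ω = N.covState β' k ω' := by
  induction k with
  | zero => rfl
  | succ k ih => rw [covState, covState, ih fun t ht => h t (by omega), h k (by omega)]

lemma kalman_congr {β β' : ℕ → Ω → Fin L → Bool} {k : ℕ} {ω : Ω}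
    (h : ∀ t < k, β t ω = β' t ω) (l : Fin L) :
    N.kalman X β k l ω = N.kalman X β' k l ω := by
  induction k with
  | zero => rfl
  | succ k ih =>
    rw [kalman, kalman, ih fun t ht => h t (by omega), h k (by omega),
      N.covState_congr fun t ht => h t (by omega)]

/-- The covariance state along a deterministic arrival pattern. -/
noncomputable def covSeq (b : ℕ → Fin L → Bool) (k : ℕ) : Fin L → Matrix (Fin n) (Fin n) ℝ :=
  N.covState (Ω := Unit) (fixed b) k ()

lemma covState_eq_of_mem_agree {β : ℕ → Ω → Fin L → Bool} {k : ℕ} {b : ℕ → Fin L → Bool} {ω : Ω}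
    (h : ω ∈ agree β k b) : N.covState β k ω = N.covSeq b k :=
  N.covState_congr fun t ht => h t ht

lemma kalman_eq_of_mem_agree {β : ℕ → Ω → Fin L → Bool} {k : ℕ} {b : ℕ → Fin L → Bool} {ω : Ω}
    (h : ω ∈ agree β k b) (l : Fin L) : N.kalman X β k l ω = N.kalman X (fixed b) k l ω :=
  N.kalman_congr X (β' := fixed b) (fun t ht => h t ht) l

/-- On the event `agree β k b` the indicators are constants and the received measurements are those
of the pattern `b`. The random information structure may thus be replaced by a fixed one there,
which makes causal powers functions of the plants. -/
lemma comap_val_coordInfo (k : ℕ) (b : ℕ → Fin L → Bool) :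
    (N.coordInfo X β k).comap (Subtype.val : agree β k b → Ω) =
      (N.coordInfo X (fixed b) k).comap Subtype.val := by
  simp only [coordInfo, estInfo, MeasurableSpace.comap_iSup, MeasurableSpace.comap_sup,
    MeasurableSpace.comap_comp]
  refine iSup_congr fun l => iSup_congr fun t => ?_
  congr 2
  · ext ω
    exact congrFun (ω.2 t t.2) l
  · funext ω
    simp only [Function.comp, received, ω.2 t t.2]

lemma exists_measurableSet_fixed {k : ℕ} (b : ℕ → Fin L → Bool) {A : Set Ω}
    (hA : MeasurableSet[N.coordInfo X β k] A) :
    ∃ A', MeasurableSet[N.coordInfo X (fixed b) k] A' ∧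
      A ∩ agree β k b = A' ∩ agree β k b := by
  have h : MeasurableSet[(N.coordInfo X β k).comap (Subtype.val : agree β k b → Ω)]
      (Subtype.val ⁻¹' A) := ⟨A, hA, rfl⟩
  rw [comap_val_coordInfo] at h
  obtain ⟨A', hA', h⟩ := h
  refine ⟨A', hA', ?_⟩
  ext ω
  simp only [Set.mem_inter_iff]
  refine and_congr_left fun hω => ?_
  exact (Set.ext_iff.1 h ⟨ω, hω⟩).symm

lemma exists_measurable_fixed {Z : Type*} [MeasurableSpace Z] [StandardBorelSpace Z] [Nonempty Z]
    {k : ℕ} (b : ℕ → Fin L → Bool) {f : Ω → Z} (hf : Measurable[N.coordInfo X β k] f) :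
    ∃ f' : Ω → Z, Measurable[N.coordInfo X (fixed b) k] f' ∧ ∀ ω ∈ agree β k b, f ω = f' ω := by
  have h : Measurable[(N.coordInfo X β k).comap (Subtype.val : agree β k b → Ω)]
      (f ∘ Subtype.val) := hf.comp (comap_measurable _)
  rw [comap_val_coordInfo] at h
  obtain ⟨f', hf', h⟩ := @Measurable.exists_eq_measurable_comp _ _ _ (N.coordInfo X (fixed b) k)
    _ _ _ _ _ h
  exact ⟨f', hf', fun ω hω => congrFun h ⟨ω, hω⟩⟩

lemma coordInfo_fixed_le_plantSigma (k : ℕ) (b : ℕ → Fin L → Bool) :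
    N.coordInfo X (fixed b) k ≤ X.plantSigma :=
  iSup_le fun l => iSup_le fun t => sup_le measurable_const.comap_le
    (@measurable_received L n m N Ω X X.plantSigma _ l t measurable_const
      (N.measurable_output_plantSigma X t l)).comap_le

lemma measurable_outcomeProb (b : Fin L → Bool) :
    Measurable fun κ : Fin L → ℝ => outcomeProb κ b := by
  unfold outcomeProb
  refine Finset.measurable_fun_prod _ fun l _ => ?_
  split_ifs <;> fun_prop

/-- On the event of a given arrival pattern, the law of the plants has a density that depends on
the received measurements alone. -/
lemma exists_density_agree [MeasurableSpace Ω] {μ : Measure Ω} [IsProbabilityMeasure μ]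
    {X : Prim Ω L n m} (hX : X.HasLaws N μ) {β : ℕ → Ω → Fin L → Bool} {κ : ℕ → Ω → Fin L → ℝ}
    (hκ : ∀ k, Measurable[N.coordInfo X β k] (κ k)) (he : IsErasure X μ κ β)
    (k : ℕ) (b : ℕ → Fin L → Bool) :
    ∃ g : Ω → ℝ≥0∞, Measurable[N.coordInfo X (fixed b) k] g ∧
      ∀ f : Ω → ℝ≥0∞, Measurable[X.plantSigma] f →
        ∫⁻ ω in agree β k b, f ω ∂μ = ∫⁻ ω, g ω * f ω ∂μ := by
  induction k with
  | zero =>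
    refine ⟨fun _ => 1, measurable_const, fun f _ => ?_⟩
    have : agree β 0 b = Set.univ := by
      ext ω
      simp [agree]
    simp [this]
  | succ k ih =>
    obtain ⟨g, hg, hgf⟩ := ih
    -- By causality the success probabilities agree on this pattern with a function `κ'` of the
    -- measurements received under `b`. Each time step multiplies the density by the resulting
    -- probability of `b k`.
    obtain ⟨κ', hκ', hκκ'⟩ := N.exists_measurable_fixed X β b (hκ k)
    have hfp := fullPast_le hX he.meas k
    have hmono : N.coordInfo X (fixed b) k ≤ N.coordInfo X (fixed b) (k + 1) :=
      iSup_le fun l => iSup_le fun t => sup_le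
        (N.measurable_arrival_estInfo X (fixed b) (t.2.trans k.lt_succ_self) l |>.mono
          (N.estInfo_le_coordInfo X _ _ l) le_rfl).comap_le
        (N.measurable_received_estInfo X (fixed b) (t.2.trans k.lt_succ_self) l |>.mono
          (N.estInfo_le_coordInfo X _ _ l) le_rfl).comap_le
    have hprob : Measurable[N.coordInfo X (fixed b) k] fun ω =>
        ENNReal.ofReal (outcomeProb (κ' ω) (b k)) :=
      ENNReal.measurable_ofReal.comp ((measurable_outcomeProb (b k)).comp hκ')
    refine ⟨fun ω => g ω * ENNReal.ofReal (outcomeProb (κ' ω) (b k)),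
      (hg.mul hprob).mono hmono le_rfl, fun f hf => ?_⟩
    have hE : MeasurableSet[fullPast X β k] (agree β k b) :=
      N.coordInfo_le_fullPast X β k _ (N.measurableSet_agree X β k b)
    have hAm : MeasurableSet {ω | β k ω = b k} := he.meas k (measurableSet_singleton (b k))
    have hsplit : agree β (k + 1) b = agree β k b ∩ {ω | β k ω = b k} := by
      ext ω
      simp only [agree, Set.mem_ofPred_eq, Set.mem_inter_iff]
      exact ⟨fun h => ⟨fun t ht => h t (by omega), h k (by omega)⟩, fun h t ht => by
        rcases Nat.lt_succ_iff_lt_or_eq.1 ht with h' | rfl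
        exacts [h.1 t h', h.2]⟩
    have hf' : Measurable[fullPast X β k] ((agree β k b).indicator f) :=
      (hf.mono le_sup_left le_rfl).indicator hE
    -- The arrival law is conditional on all the plants, so an arbitrary `plantSigma`-measurable
    -- `f`, cut off to the earlier pattern, is a legitimate test function.
    have h1 := setLIntegral_eq_of_condExp_indicator hfp hAm (he.law k (b k)) hf'
    rw [setLIntegral_indicator (hfp _ hE), ← hsplit] at h1
    rw [h1]
    have h2 : ∀ ω, ENNReal.ofReal (outcomeProb (κ k ω) (b k)) * (agree β k b).indicator f ω =
        (agree β k b).indicator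
          (fun ω => ENNReal.ofReal (outcomeProb (κ' ω) (b k)) * f ω) ω := fun ω => by
      by_cases hω : ω ∈ agree β k b
      · simp [hω, hκκ' ω hω]
      · simp [hω]
    simp only [h2]
    have h3 := hgf (fun ω => ENNReal.ofReal (outcomeProb (κ' ω) (b k)) * f ω) ((hprob.mono
      (N.coordInfo_fixed_le_plantSigma X k b) le_rfl).mul hf)
    rw [lintegral_indicator (hfp _ hE), h3]
    simp only [mul_assoc]

end Net

-- Independence of joined σ-algebras, and uncorrelated linear images

/-- Intersections `s ∩ t` with `s` in `m₂` and `t` in `m₃` form a π-system generating `m₂ ⊔ m₃`. On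
it the product formula follows by splitting off `t` first and `s` next. -/
lemma Indep.sup_right_of_sup_left {Ω : Type*} {m₁ m₂ m₃ m0 : MeasurableSpace Ω} {μ : Measure Ω}
    [IsProbabilityMeasure μ] (h₁ : m₁ ≤ m0) (h₂ : m₂ ≤ m0) (h₃ : m₃ ≤ m0)
    (h12 : Indep m₁ m₂ μ) (h123 : Indep (m₁ ⊔ m₂) m₃ μ) : Indep m₁ (m₂ ⊔ m₃) μ := by
  set π : Set (Set Ω) := Set.image2 (· ∩ ·) {s | MeasurableSet[m₂] s} {s | MeasurableSet[m₃] s}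
    with hπ
  have hgen : m₂ ⊔ m₃ = MeasurableSpace.generateFrom π := by
    apply le_antisymm
    · refine sup_le (fun s hs => ?_) (fun s hs => ?_)
      · exact MeasurableSpace.measurableSet_generateFrom
          ⟨s, hs, Set.univ, MeasurableSet.univ, Set.inter_univ s⟩
      · exact MeasurableSpace.measurableSet_generateFrom
          ⟨Set.univ, MeasurableSet.univ, s, hs, Set.univ_inter s⟩
    · refine MeasurableSpace.generateFrom_le ?_
      rintro _ ⟨s, hs, t, ht, rfl⟩
      exact MeasurableSet.inter ((le_sup_left : m₂ ≤ m₂ ⊔ m₃) s hs)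
        ((le_sup_right : m₃ ≤ m₂ ⊔ m₃) t ht)
  have hpi : IsPiSystem π := by
    rintro _ ⟨s, hs, t, ht, rfl⟩ _ ⟨s', hs', t', ht', rfl⟩ _
    exact ⟨s ∩ s', @MeasurableSet.inter _ m₂ _ _ hs hs',
      t ∩ t', @MeasurableSet.inter _ m₃ _ _ ht ht',
      Set.inter_inter_inter_comm s s' t t'⟩
  refine IndepSets.indep h₁ (sup_le h₂ h₃) (@MeasurableSpace.isPiSystem_measurableSet _ m₁) hpi
    (@MeasurableSpace.generateFrom_measurableSet _ m₁).symm hgen ?_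
  rw [IndepSets_iff]
  rintro a _ ha ⟨s, hs, t, ht, rfl⟩
  rw [Indep_iff] at h12 h123
  have ha' : MeasurableSet[m₁] a := ha
  have e1 := h123 (a ∩ s) t (MeasurableSet.inter ((le_sup_left : m₁ ≤ m₁ ⊔ m₂) a ha')
    ((le_sup_right : m₂ ≤ m₁ ⊔ m₂) s hs)) ht
  have e2 := h123 s t ((le_sup_right : m₂ ≤ m₁ ⊔ m₂) s hs) ht
  show μ (a ∩ (s ∩ t)) = μ a * μ (s ∩ t)
  rw [← Set.inter_assoc, e1, e2, h12 a s ha' hs, mul_assoc]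

lemma ofLp_toEuclideanLin {a b : ℕ} (A : Matrix (Fin a) (Fin b) ℝ) (x : EuclideanSpace ℝ (Fin b)) :
    (A.toEuclideanLin x).ofLp = A *ᵥ x.ofLp := rfl

lemma memLp_dotProduct {Ω : Type*} [MeasurableSpace Ω] {μ : Measure Ω} {d : ℕ}
    {e : Ω → EuclideanSpace ℝ (Fin d)} (he : MemLp e 2 μ)
    (x : Fin d → ℝ) : MemLp (fun ω => x ⬝ᵥ (e ω).ofLp) 2 μ := by
  have h : (fun ω => x ⬝ᵥ (e ω).ofLp) = fun ω => inner ℝ (WithLp.toLp 2 x) (e ω) := by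
    funext ω
    rw [EuclideanSpace.inner_eq_star_dotProduct]
    simp [dotProduct_comm]
  rw [h]
  exact he.const_inner _

lemma covariance_dotProduct_eq_zero {Ω : Type*} [MeasurableSpace Ω] {μ : Measure Ω} {d d' : ℕ}
    {e : Ω → EuclideanSpace ℝ (Fin d)}
    {f : Ω → EuclideanSpace ℝ (Fin d')} (h : IndepFun e f μ) (he : MemLp e 2 μ) (hf : MemLp f 2 μ)
    (x : Fin d → ℝ) (y : Fin d' → ℝ) :
    cov[fun ω => x ⬝ᵥ (e ω).ofLp, fun ω => y ⬝ᵥ (f ω).ofLp; μ] = 0 := by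
  have h1 : IndepFun (fun ω => x ⬝ᵥ (e ω).ofLp) (fun ω => y ⬝ᵥ (f ω).ofLp) μ :=
    h.comp (φ := fun z : EuclideanSpace ℝ (Fin d) => x ⬝ᵥ z.ofLp)
      (ψ := fun z : EuclideanSpace ℝ (Fin d') => y ⬝ᵥ z.ofLp)
      (by unfold dotProduct; fun_prop) (by unfold dotProduct; fun_prop)
  exact h1.covariance_eq_zero (memLp_dotProduct he x) (memLp_dotProduct hf y)

/-! ### Centered Gaussian vectors and their covariance matrices -/

section Gauss

variable {Ω : Type*} [mΩ : MeasurableSpace Ω] {μ : Measure Ω} [IsProbabilityMeasure μ]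

/-- A centered Gaussian vector with covariance matrix `P`. -/
structure IsCenteredGaussian {d : ℕ} (μ : Measure Ω) (e : Ω → EuclideanSpace ℝ (Fin d))
    (P : Matrix (Fin d) (Fin d) ℝ) : Prop where
  meas : Measurable e
  gauss : HasGaussianLaw e μ
  mean : ∫ ω, e ω ∂μ = 0
  cov : ∀ x y : Fin d → ℝ, cov[fun ω => x ⬝ᵥ (e ω).ofLp, fun ω => y ⬝ᵥ (e ω).ofLp; μ] = x ⬝ᵥ P *ᵥ y

lemma isCenteredGaussian_of_map_eq {d : ℕ} {e : Ω → EuclideanSpace ℝ (Fin d)}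
    {c : EuclideanSpace ℝ (Fin d)} {R : Matrix (Fin d) (Fin d) ℝ} (hR : R.PosSemidef)
    (he : Measurable e) (h : μ.map e = multivariateGaussian c R) :
    IsCenteredGaussian μ (fun ω => e ω - c) R := by
  have hg : HasGaussianLaw e μ := ⟨by rw [h]; infer_instance⟩
  have hmean : ∫ ω, e ω ∂μ = c := by
    have := integral_id_multivariateGaussian (μ := c) (S := R)
    rwa [← h, integral_map he.aemeasurable (by fun_prop)] at this
  have hg' : HasGaussianLaw (fun ω => e ω - c) μ := ⟨by
    have : μ.map (fun ω => e ω - c) = (μ.map e).map (fun z => z - c) := by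
      rw [Measure.map_map (by fun_prop) he]; rfl
    rw [this, h]
    -- Translations are known to preserve Gaussian measures in the form `z + (-c)`.
    have e2 : (fun z : EuclideanSpace ℝ (Fin d) => z - c) = fun z => z + (-c) := by
      funext z; rw [sub_eq_add_neg]
    rw [e2]
    infer_instance⟩
  refine ⟨by fun_prop, hg', ?_, fun x y => ?_⟩
  · rw [integral_sub hg.integrable (integrable_const c), hmean]
    simp
  · have h1 := covarianceBilin_multivariateGaussian (μ := c) hR (WithLp.toLp 2 x) (WithLp.toLp 2 y)
    rw [covarianceBilin_apply_eq_cov IsGaussian.memLp_two_id, ← h,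
      covariance_map_fun (by fun_prop) (by fun_prop) he.aemeasurable] at h1
    have h2 : ∀ z : Fin d → ℝ, (fun ω => z ⬝ᵥ (e ω - c).ofLp) =
        fun ω => z ⬝ᵥ (e ω).ofLp - z ⬝ᵥ c.ofLp := fun z => by
      funext ω
      rw [WithLp.ofLp_sub, dotProduct_sub]
    have hI : ∀ z : Fin d → ℝ, MemLp (fun ω => z ⬝ᵥ (e ω).ofLp) 2 μ := fun z =>
      memLp_dotProduct hg.memLp_two z
    rw [h2 x, h2 y, covariance_sub_const_left ((hI x).integrable one_le_two),
      covariance_sub_const_right ((hI y).integrable one_le_two), ← h1]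
    congr 1 <;> funext ω <;> rw [EuclideanSpace.inner_eq_star_dotProduct] <;>
      simp [dotProduct_comm]

variable {n m : ℕ} {e w : Ω → EuclideanSpace ℝ (Fin n)} {v : Ω → EuclideanSpace ℝ (Fin m)}
  {P R₁ : Matrix (Fin n) (Fin n) ℝ} {R₂ : Matrix (Fin m) (Fin m) ℝ}

lemma covariance_dotProduct_triple (he : IsCenteredGaussian μ e P) (hw : IsCenteredGaussian μ w R₁)
    (hv : IsCenteredGaussian μ v R₂) (hew : IndepFun e w μ) (hev : IndepFun e v μ)
    (hwv : IndepFun w v μ) (x₁ x₂ y₁ y₂ : Fin n → ℝ) (x₃ y₃ : Fin m → ℝ) :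
    cov[fun ω => x₁ ⬝ᵥ (e ω).ofLp + x₂ ⬝ᵥ (w ω).ofLp + x₃ ⬝ᵥ (v ω).ofLp,
      fun ω => y₁ ⬝ᵥ (e ω).ofLp + y₂ ⬝ᵥ (w ω).ofLp + y₃ ⬝ᵥ (v ω).ofLp; μ] =
      x₁ ⬝ᵥ P *ᵥ y₁ + x₂ ⬝ᵥ R₁ *ᵥ y₂ + x₃ ⬝ᵥ R₂ *ᵥ y₃ := by
  have Le := he.gauss.memLp_two
  have Lw := hw.gauss.memLp_two
  have Lv := hv.gauss.memLp_two
  have le := memLp_dotProduct Le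
  have lw := memLp_dotProduct Lw
  have lv := memLp_dotProduct Lv
  have hl : ∀ Z : Ω → ℝ, MemLp Z 2 μ →
      cov[fun ω => x₁ ⬝ᵥ (e ω).ofLp + x₂ ⬝ᵥ (w ω).ofLp + x₃ ⬝ᵥ (v ω).ofLp, Z; μ] =
      cov[fun ω => x₁ ⬝ᵥ (e ω).ofLp, Z; μ] + cov[fun ω => x₂ ⬝ᵥ (w ω).ofLp, Z; μ] +
        cov[fun ω => x₃ ⬝ᵥ (v ω).ofLp, Z; μ] := fun Z hZ => by
    have h1 := covariance_add_left ((le x₁).add (lw x₂)) (lv x₃) hZ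
    rw [covariance_add_left (le x₁) (lw x₂) hZ] at h1
    exact h1
  have hr : ∀ Z : Ω → ℝ, MemLp Z 2 μ →
      cov[Z, fun ω => y₁ ⬝ᵥ (e ω).ofLp + y₂ ⬝ᵥ (w ω).ofLp + y₃ ⬝ᵥ (v ω).ofLp; μ] =
      cov[Z, fun ω => y₁ ⬝ᵥ (e ω).ofLp; μ] + cov[Z, fun ω => y₂ ⬝ᵥ (w ω).ofLp; μ] +
        cov[Z, fun ω => y₃ ⬝ᵥ (v ω).ofLp; μ] := fun Z hZ => by
    have h1 := covariance_add_right hZ ((le y₁).add (lw y₂)) (lv y₃)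
    rw [covariance_add_right hZ (le y₁) (lw y₂)] at h1
    exact h1
  have hY : MemLp (fun ω => y₁ ⬝ᵥ (e ω).ofLp + y₂ ⬝ᵥ (w ω).ofLp + y₃ ⬝ᵥ (v ω).ofLp) 2 μ :=
    ((le y₁).add (lw y₂)).add (lv y₃)
  rw [hl _ hY, hr _ (le x₁), hr _ (lw x₂), hr _ (lv x₃),
    he.cov, hw.cov, hv.cov, covariance_dotProduct_eq_zero hew Le Lw,
    covariance_dotProduct_eq_zero hev Le Lv, covariance_dotProduct_eq_zero hwv Lw Lv,
    covariance_dotProduct_eq_zero hew.symm Lw Le, covariance_dotProduct_eq_zero hev.symm Lv Le,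
    covariance_dotProduct_eq_zero hwv.symm Lv Lw]
  ring

/-- Linear images of a triple of independent centered Gaussian vectors. -/
lemma isCenteredGaussian_linear {d : ℕ} (he : IsCenteredGaussian μ e P)
    (hw : IsCenteredGaussian μ w R₁)
    (hv : IsCenteredGaussian μ v R₂) (hewv : IndepFun e (fun ω => (w ω, v ω)) μ)
    (hwv : IndepFun w v μ) (A B : Matrix (Fin d) (Fin n) ℝ) (C : Matrix (Fin d) (Fin m) ℝ) :
    IsCenteredGaussian μ
      (fun ω => A.toEuclideanLin (e ω) + B.toEuclideanLin (w ω) + C.toEuclideanLin (v ω))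
      (A * P * Aᵀ + B * R₁ * Bᵀ + C * R₂ * Cᵀ) := by
  have hew : IndepFun e w μ := hewv.comp measurable_id measurable_fst
  have hev : IndepFun e v μ := hewv.comp measurable_id measurable_snd
  have hgj : HasGaussianLaw (fun ω => (e ω, (w ω, v ω))) μ :=
    hewv.hasGaussianLaw he.gauss (hwv.hasGaussianLaw hw.gauss hv.gauss)
  have ie := he.gauss.map_fun A.toEuclideanLin.toContinuousLinearMap
  have iw := hw.gauss.map_fun B.toEuclideanLin.toContinuousLinearMap
  have iv := hv.gauss.map_fun C.toEuclideanLin.toContinuousLinearMap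
  refine ⟨?_, ?_, ?_, fun x y => ?_⟩
  · exact ((measurable_toEuclideanLin A he.meas).add (measurable_toEuclideanLin B hw.meas)).add
      (measurable_toEuclideanLin C hv.meas)
  · exact hgj.map_fun
      (A.toEuclideanLin.toContinuousLinearMap.comp (ContinuousLinearMap.fst ℝ _ _) +
        B.toEuclideanLin.toContinuousLinearMap.comp
          ((ContinuousLinearMap.fst ℝ _ _).comp (ContinuousLinearMap.snd ℝ _ _)) +
        C.toEuclideanLin.toContinuousLinearMap.comp
          ((ContinuousLinearMap.snd ℝ _ _).comp (ContinuousLinearMap.snd ℝ _ _)))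
  · have he0 := A.toEuclideanLin.toContinuousLinearMap.integral_comp_comm he.gauss.integrable
    have hw0 := B.toEuclideanLin.toContinuousLinearMap.integral_comp_comm hw.gauss.integrable
    have hv0 := C.toEuclideanLin.toContinuousLinearMap.integral_comp_comm hv.gauss.integrable
    rw [he.mean, map_zero] at he0
    rw [hw.mean, map_zero] at hw0
    rw [hv.mean, map_zero] at hv0
    have h1 := integral_add (ie.integrable.add iw.integrable) iv.integrable
    have h2 := integral_add ie.integrable iw.integrable
    simp only [LinearMap.coe_toContinuousLinearMap', Pi.add_apply] at *
    rw [h1, h2, he0, hw0, hv0]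
    simp
  · have hd : ∀ x : Fin d → ℝ, (fun ω => x ⬝ᵥ (A.toEuclideanLin (e ω) + B.toEuclideanLin (w ω) +
        C.toEuclideanLin (v ω)).ofLp) = fun ω => (x ᵥ* A) ⬝ᵥ (e ω).ofLp +
          (x ᵥ* B) ⬝ᵥ (w ω).ofLp + (x ᵥ* C) ⬝ᵥ (v ω).ofLp := fun x => by
      funext ω
      simp only [WithLp.ofLp_add, ofLp_toEuclideanLin, dotProduct_add, dotProduct_mulVec]
    rw [hd x, hd y, covariance_dotProduct_triple he hw hv hew hev hwv]
    simp only [Matrix.add_mulVec, dotProduct_add, ← Matrix.mulVec_mulVec, Matrix.mulVec_transpose,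
      dotProduct_mulVec, Matrix.vecMul_vecMul]

/-- Two linear images of a triple of independent centered Gaussian vectors are independent if
they are uncorrelated. -/
lemma indepFun_linear {d d' : ℕ} (he : IsCenteredGaussian μ e P)
    (hw : IsCenteredGaussian μ w R₁)
    (hv : IsCenteredGaussian μ v R₂) (hewv : IndepFun e (fun ω => (w ω, v ω)) μ)
    (hwv : IndepFun w v μ) (A B : Matrix (Fin d) (Fin n) ℝ) (C : Matrix (Fin d) (Fin m) ℝ)
    (A' B' : Matrix (Fin d') (Fin n) ℝ) (C' : Matrix (Fin d') (Fin m) ℝ)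
    (h : A * P * A'ᵀ + B * R₁ * B'ᵀ + C * R₂ * C'ᵀ = 0) :
    IndepFun
      (fun ω => A.toEuclideanLin (e ω) + B.toEuclideanLin (w ω) + C.toEuclideanLin (v ω))
      (fun ω => A'.toEuclideanLin (e ω) + B'.toEuclideanLin (w ω) + C'.toEuclideanLin (v ω)) μ := by
  have hew : IndepFun e w μ := hewv.comp measurable_id measurable_fst
  have hev : IndepFun e v μ := hewv.comp measurable_id measurable_snd
  have hgj : HasGaussianLaw (fun ω => (e ω, (w ω, v ω))) μ :=
    hewv.hasGaussianLaw he.gauss (hwv.hasGaussianLaw hw.gauss hv.gauss)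
  -- The pair is a single linear image of the jointly Gaussian triple, so it suffices that all cross
  -- covariances vanish.
  refine HasGaussianLaw.indepFun_of_covariance_inner ?_ fun x y => ?_
  · exact hgj.map_fun
      ((A.toEuclideanLin.toContinuousLinearMap.comp (ContinuousLinearMap.fst ℝ _ _) +
        B.toEuclideanLin.toContinuousLinearMap.comp
          ((ContinuousLinearMap.fst ℝ _ _).comp (ContinuousLinearMap.snd ℝ _ _)) +
        C.toEuclideanLin.toContinuousLinearMap.comp
          ((ContinuousLinearMap.snd ℝ _ _).comp (ContinuousLinearMap.snd ℝ _ _))).prod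
      (A'.toEuclideanLin.toContinuousLinearMap.comp (ContinuousLinearMap.fst ℝ _ _) +
        B'.toEuclideanLin.toContinuousLinearMap.comp
          ((ContinuousLinearMap.fst ℝ _ _).comp (ContinuousLinearMap.snd ℝ _ _)) +
        C'.toEuclideanLin.toContinuousLinearMap.comp
          ((ContinuousLinearMap.snd ℝ _ _).comp (ContinuousLinearMap.snd ℝ _ _))))
  · have hd : ∀ {d : ℕ} (A B : Matrix (Fin d) (Fin n) ℝ) (C : Matrix (Fin d) (Fin m) ℝ)
        (x : EuclideanSpace ℝ (Fin d)),
        (fun ω => inner ℝ x (A.toEuclideanLin (e ω) + B.toEuclideanLin (w ω) +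
        C.toEuclideanLin (v ω))) = fun ω => (x.ofLp ᵥ* A) ⬝ᵥ (e ω).ofLp +
          (x.ofLp ᵥ* B) ⬝ᵥ (w ω).ofLp + (x.ofLp ᵥ* C) ⬝ᵥ (v ω).ofLp := fun A B C x => by
      funext ω
      rw [EuclideanSpace.inner_eq_star_dotProduct, dotProduct_comm]
      simp only [star_trivial, WithLp.ofLp_add, ofLp_toEuclideanLin, dotProduct_add,
        dotProduct_mulVec]
    rw [hd A B C x, hd A' B' C' y, covariance_dotProduct_triple he hw hv hew hev hwv]
    have h2 := congrArg (fun M => x.ofLp ⬝ᵥ M *ᵥ y.ofLp) h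
    simp only [Matrix.zero_mulVec, dotProduct_zero] at h2
    rw [← h2]
    simp only [Matrix.add_mulVec, dotProduct_add, ← Matrix.mulVec_mulVec, Matrix.mulVec_transpose,
      dotProduct_mulVec, Matrix.vecMul_vecMul]

end Gauss

namespace Net

variable {L n m : ℕ} (N : Net L n m) {Ω : Type*} (X : Prim Ω L n m)

/-! ### Admissibility of the recursive estimator -/

/-- The covariance is determined by finitely many arrivals, so it is measurable even for the
discrete σ-algebra. Every function of it, such as the gain, is then measurable at no cost. This
version for a single link needs only the arrivals of that link, as an estimator does. -/
lemma measurable_covState_apply_top {mΩ : MeasurableSpace Ω} {β : ℕ → Ω → Fin L → Bool} {k : ℕ}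
    {l : Fin L} (hβ : ∀ t < k, Measurable fun ω => β t ω l) :
    @Measurable _ _ mΩ ⊤ fun ω => N.covState β k ω l := by
  induction k with
  | zero => exact measurable_const
  | succ k ih =>
    intro B _
    have : (fun ω => N.covState β (k + 1) ω l) ⁻¹' B = ⋃ c : Bool, {ω | β k ω l = c} ∩
        (fun ω => N.covState β k ω l) ⁻¹' {P | N.covStep l P c ∈ B} := by
      ext ω
      simp [covState, stateStep]
    rw [this]
    exact MeasurableSet.iUnion fun c => (hβ k (by omega) (measurableSet_singleton c)).inter
      (ih (fun t ht => hβ t (by omega)) trivial)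

/-- The version for all links, used for policies `ν`, on which no measurability is imposed. -/
lemma measurable_covState_top {mΩ : MeasurableSpace Ω} {β : ℕ → Ω → Fin L → Bool} {k : ℕ}
    (hβ : ∀ t < k, Measurable (β t)) : @Measurable _ _ mΩ ⊤ (N.covState β k) := by
  induction k with
  | zero => exact measurable_const
  | succ k ih =>
    intro B _
    have : N.covState β (k + 1) ⁻¹' B = ⋃ c : Fin L → Bool, {ω | β k ω = c} ∩
        N.covState β k ⁻¹' {S | N.stateStep S c ∈ B} := by
      ext ω
      simp [covState]
    rw [this]
    exact MeasurableSet.iUnion fun c => (hβ k (by omega) (measurableSet_singleton c)).inter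
      (ih (fun t ht => hβ t (by omega)) trivial)

lemma measurable_kalman {mΩ : MeasurableSpace Ω} {β : ℕ → Ω → Fin L → Bool} {k : ℕ}
    {l : Fin L} (hβ : ∀ t < k, Measurable fun ω => β t ω l)
    (hy : ∀ t < k, Measurable (N.received X β t l)) : Measurable (N.kalman X β k l) := by
  induction k with
  | zero => exact measurable_const
  | succ k ih =>
    have ih' := ih (fun t ht => hβ t (by omega)) (fun t ht => hy t (by omega))
    have hK : ∀ i j, Measurable fun ω => N.kalmanGain l (N.covState β k ω l) i j := fun i j =>
      @Measurable.comp _ _ _ mΩ ⊤ _ (fun P => N.kalmanGain l P i j) _ measurable_from_top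
        (N.measurable_covState_apply_top fun t ht => hβ t (by omega))
    have hd : Measurable fun ω => N.received X β k l ω -
        (N.H l).toEuclideanLin (N.kalman X β k l ω) :=
      (hy k (by omega)).sub (measurable_toEuclideanLin _ ih')
    have hin : Measurable fun ω => (N.kalmanGain l (N.covState β k ω l)).toEuclideanLin
        (N.received X β k l ω - (N.H l).toEuclideanLin (N.kalman X β k l ω)) := by
      refine (WithLp.measurable_toLp 2 (Fin n → ℝ)).comp (measurable_pi_lambda _ fun i => ?_)
      have hs : Measurable fun ω => ∑ j, N.kalmanGain l (N.covState β k ω l) i j *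
          (N.received X β k l ω - (N.H l).toEuclideanLin (N.kalman X β k l ω)).ofLp j :=
        Finset.measurable_fun_sum _ fun j _ => (hK i j).mul
          ((measurable_pi_apply j).comp ((WithLp.measurable_ofLp 2 (Fin m → ℝ)).comp hd))
      exact hs
    -- The output may be replaced by the received measurement: they differ only when the packet is
    -- lost, and then the correction is absent. This is what makes the estimate admissible.
    have heq : N.kalman X β (k + 1) l = fun ω => (N.F l).toEuclideanLin (N.kalman X β k l ω) +
        if β k ω l = true then (N.kalmanGain l (N.covState β k ω l)).toEuclideanLin
        (N.received X β k l ω - (N.H l).toEuclideanLin (N.kalman X β k l ω)) else 0 := by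
      funext ω
      cases h : β k ω l <;> simp [kalman, received, h]
    rw [heq]
    exact (measurable_toEuclideanLin _ ih').add (Measurable.ite
      (hβ k (by omega) (measurableSet_singleton true)) hin measurable_const)

lemma isEstimator_kalman (β : ℕ → Ω → Fin L → Bool) : N.IsEstimator X β (N.kalman X β) :=
  fun k l => @measurable_kalman L n m N Ω X (N.estInfo X β k l) β k l
    (fun _ ht => N.measurable_arrival_estInfo X β ht l)
    (fun _ ht => N.measurable_received_estInfo X β ht l)

/-! ### The Riccati step -/

lemma posDef_innovation {l : Fin L} {P : Matrix (Fin n) (Fin n) ℝ} (hP : P.PosSemidef) :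
    (N.H l * P * (N.H l)ᵀ + N.R₂ l).PosDef := by
  have := hP.mul_mul_conjTranspose_same (N.H l)
  rw [conjTranspose_eq_transpose_of_trivial] at this
  exact Matrix.PosDef.posSemidef_add this (N.R₂_posDef l)

/-- The normal equation of the gain; the innovation covariance is invertible because `R₂` is
positive definite. It says that the next error is uncorrelated with the innovation. -/
lemma kalmanGain_mul_innovation {l : Fin L} {P : Matrix (Fin n) (Fin n) ℝ} (hP : P.PosSemidef) :
    N.kalmanGain l P * (N.H l * P * (N.H l)ᵀ + N.R₂ l) = N.F l * P * (N.H l)ᵀ := by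
  rw [kalmanGain, Matrix.mul_assoc, Matrix.nonsing_inv_mul, Matrix.mul_one]
  exact (Matrix.isUnit_iff_isUnit_det _).1 (N.posDef_innovation hP).isUnit

/-- Joseph form of the covariance update. -/
lemma covStep_eq {l : Fin L} {P : Matrix (Fin n) (Fin n) ℝ} (hP : P.PosSemidef) (c : Bool) :
    N.covStep l P c =
      (N.F l - (if c then (1 : ℝ) else 0) • (N.kalmanGain l P * N.H l)) * P *
        (N.F l - (if c then (1 : ℝ) else 0) • (N.kalmanGain l P * N.H l))ᵀ +
      1 * N.R₁ l * 1ᵀ +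
      (-((if c then (1 : ℝ) else 0) • N.kalmanGain l P)) * N.R₂ l *
        (-((if c then (1 : ℝ) else 0) • N.kalmanGain l P))ᵀ := by
  cases c
  · simp [covStep]
  -- The normal equation times `Kᵀ` identifies the quadratic terms in `K` with `F P Hᵀ Kᵀ`, so that
  -- only one subtracted term survives.
  · have h := congrArg (· * (N.kalmanGain l P)ᵀ) (N.kalmanGain_mul_innovation (l := l) hP)
    simp only [Matrix.mul_add, Matrix.add_mul] at h
    simp only [covStep, if_true, one_smul, Matrix.transpose_sub, Matrix.transpose_mul,
      Matrix.transpose_one, Matrix.mul_one, Matrix.one_mul, Matrix.transpose_neg, Matrix.sub_mul,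
      Matrix.mul_sub, Matrix.neg_mul, Matrix.mul_neg, neg_neg]
    simp only [Matrix.mul_assoc] at h ⊢
    rw [← h]
    abel

lemma posSemidef_covStep {l : Fin L} {P : Matrix (Fin n) (Fin n) ℝ} (hP : P.PosSemidef)
    (c : Bool) : (N.covStep l P c).PosSemidef := by
  rw [N.covStep_eq hP]
  simp only [← conjTranspose_eq_transpose_of_trivial]
  exact ((hP.mul_mul_conjTranspose_same _).add
    ((N.R₁_posDef l).posSemidef.mul_mul_conjTranspose_same _)).add
    ((N.R₂_posDef l).posSemidef.mul_mul_conjTranspose_same _)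

lemma posSemidef_covState (β : ℕ → Ω → Fin L → Bool) (k : ℕ) (ω : Ω) (l : Fin L) :
    (N.covState β k ω l).PosSemidef := by
  induction k with
  | zero => exact N.R₀_posSemidef l
  | succ k ih => exact N.posSemidef_covStep ih _

/-! ### The filtering error along a deterministic arrival pattern -/

/-- Estimation error of the recursive estimator. -/
noncomputable def filterErr (β : ℕ → Ω → Fin L → Bool) (k : ℕ) (l : Fin L) (ω : Ω) :
    EuclideanSpace ℝ (Fin n) :=
  N.state X k l ω - N.kalman X β k l ω

/-- The estimate itself cancels. What remains is linear in the error and the two noises, with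
coefficients that depend on the arrivals alone, the same three matrices as in `covStep_eq`. -/
lemma filterErr_succ (β : ℕ → Ω → Fin L → Bool) (k : ℕ) (l : Fin L) (ω : Ω) :
    N.filterErr X β (k + 1) l ω =
      (N.F l - (if β k ω l then (1 : ℝ) else 0) •
        (N.kalmanGain l (N.covState β k ω l) * N.H l)).toEuclideanLin (N.filterErr X β k l ω) +
      (1 : Matrix (Fin n) (Fin n) ℝ).toEuclideanLin (X.w k l ω) +
      (-((if β k ω l then (1 : ℝ) else 0) •
        N.kalmanGain l (N.covState β k ω l))).toEuclideanLin (X.v k l ω) := by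
  apply WithLp.ofLp_injective
  simp only [filterErr, state, kalman, output, WithLp.ofLp_sub, WithLp.ofLp_add, WithLp.ofLp_smul,
    ofLp_toEuclideanLin, Matrix.mulVec_sub, Matrix.mulVec_add, Matrix.sub_mulVec,
    Matrix.one_mulVec, Matrix.neg_mulVec, Matrix.smul_mulVec, ← Matrix.mulVec_mulVec]
  module

/-- The link that a primitive random variable belongs to. -/
def link : PrimIdx L → Fin L
  | .init l => l
  | .state _ l => l
  | .meas _ l => l
  | .unif _ l => l

/-- Labels of all primitive variables but the noises of plant `l` from time `k` on. -/
def pastIdx (k : ℕ) (l : Fin L) : Set (PrimIdx L) :=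
  {i | ∀ t ≥ k, i ≠ .state t l ∧ i ≠ .meas t l}

lemma le_iSup_sigma {S : Set (PrimIdx L)} {i : PrimIdx L} (h : i ∈ S) :
    X.sigma i ≤ ⨆ i ∈ S, X.sigma i :=
  le_iSup₂_of_le i h le_rfl

/-- The σ-algebra generated by the other links and by the information of estimator `l`. -/
noncomputable abbrev othersInfo (β : ℕ → Ω → Fin L → Bool) (k : ℕ) (l : Fin L) :
    MeasurableSpace Ω :=
  (⨆ i ∈ {i | link i ≠ l}, X.sigma i) ⊔ N.estInfo X β k l

/-- The measurements of another link are functions of the primitive variables of that link. Powers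
react to all links, so the density of a pattern does as well; this inclusion makes it independent of
the error of link `l`. -/
lemma coordInfo_fixed_le_othersInfo (b : ℕ → Fin L → Bool) (k : ℕ) (l : Fin L) :
    N.coordInfo X (fixed b) k ≤ N.othersInfo X (fixed b) k l := by
  refine iSup_le fun j => ?_
  by_cases h : j = l
  · subst h
    exact le_sup_right
  · refine le_sup_of_le_left (iSup_le fun t => sup_le measurable_const.comap_le ?_)
    have hs : ∀ i, link i = j → X.sigma i ≤ ⨆ i ∈ {i : PrimIdx L | link i ≠ l}, X.sigma i :=
      fun i hi => le_iSup_sigma X (by simpa [hi] using h)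
    refine (@measurable_received L n m N Ω X (⨆ i ∈ {i : PrimIdx L | link i ≠ l}, X.sigma i) _ j t
      measurable_const (@measurable_output L n m N Ω X
          (⨆ i ∈ {i : PrimIdx L | link i ≠ l}, X.sigma i)
        j t ?_ (fun s _ => ?_) ?_)).comap_le
    · exact (comap_measurable _).mono (hs (.init j) rfl) le_rfl
    · exact (comap_measurable _).mono (hs (.state s j) rfl) le_rfl
    · exact (comap_measurable _).mono (hs (.meas t j) rfl) le_rfl

lemma measurable_state_past (k : ℕ) (l : Fin L) :
    Measurable[⨆ i ∈ pastIdx k l, X.sigma i] (N.state X k l) := by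
  refine @measurable_state L n m N Ω X (⨆ i ∈ pastIdx k l, X.sigma i) l k ?_ fun s hs => ?_
  · exact (comap_measurable _).mono (le_iSup_sigma X (i := .init l) fun t _ => by simp) le_rfl
  · exact (comap_measurable _).mono (le_iSup_sigma X (i := .state s l) fun t ht => by
      simp; omega) le_rfl

lemma estInfo_fixed_le_past (b : ℕ → Fin L → Bool) (k : ℕ) (l : Fin L) :
    N.estInfo X (fixed b) k l ≤ ⨆ i ∈ pastIdx k l, X.sigma i := by
  refine iSup_le fun t => sup_le measurable_const.comap_le ?_
  refine (@measurable_received L n m N Ω X (⨆ i ∈ pastIdx k l, X.sigma i) _ l t measurable_const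
    (@measurable_output L n m N Ω X (⨆ i ∈ pastIdx k l, X.sigma i) l t ?_ (fun s hs => ?_)
      ?_)).comap_le
  · exact (comap_measurable _).mono (le_iSup_sigma X (i := .init l) fun t _ => by simp) le_rfl
  · exact (comap_measurable _).mono (le_iSup_sigma X (i := .state s l) fun t' ht => by
      have := t.2
      simp; omega) le_rfl
  · exact (comap_measurable _).mono (le_iSup_sigma X (i := .meas t l) fun t' ht => by
      have := t.2
      simp; omega) le_rfl

lemma othersInfo_fixed_le_past (b : ℕ → Fin L → Bool) (k : ℕ) (l : Fin L) :
    N.othersInfo X (fixed b) k l ≤ ⨆ i ∈ pastIdx k l, X.sigma i := by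
  refine sup_le (iSup₂_le fun i hi => le_iSup_sigma X fun t _ => ?_)
      (N.estInfo_fixed_le_past X b k l)
  constructor <;> rintro rfl <;> exact hi rfl

lemma measurable_filterErr_past (b : ℕ → Fin L → Bool) (k : ℕ) (l : Fin L) :
    Measurable[⨆ i ∈ pastIdx k l, X.sigma i] (N.filterErr X (fixed b) k l) :=
  (N.measurable_state_past X k l).sub
    ((N.isEstimator_kalman X (fixed b) k l).mono (N.estInfo_fixed_le_past X b k l) le_rfl)

/-- Along a deterministic arrival pattern, the filtering error is a centered Gaussian vector that
is independent of the information, and its covariance follows the Riccati recursion. -/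
lemma filterErr_fixed [mΩ : MeasurableSpace Ω] {μ : Measure Ω} [IsProbabilityMeasure μ]
    {X : Prim Ω L n m} (hX : X.HasLaws N μ) (b : ℕ → Fin L → Bool) (k : ℕ) (l : Fin L) :
    IsCenteredGaussian μ (N.filterErr X (fixed b) k l) (N.covSeq b k l) ∧
    Indep (MeasurableSpace.comap (N.filterErr X (fixed b) k l) inferInstance)
      (N.othersInfo X (fixed b) k l) μ := by
  have hsup : ∀ S : Set (PrimIdx L), (⨆ i ∈ S, X.sigma i) ≤ mΩ :=
    fun S => iSup₂_le fun i _ => hX.sigma_le i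
  induction k with
  | zero =>
    refine ⟨isCenteredGaussian_of_map_eq (N.R₀_posSemidef l) (hX.meas_x₀ l) (hX.law_x₀ l), ?_⟩
    have h := indep_iSup_of_disjoint hX.sigma_le hX.indep (S := {.init l}) (T := {i | link i ≠ l})
      (by simp [link])
    refine indep_of_indep_of_le h ?_ ?_
    · refine Measurable.comap_le ?_
      have : Measurable[⨆ i ∈ ({.init l} : Set (PrimIdx L)), X.sigma i] (X.x₀ l) :=
        (comap_measurable _).mono (le_iSup_sigma X (i := .init l) rfl) le_rfl
      exact this.sub measurable_const
    · exact sup_le le_rfl (iSup_le fun t => t.elim0)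
  | succ k ih =>
    obtain ⟨hg, hi⟩ := ih
    have hP : (N.covSeq b k l).PosSemidef := N.posSemidef_covState _ k () l
    have hw : IsCenteredGaussian μ (X.w k l) (N.R₁ l) := by
      simpa using isCenteredGaussian_of_map_eq (N.R₁_posDef l).posSemidef (hX.meas_w k l)
        (hX.law_w k l)
    have hv : IsCenteredGaussian μ (X.v k l) (N.R₂ l) := by
      simpa using isCenteredGaussian_of_map_eq (N.R₂_posDef l).posSemidef (hX.meas_v k l)
        (hX.law_v k l)
    have hwv : IndepFun (X.w k l) (X.v k l) μ :=
      hX.indep.indep (i := .state k l) (j := .meas k l) (by simp)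
    set e := N.filterErr X (fixed b) k l with he
    have hGpast := N.othersInfo_fixed_le_past X b k l
    have hepast : MeasurableSpace.comap e inferInstance ≤ ⨆ i ∈ pastIdx k l, X.sigma i :=
      (N.measurable_filterErr_past X b k l).comap_le
    have hG0 : N.othersInfo X (fixed b) k l ≤ mΩ := hGpast.trans (hsup _)
    have he0 : MeasurableSpace.comap e inferInstance ≤ mΩ := hepast.trans (hsup _)
    have hwv0 : MeasurableSpace.comap (fun ω => (X.w k l ω, X.v k l ω)) inferInstance ≤ mΩ :=
        (hw.meas.prodMk hv.meas).comap_le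
    have hfut : Indep (⨆ i ∈ pastIdx k l, X.sigma i)
      (MeasurableSpace.comap (fun ω => (X.w k l ω, X.v k l ω)) inferInstance) μ := by
      refine indep_of_indep_of_le_right (indep_iSup_of_disjoint hX.sigma_le hX.indep
        (S := pastIdx k l) (T := {.state k l, .meas k l}) ?_) ?_
      · refine Set.disjoint_left.2 fun i hi hi' => ?_
        rcases hi' with rfl | rfl
        · exact (hi k le_rfl).1 rfl
        · exact (hi k le_rfl).2 rfl
      · refine Measurable.comap_le ?_
        refine Measurable.prodMk ?_ ?_
        · exact (comap_measurable _).mono (le_iSup_sigma X (i := .state k l) (by simp)) le_rfl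
        · exact (comap_measurable _).mono (le_iSup_sigma X (i := .meas k l) (by simp)) le_rfl
    have hewv : IndepFun e (fun ω => (X.w k l ω, X.v k l ω)) μ :=
      indep_of_indep_of_le_left hfut hepast
    -- The current error and the fresh noises are jointly independent of the information, hence so
    -- is every linear combination of them.
    have hGT : Indep (N.othersInfo X (fixed b) k l)
        (MeasurableSpace.comap e inferInstance ⊔ MeasurableSpace.comap
        (fun ω => (X.w k l ω, X.v k l ω)) inferInstance) μ :=
      Indep.sup_right_of_sup_left hG0 he0 hwv0 hi.symm
        (indep_of_indep_of_le_left hfut (sup_le hGpast hepast))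
    have heT : Measurable[MeasurableSpace.comap e inferInstance ⊔ MeasurableSpace.comap
        (fun ω => (X.w k l ω, X.v k l ω)) inferInstance] e :=
      (comap_measurable e).mono le_sup_left le_rfl
    have hwvT : Measurable[MeasurableSpace.comap e inferInstance ⊔ MeasurableSpace.comap
        (fun ω => (X.w k l ω, X.v k l ω)) inferInstance] fun ω => (X.w k l ω, X.v k l ω) :=
      (comap_measurable _).mono le_sup_right le_rfl
    have hwT : Measurable[MeasurableSpace.comap e inferInstance ⊔ MeasurableSpace.comap
        (fun ω => (X.w k l ω, X.v k l ω)) inferInstance] (X.w k l) := measurable_fst.comp hwvT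
    have hvT : Measurable[MeasurableSpace.comap e inferInstance ⊔ MeasurableSpace.comap
        (fun ω => (X.w k l ω, X.v k l ω)) inferInstance] (X.v k l) := measurable_snd.comp hwvT
    set c : ℝ := if b k l then (1 : ℝ) else 0 with hc
    set K := N.kalmanGain l (N.covSeq b k l) with hK
    have hcov : ∀ ω : Ω, N.covState (fixed b) k ω = N.covSeq b k := fun ω =>
      N.covState_eq_of_mem_agree (fun _ _ => rfl)
    have hsucc : N.filterErr X (fixed b) (k + 1) l = fun ω =>
        (N.F l - c • (K * N.H l)).toEuclideanLin (e ω) +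
        (1 : Matrix (Fin n) (Fin n) ℝ).toEuclideanLin (X.w k l ω) +
        (-(c • K)).toEuclideanLin (X.v k l ω) := by
      funext ω
      rw [filterErr_succ, hcov ω]
    have haT : Measurable[MeasurableSpace.comap e inferInstance ⊔ MeasurableSpace.comap
        (fun ω => (X.w k l ω, X.v k l ω)) inferInstance] (N.filterErr X (fixed b) (k + 1) l) := by
      rw [hsucc]
      exact ((measurable_toEuclideanLin _ heT).add (measurable_toEuclideanLin _ hwT)).add
        (measurable_toEuclideanLin _ hvT)
    have hcovsucc : N.covSeq b (k + 1) l = (N.F l - c • (K * N.H l)) * N.covSeq b k l *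
        (N.F l - c • (K * N.H l))ᵀ + 1 * N.R₁ l * 1ᵀ + (-(c • K)) * N.R₂ l * (-(c • K))ᵀ :=
      N.covStep_eq hP (b k l)
    refine ⟨?_, ?_⟩
    · rw [hcovsucc, hsucc]
      exact isCenteredGaussian_linear hg hw hv hewv hwv _ _ _
    · cases hb : b k l with
      | false =>
        -- A lost packet adds only the constant `0` to the information.
        refine indep_of_indep_of_le hGT.symm haT.comap_le ?_
        refine sup_le le_sup_left (iSup_le fun t => sup_le measurable_const.comap_le ?_)
        rcases Nat.lt_succ_iff_lt_or_eq.1 t.2 with ht | ht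
        · exact ((N.measurable_received_estInfo X (fixed b) ht l).mono le_sup_right le_rfl).comap_le
        · have : N.received X (fixed b) t l = fun _ => 0 := by
            funext ω
            simp [received, ht, hb]
          rw [this]
          exact measurable_const.comap_le
      | true =>
        -- The innovation. The new measurement is `ε` plus a function of the old information, so the
        -- information grows exactly by `ε`.
        set ε : Ω → EuclideanSpace ℝ (Fin m) := fun ω => (N.H l).toEuclideanLin (e ω) +
          (0 : Matrix (Fin m) (Fin n) ℝ).toEuclideanLin (X.w k l ω) +
          (1 : Matrix (Fin m) (Fin m) ℝ).toEuclideanLin (X.v k l ω) with hε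
        have hεT : Measurable[MeasurableSpace.comap e inferInstance ⊔ MeasurableSpace.comap
            (fun ω => (X.w k l ω, X.v k l ω)) inferInstance] ε :=
          ((measurable_toEuclideanLin _ heT).add (measurable_toEuclideanLin _ hwT)).add
            (measurable_toEuclideanLin _ hvT)
        have hT0 : MeasurableSpace.comap e inferInstance ⊔ MeasurableSpace.comap
            (fun ω => (X.w k l ω, X.v k l ω)) inferInstance ≤ mΩ := sup_le he0 hwv0
        have haε : IndepFun (N.filterErr X (fixed b) (k + 1) l) ε μ := by
          rw [hsucc]
          refine indepFun_linear hg hw hv hewv hwv _ _ _ _ _ _ ?_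
          -- The cross covariance is `(F - K H) P Hᵀ - K R₂`, which vanishes by the choice of the
          -- gain.
          have h := N.kalmanGain_mul_innovation (l := l) hP
          simp only [hc, hb, if_true, one_smul, Matrix.transpose_zero, Matrix.mul_zero, add_zero,
            Matrix.transpose_one, Matrix.mul_one, Matrix.sub_mul, Matrix.neg_mul]
          rw [← h, Matrix.mul_add]
          simp only [Matrix.mul_assoc, hK]
          abel
        have hind : Indep (MeasurableSpace.comap (N.filterErr X (fixed b) (k + 1) l) inferInstance)
            (MeasurableSpace.comap ε inferInstance ⊔
              N.othersInfo X (fixed b) k l) μ :=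
          Indep.sup_right_of_sup_left (haT.comap_le.trans hT0) (hεT.comap_le.trans hT0) hG0 haε
            (indep_of_indep_of_le_left hGT.symm (sup_le haT.comap_le hεT.comap_le))
        refine indep_of_indep_of_le_right hind ?_
        refine sup_le (le_sup_of_le_right le_sup_left)
          (iSup_le fun t => sup_le measurable_const.comap_le ?_)
        rcases Nat.lt_succ_iff_lt_or_eq.1 t.2 with ht | ht
        · exact ((N.measurable_received_estInfo X (fixed b) ht l).mono
            (le_sup_of_le_right le_sup_right) le_rfl).comap_le
        · have : N.received X (fixed b) t l = fun ω =>
              (N.H l).toEuclideanLin (N.kalman X (fixed b) k l ω) + ε ω := by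
            funext ω
            simp only [received, ht, hb, if_true, output, hε, he, filterErr]
            apply WithLp.ofLp_injective
            simp only [WithLp.ofLp_sub, WithLp.ofLp_add, ofLp_toEuclideanLin, Matrix.mulVec_sub,
              Matrix.zero_mulVec, Matrix.one_mulVec]
            abel
          rw [this]
          refine Measurable.comap_le (Measurable.add ?_ ?_)
          · exact measurable_toEuclideanLin _ ((N.isEstimator_kalman X (fixed b) k l).mono
              (le_sup_of_le_right le_sup_right) le_rfl)
          · exact (comap_measurable ε).mono le_sup_left le_rfl

end Net

/-! ### Weighted norms -/

section Weight

open scoped MatrixOrder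

/-- With `Θ = Bᵀ * B` the weighted norm of `z` is the Euclidean norm of `B z`, and invertibility of
`B` recovers `z`. -/
lemma exists_factor {d : ℕ} {Θ : Matrix (Fin d) (Fin d) ℝ} (hΘ : Θ.PosDef) :
    ∃ B : Matrix (Fin d) (Fin d) ℝ, IsUnit B ∧ Θ = Bᵀ * B := by
  obtain ⟨B, hB, h⟩ := CStarAlgebra.isStrictlyPositive_iff_eq_star_mul_self.mp hΘ.isStrictlyPositive
  exact ⟨B, hB, by rw [h, star_eq_conjTranspose, conjTranspose_eq_transpose_of_trivial]⟩

lemma wnormSq_eq_norm_sq {d : ℕ} (B : Matrix (Fin d) (Fin d) ℝ) (z : EuclideanSpace ℝ (Fin d)) :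
    wnormSq (Bᵀ * B) z = ‖B.toEuclideanLin z‖ ^ 2 := by
  rw [wnormSq, ← real_inner_self_eq_norm_sq, EuclideanSpace.inner_eq_star_dotProduct,
    ofLp_toEuclideanLin, star_trivial, ← Matrix.mulVec_mulVec, dotProduct_mulVec,
    Matrix.vecMul_transpose]

lemma trace_mul_nonneg {d : ℕ} {Θ P : Matrix (Fin d) (Fin d) ℝ} (hΘ : Θ.PosDef)
    (hP : P.PosSemidef) : 0 ≤ (Θ * P).trace := by
  obtain ⟨B, -, rfl⟩ := exists_factor hΘ
  have h := (hP.mul_mul_conjTranspose_same B).trace_nonneg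
  rwa [conjTranspose_eq_transpose_of_trivial, Matrix.trace_mul_comm, ← Matrix.mul_assoc] at h

lemma wnormSq_nonneg {d : ℕ} {Θ : Matrix (Fin d) (Fin d) ℝ} (hΘ : Θ.PosDef)
    (z : EuclideanSpace ℝ (Fin d)) : 0 ≤ wnormSq Θ z := by
  obtain ⟨B, -, rfl⟩ := exists_factor hΘ
  rw [wnormSq_eq_norm_sq]
  positivity

end Weight

lemma memLp_two_toEuclideanLin {Ω : Type*} [MeasurableSpace Ω] {μ : Measure Ω} {a b : ℕ}
    (A : Matrix (Fin a) (Fin b) ℝ) {f : Ω → EuclideanSpace ℝ (Fin b)} (hf : MemLp f 2 μ) :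
    MemLp (fun ω => A.toEuclideanLin (f ω)) 2 μ :=
  hf.continuousLinearMap_comp A.toEuclideanLin.toContinuousLinearMap

/-- Pythagoras' theorem for a square integrable `m`-measurable vector and one whose conditional
expectation given `m` vanishes. -/
lemma integral_norm_add_sq_of_condExp_eq_zero {Ω : Type*} {m m0 : MeasurableSpace Ω}
    {μ : Measure Ω} [IsFiniteMeasure μ] {d : ℕ} {r u : Ω → EuclideanSpace ℝ (Fin d)} (hm : m ≤ m0)
    (hr : MemLp r 2 μ) (hu : MemLp u 2 μ) (hum : Measurable[m] u) (h0 : μ[r | m] =ᵐ[μ] 0) :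
    ∫ ω, ‖r ω + u ω‖ ^ 2 ∂μ = ∫ ω, ‖r ω‖ ^ 2 ∂μ + ∫ ω, ‖u ω‖ ^ 2 ∂μ := by
  have hint : Integrable (fun ω => innerSL ℝ (u ω) (r ω)) μ := by
    refine (hu.norm.integrable_mul hr.norm).mono' ?_ (Filter.Eventually.of_forall fun ω => ?_)
    · exact hu.1.inner (𝕜 := ℝ) hr.1
    · exact norm_inner_le_norm (𝕜 := ℝ) (u ω) (r ω)
  -- The factor `u` is known given `m`, so the inner product has conditional mean `⟨u, E[r | m]⟩ =
  -- 0`.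
  have hpull := condExp_bilin_of_aestronglyMeasurable_left (innerSL ℝ)
    hum.stronglyMeasurable.aestronglyMeasurable hint (hr.integrable one_le_two)
  have hcross : ∫ ω, innerSL ℝ (u ω) (r ω) ∂μ = 0 := by
    rw [← integral_condExp hm, integral_congr_ae hpull]
    refine integral_eq_zero_of_ae ?_
    filter_upwards [h0] with ω hω
    rw [hω]
    simp
  have e : ∀ ω, ‖r ω + u ω‖ ^ 2 = ‖r ω‖ ^ 2 + ‖u ω‖ ^ 2 + 2 * innerSL ℝ (u ω) (r ω) := fun ω => by
    rw [norm_add_sq_real, innerSL_apply_apply, real_inner_comm]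
    ring
  have hr2 : Integrable (fun ω => ‖r ω‖ ^ 2) μ := hr.integrable_norm_pow two_ne_zero
  have hu2 : Integrable (fun ω => ‖u ω‖ ^ 2) μ := hu.integrable_norm_pow two_ne_zero
  have h1 : ∫ ω, (‖r ω‖ ^ 2 + ‖u ω‖ ^ 2) + 2 * innerSL ℝ (u ω) (r ω) ∂μ =
      ∫ ω, ‖r ω‖ ^ 2 + ‖u ω‖ ^ 2 ∂μ + ∫ ω, 2 * innerSL ℝ (u ω) (r ω) ∂μ :=
    integral_add (hr2.add hu2) (hint.const_mul 2)
  have h2 : ∫ ω, ‖r ω‖ ^ 2 + ‖u ω‖ ^ 2 ∂μ = ∫ ω, ‖r ω‖ ^ 2 ∂μ + ∫ ω, ‖u ω‖ ^ 2 ∂μ :=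
    integral_add hr2 hu2
  simp only [e]
  rw [h1, h2, integral_const_mul, hcross, mul_zero, add_zero]

namespace Net

variable {L n m : ℕ} (N : Net L n m) {Ω : Type*}

/-! ### Decomposition over arrival histories -/

/-- Extension of a finite arrival history by losses. -/
def extendHist (k : ℕ) (h : Fin k → Fin L → Bool) : ℕ → Fin L → Bool :=
  fun t => if ht : t < k then h ⟨t, ht⟩ else fun _ => false

lemma mem_agree_extendHist {β : ℕ → Ω → Fin L → Bool} {k : ℕ} {h : Fin k → Fin L → Bool} {ω : Ω} :
    ω ∈ agree β k (extendHist k h) ↔ h = fun t : Fin k => β t ω := by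
  constructor
  · intro hω
    funext t
    rw [hω t t.2]
    simp [extendHist]
  · rintro rfl t ht
    simp [extendHist, ht]

lemma iUnion_agree (β : ℕ → Ω → Fin L → Bool) (k : ℕ) :
    ⋃ h : Fin k → Fin L → Bool, agree β k (extendHist k h) = Set.univ :=
  Set.eq_univ_of_forall fun _ => Set.mem_iUnion.2 ⟨_, mem_agree_extendHist.2 rfl⟩

lemma pairwise_disjoint_agree (β : ℕ → Ω → Fin L → Bool) (k : ℕ) :
    Pairwise (Function.onFun Disjoint fun h : Fin k → Fin L → Bool =>
      agree β k (extendHist k h)) := by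
  intro h h' hne
  refine Set.disjoint_left.2 fun ω hω hω' => hne ?_
  rw [mem_agree_extendHist.1 hω, mem_agree_extendHist.1 hω']

variable [mΩ : MeasurableSpace Ω] {X : Prim Ω L n m}

lemma coordInfo_le {μ : Measure Ω} (hX : X.HasLaws N μ) {β : ℕ → Ω → Fin L → Bool}
    {κ : ℕ → Ω → Fin L → ℝ} (he : IsErasure X μ κ β) (k : ℕ) : N.coordInfo X β k ≤ mΩ :=
  (N.coordInfo_le_fullPast X β k).trans (fullPast_le hX he.meas k)

lemma measurable_filterErr {μ : Measure Ω} (hX : X.HasLaws N μ) {β : ℕ → Ω → Fin L → Bool}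
    {κ : ℕ → Ω → Fin L → ℝ} (he : IsErasure X μ κ β) (k : ℕ) (l : Fin L) :
    Measurable (N.filterErr X β k l) := by
  refine Measurable.sub ?_ ?_
  · exact N.measurable_state X (hX.meas_x₀ l) fun t _ => hX.meas_w t l
  · exact (N.isEstimator_kalman X β k l).mono
      ((N.estInfo_le_coordInfo X β k l).trans (N.coordInfo_le hX he k)) le_rfl

variable {μ : Measure Ω} [IsProbabilityMeasure μ]

-- Law of the filtering error under random arrivals

section Filter

variable (hX : X.HasLaws N μ) {β : ℕ → Ω → Fin L → Bool} {κ : ℕ → Ω → Fin L → ℝ}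
  (hκ : ∀ k, Measurable[N.coordInfo X β k] (κ k)) (he : IsErasure X μ κ β)
include hX hκ he

/-- Within the pattern, the density `g` and the event `A` depend on the measurements received under
`b`, which are independent of the error for `b`. The integral therefore factors, and feedback
through the powers leaves the error law unchanged. -/
lemma map_filterErr_restrict (k : ℕ) (l : Fin L) (b : ℕ → Fin L → Bool) {A : Set Ω}
    (hA : MeasurableSet[N.coordInfo X β k] A) :
    (μ.restrict (A ∩ agree β k b)).map (N.filterErr X β k l) =
      μ (A ∩ agree β k b) • μ.map (N.filterErr X (fixed b) k l) := by
  have hle := N.coordInfo_le hX he k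
  obtain ⟨A', hA', hAA'⟩ := N.exists_measurableSet_fixed X β b hA
  obtain ⟨g, hg, hgf⟩ := N.exists_density_agree hX hκ he k b
  obtain ⟨hG, hI⟩ := N.filterErr_fixed hX b k l
  have hle' : N.coordInfo X (fixed b) k ≤ mΩ :=
    (N.coordInfo_fixed_le_plantSigma X k b).trans hX.plantSigma_le
  have hagree : MeasurableSet (agree β k b) := hle _ (N.measurableSet_agree X β k b)
  have hAE : MeasurableSet (A ∩ agree β k b) := (hle _ hA).inter hagree
  have hplant : Measurable[X.plantSigma] (N.filterErr X (fixed b) k l) := by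
    refine Measurable.sub ?_ ?_
    · exact @measurable_state L n m N Ω X X.plantSigma l k (X.measurable_x₀_plantSigma l)
        fun t _ => X.measurable_w_plantSigma t l
    · exact (N.isEstimator_kalman X (fixed b) k l).mono
        ((N.estInfo_le_coordInfo X _ k l).trans (N.coordInfo_fixed_le_plantSigma X k b)) le_rfl
  have herr := N.measurable_filterErr hX he k l
  have hA'p : MeasurableSet[X.plantSigma] A' := N.coordInfo_fixed_le_plantSigma X k b _ hA'
  have key : ∀ C : Set (EuclideanSpace ℝ (Fin n)), MeasurableSet C →
      μ (N.filterErr X β k l ⁻¹' C ∩ (A ∩ agree β k b)) =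
        (∫⁻ ω, g ω * A'.indicator (fun _ => 1) ω ∂μ) *
          μ (N.filterErr X (fixed b) k l ⁻¹' C) := by
    intro C hC
    have e1 : N.filterErr X β k l ⁻¹' C ∩ (A ∩ agree β k b) =
        (A' ∩ N.filterErr X (fixed b) k l ⁻¹' C) ∩ agree β k b := by
      rw [hAA']
      ext ω
      simp only [Set.mem_inter_iff, Set.mem_preimage, filterErr]
      constructor
      · rintro ⟨h1, h2, h3⟩
        rw [N.kalman_eq_of_mem_agree X h3] at h1
        exact ⟨⟨h2, h1⟩, h3⟩
      · rintro ⟨⟨h2, h1⟩, h3⟩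
        rw [← N.kalman_eq_of_mem_agree X h3] at h1
        exact ⟨h1, h2, h3⟩
    have hS : MeasurableSet[X.plantSigma] (A' ∩ N.filterErr X (fixed b) k l ⁻¹' C) :=
      hA'p.inter (hplant hC)
    have h1 := hgf ((A' ∩ N.filterErr X (fixed b) k l ⁻¹' C).indicator fun _ => 1)
      (measurable_const.indicator hS)
    rw [lintegral_indicator (hX.plantSigma_le _ hS), setLIntegral_one,
      Measure.restrict_apply (hX.plantSigma_le _ hS)] at h1
    have h2 := lintegral_mul_eq_lintegral_mul_lintegral_of_independent_measurableSpace
      hle' hG.meas.comap_le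
      (indep_of_indep_of_le_right hI (N.coordInfo_fixed_le_othersInfo X b k l)).symm
      (hg.mul (measurable_const.indicator hA') :
        Measurable[N.coordInfo X (fixed b) k] fun ω => g ω * A'.indicator (fun _ => 1) ω)
      (measurable_const.indicator ⟨C, hC, rfl⟩ :
        Measurable[MeasurableSpace.comap (N.filterErr X (fixed b) k l) inferInstance]
          ((N.filterErr X (fixed b) k l ⁻¹' C).indicator fun _ => (1 : ℝ≥0∞)))
    rw [lintegral_indicator (hG.meas hC), setLIntegral_one] at h2
    rw [e1, h1]
    refine Eq.trans ?_ h2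
    refine lintegral_congr fun ω => ?_
    by_cases hA1 : ω ∈ A' <;>
      by_cases hC1 : ω ∈ N.filterErr X (fixed b) k l ⁻¹' C <;>
      simp only [Pi.mul_apply, Set.indicator, Set.mem_inter_iff, hA1, hC1] <;> simp
  ext C hC
  rw [Measure.map_apply herr hC, Measure.restrict_apply (herr hC), key C hC,
    Measure.smul_apply, Measure.map_apply hG.meas hC, smul_eq_mul]
  -- The case of the whole space identifies the constant factor as the mass of the event.
  have := key Set.univ MeasurableSet.univ
  simp only [Set.preimage_univ, Set.univ_inter, measure_univ, mul_one] at this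
  rw [this]

section Integral

variable {F : Type*} [NormedAddCommGroup F]
  {k : ℕ} {l : Fin L} {φ : EuclideanSpace ℝ (Fin n) → F} (hφ : StronglyMeasurable φ)
  (hint : ∀ b, Integrable (fun ω => φ (N.filterErr X (fixed b) k l ω)) μ)
include hφ hint

lemma integrableOn_filterErr (b : ℕ → Fin L → Bool) :
    IntegrableOn (fun ω => φ (N.filterErr X β k l ω)) (agree β k b) μ := by
  have hmap := N.map_filterErr_restrict hX hκ he k l b MeasurableSet.univ
  rw [Set.univ_inter] at hmap
  have hm := N.measurable_filterErr hX he k l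
  have h1 : Integrable φ ((μ.restrict (agree β k b)).map (N.filterErr X β k l)) := by
    rw [hmap]
    refine Integrable.smul_measure ?_ (measure_ne_top _ _)
    rw [integrable_map_measure hφ.aestronglyMeasurable
      (N.filterErr_fixed hX b k l).1.meas.aemeasurable]
    exact hint b
  exact (integrable_map_measure hφ.aestronglyMeasurable hm.aemeasurable).1 h1

lemma integrable_filterErr : Integrable (fun ω => φ (N.filterErr X β k l ω)) μ := by
  rw [← integrableOn_univ, ← iUnion_agree β k]
  exact integrableOn_finite_iUnion.2 fun h => N.integrableOn_filterErr hX hκ he hφ hint _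

/-- Sums the laws over the finite partition into arrival histories. It is applied with `φ` the
identity, a product of two coordinates and the weighted norm; `c` is constant on each history. -/
lemma setIntegral_filterErr [NormedSpace ℝ F] [CompleteSpace F] {c : Ω → F}
    (hc : ∀ b, ∀ ω ∈ agree β k b, c ω = ∫ ω', φ (N.filterErr X (fixed b) k l ω') ∂μ)
    {A : Set Ω} (hA : MeasurableSet[N.coordInfo X β k] A) :
    ∫ ω in A, φ (N.filterErr X β k l ω) ∂μ = ∫ ω in A, c ω ∂μ := by
  have hle := N.coordInfo_le hX he k
  have hagree : ∀ b, MeasurableSet (agree β k b) := fun b =>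
    hle _ (N.measurableSet_agree X β k b)
  have hm := N.measurable_filterErr hX he k l
  have hpiece : ∀ b, ∫ ω in A ∩ agree β k b, φ (N.filterErr X β k l ω) ∂μ =
      ∫ ω in A ∩ agree β k b, c ω ∂μ := fun b => by
    rw [setIntegral_congr_fun ((hle _ hA).inter (hagree b)) (fun ω hω => hc b ω hω.2),
      setIntegral_const]
    have hmap := N.map_filterErr_restrict hX hκ he k l b hA
    have := integral_map (μ := μ.restrict (A ∩ agree β k b)) hm.aemeasurable
      (hφ.aestronglyMeasurable (μ := (μ.restrict (A ∩ agree β k b)).map (N.filterErr X β k l)))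
    rw [← this, hmap, integral_smul_measure, integral_map
      (N.filterErr_fixed hX b k l).1.meas.aemeasurable hφ.aestronglyMeasurable]
    rfl
  have hAe : A = ⋃ h : Fin k → Fin L → Bool, A ∩ agree β k (extendHist k h) := by
    rw [← Set.inter_iUnion, iUnion_agree, Set.inter_univ]
  have hdisj : Pairwise (Function.onFun Disjoint fun h : Fin k → Fin L → Bool =>
      A ∩ agree β k (extendHist k h)) := fun h h' hne =>
    (pairwise_disjoint_agree β k hne).mono Set.inter_subset_right Set.inter_subset_right
  have hcint : ∀ h : Fin k → Fin L → Bool, IntegrableOn c (A ∩ agree β k (extendHist k h)) μ :=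
    fun h => by
      rw [integrableOn_congr_fun (fun ω hω => hc _ ω hω.2) ((hle _ hA).inter (hagree _))]
      exact integrableOn_const
  rw [hAe, integral_iUnion_fintype (fun h => (hle _ hA).inter (hagree _)) hdisj
    (fun h => (N.integrableOn_filterErr hX hκ he hφ hint _).mono_set Set.inter_subset_right),
    integral_iUnion_fintype (fun h => (hle _ hA).inter (hagree _)) hdisj hcint]
  exact Finset.sum_congr rfl fun h _ => hpiece _

end Integral

end Filter

end Net

/-! ### Second moments of centered Gaussian vectors -/

section Moments

variable {Ω : Type*} [MeasurableSpace Ω] {μ : Measure Ω} {d : ℕ}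
  {e : Ω → EuclideanSpace ℝ (Fin d)} {P : Matrix (Fin d) (Fin d) ℝ}

lemma memLp_two_apply {Ω : Type*} [MeasurableSpace Ω] {μ : Measure Ω} {d : ℕ}
    {e : Ω → EuclideanSpace ℝ (Fin d)} (he : MemLp e 2 μ) (i : Fin d) :
    MemLp (fun ω => e ω i) 2 μ := by
  simpa using memLp_dotProduct he (Pi.single i 1)

lemma IsCenteredGaussian.integral_apply (he : IsCenteredGaussian μ e P) (i : Fin d) :
    ∫ ω, e ω i ∂μ = 0 := by
  have h := (EuclideanSpace.proj (𝕜 := ℝ) i).integral_comp_comm he.gauss.integrable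
  rw [he.mean, map_zero] at h
  exact h

lemma IsCenteredGaussian.integral_mul [IsProbabilityMeasure μ] (he : IsCenteredGaussian μ e P)
    (i j : Fin d) :
    ∫ ω, e ω i * e ω j ∂μ = P i j := by
  have h := he.cov (Pi.single i 1) (Pi.single j 1)
  have h1 := covariance_eq_sub (memLp_two_apply he.gauss.memLp_two i)
    (memLp_two_apply he.gauss.memLp_two j)
  simp only [he.integral_apply, mul_zero, sub_zero] at h1
  simp only [single_one_dotProduct, Matrix.mulVec_single_one] at h
  exact h1.symm.trans h

lemma IsCenteredGaussian.integrable_mul (he : IsCenteredGaussian μ e P) (i j : Fin d) :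
    Integrable (fun ω => e ω i * e ω j) μ :=
  (memLp_two_apply he.gauss.memLp_two i).integrable_mul (memLp_two_apply he.gauss.memLp_two j)

lemma wnormSq_eq_sum (Θ : Matrix (Fin d) (Fin d) ℝ) (z : EuclideanSpace ℝ (Fin d)) :
    wnormSq Θ z = ∑ i, ∑ j, Θ i j * (z i * z j) := by
  simp only [wnormSq, Matrix.mulVec, dotProduct, Finset.mul_sum]
  exact Finset.sum_congr rfl fun i _ => Finset.sum_congr rfl fun j _ => by ring

lemma continuous_wnormSq (Θ : Matrix (Fin d) (Fin d) ℝ) : Continuous (wnormSq Θ) := by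
  have : wnormSq Θ = fun z => ∑ i, ∑ j, Θ i j * (z i * z j) := funext (wnormSq_eq_sum Θ)
  rw [this]
  fun_prop

lemma integrable_wnormSq {Ω : Type*} [MeasurableSpace Ω] {μ : Measure Ω} {d : ℕ}
    {e : Ω → EuclideanSpace ℝ (Fin d)} (he : MemLp e 2 μ) (Θ : Matrix (Fin d) (Fin d) ℝ) :
    Integrable (fun ω => wnormSq Θ (e ω)) μ := by
  simp only [wnormSq_eq_sum]
  exact integrable_finsetSum _ fun i _ => integrable_finsetSum _ fun j _ =>
    ((memLp_two_apply he i).integrable_mul (memLp_two_apply he j)).const_mul _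

lemma IsCenteredGaussian.integral_wnormSq [IsProbabilityMeasure μ] (he : IsCenteredGaussian μ e P)
    (hP : P.PosSemidef)
    (Θ : Matrix (Fin d) (Fin d) ℝ) : ∫ ω, wnormSq Θ (e ω) ∂μ = (Θ * P).trace := by
  simp only [wnormSq_eq_sum]
  refine (integral_finsetSum _ fun i _ => integrable_finsetSum _ fun j _ =>
    (he.integrable_mul i j).const_mul _).trans ?_
  simp only [Matrix.trace, Matrix.diag, Matrix.mul_apply]
  refine Finset.sum_congr rfl fun i _ => ?_
  refine (integral_finsetSum _ fun j _ => (he.integrable_mul i j).const_mul _).trans ?_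
  refine Finset.sum_congr rfl fun j _ => ?_
  rw [integral_const_mul, he.integral_mul]
  have := hP.1.apply i j
  rw [star_trivial] at this
  rw [this]

end Moments

-- Conditional moments and optimality of the recursive estimator

namespace Net

variable {L n m : ℕ} (N : Net L n m) {Ω : Type*} [mΩ : MeasurableSpace Ω] {X : Prim Ω L n m}
  {μ : Measure Ω}

lemma memLp_state (hX : X.HasLaws N μ) (k : ℕ) (l : Fin L) : MemLp (N.state X k l) 2 μ := by
  induction k with
  | zero =>
    have h : HasGaussianLaw (X.x₀ l) μ := ⟨by rw [hX.law_x₀ l]; infer_instance⟩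
    exact h.memLp_two
  | succ k ih =>
    have h : HasGaussianLaw (X.w k l) μ := ⟨by rw [hX.law_w k l]; infer_instance⟩
    exact (memLp_two_toEuclideanLin (N.F l) ih).add h.memLp_two

lemma estInfo_le (hX : X.HasLaws N μ) {β : ℕ → Ω → Fin L → Bool} {κ : ℕ → Ω → Fin L → ℝ}
    (he : IsErasure X μ κ β) (k : ℕ) (l : Fin L) :
    N.estInfo X β k l ≤ mΩ :=
  (N.estInfo_le_coordInfo X β k l).trans (N.coordInfo_le hX he k)

lemma integrable_trace_covState [IsFiniteMeasure μ] (hX : X.HasLaws N μ) {β : ℕ → Ω → Fin L → Bool}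
    {κ : ℕ → Ω → Fin L → ℝ}
    (he : IsErasure X μ κ β) (k : ℕ) (l : Fin L) :
    Integrable (fun ω => (N.Θ k l * N.covState β k ω l).trace) μ := by
  rw [← integrableOn_univ, ← iUnion_agree β k]
  refine integrableOn_finite_iUnion.2 fun h => ?_
  rw [integrableOn_congr_fun (g := fun _ => (N.Θ k l * N.covSeq (extendHist k h) k l).trace)
    (fun ω hω => by simp only [N.covState_eq_of_mem_agree hω])
    (N.coordInfo_le hX he k _ (N.measurableSet_agree X β k _))]
  exact integrableOn_const

section Filter

variable [IsProbabilityMeasure μ] (hX : X.HasLaws N μ) {β : ℕ → Ω → Fin L → Bool}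
    {κ : ℕ → Ω → Fin L → ℝ}
  (hκ : ∀ k, Measurable[N.coordInfo X β k] (κ k)) (he : IsErasure X μ κ β)
include hX hκ he

lemma memLp_filterErr (k : ℕ) (l : Fin L) : MemLp (N.filterErr X β k l) 2 μ := by
  have hm := N.measurable_filterErr hX he k l
  rw [memLp_two_iff_integrable_sq_norm hm.aestronglyMeasurable]
  exact N.integrable_filterErr hX hκ he (φ := fun z => ‖z‖ ^ 2)
    (Continuous.stronglyMeasurable (by fun_prop))
    fun b => (N.filterErr_fixed hX b k l).1.gauss.memLp_two.integrable_norm_pow two_ne_zero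

lemma memLp_kalman (k : ℕ) (l : Fin L) : MemLp (N.kalman X β k l) 2 μ := by
  have h : N.kalman X β k l = N.state X k l - N.filterErr X β k l := by
    funext ω
    simp [filterErr]
  rw [h]
  exact (N.memLp_state hX k l).sub (N.memLp_filterErr hX hκ he k l)

lemma setIntegral_filterErr_eq_zero (k : ℕ) (l : Fin L) {A : Set Ω}
    (hA : MeasurableSet[N.coordInfo X β k] A) : ∫ ω in A, N.filterErr X β k l ω ∂μ = 0 := by
  have := N.setIntegral_filterErr hX hκ he (k := k) (l := l) (φ := fun z => z)
    stronglyMeasurable_id (fun b => (N.filterErr_fixed hX b k l).1.gauss.integrable)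
    (c := fun _ => 0) (fun b _ _ => ((N.filterErr_fixed hX b k l).1.mean).symm) hA
  simpa using this

lemma condExp_filterErr (k : ℕ) (l : Fin L) :
    μ[N.filterErr X β k l | N.estInfo X β k l] =ᵐ[μ] 0 := by
  refine (ae_eq_condExp_of_forall_setIntegral_eq (N.estInfo_le hX he k l)
    ((N.memLp_filterErr hX hκ he k l).integrable one_le_two)
    (fun _ _ _ => integrableOn_zero) (fun s hs _ => ?_)
    (@StronglyMeasurable.aestronglyMeasurable _ _ _ (N.estInfo X β k l) _ _ _
      stronglyMeasurable_zero)).symm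
  rw [N.setIntegral_filterErr_eq_zero hX hκ he k l (N.estInfo_le_coordInfo X β k l _ hs)]
  simp

lemma kalman_ae_eq_condExp (k : ℕ) (l : Fin L) :
    N.kalman X β k l =ᵐ[μ] μ[N.state X k l | N.estInfo X β k l] := by
  have hk := (N.memLp_kalman hX hκ he k l).integrable one_le_two
  have h1 : N.state X k l = N.filterErr X β k l + N.kalman X β k l := by
    funext ω
    simp [filterErr]
  have h2 := condExp_add ((N.memLp_filterErr hX hκ he k l).integrable one_le_two) hk
    (N.estInfo X β k l)
  rw [condExp_of_stronglyMeasurable (N.estInfo_le hX he k l)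
    (N.isEstimator_kalman X β k l).stronglyMeasurable hk, ← h1] at h2
  filter_upwards [h2, N.condExp_filterErr hX hκ he k l] with ω h h'
  rw [h, Pi.add_apply, h']
  simp

lemma covState_ae_eq_condExp (k : ℕ) (l : Fin L) (i j : Fin n) :
    (fun ω => N.covState β k ω l i j) =ᵐ[μ]
      μ[fun ω => (N.state X k l ω - (μ[N.state X k l | N.estInfo X β k l]) ω) i *
          (N.state X k l ω - (μ[N.state X k l | N.estInfo X β k l]) ω) j
        | N.estInfo X β k l] := by
  have hle := N.estInfo_le hX he k l
  have hmul : Integrable (fun ω => N.filterErr X β k l ω i * N.filterErr X β k l ω j) μ :=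
    (memLp_two_apply (N.memLp_filterErr hX hκ he k l) i).integrable_mul
      (memLp_two_apply (N.memLp_filterErr hX hκ he k l) j)
  have hc : ∀ b, ∀ ω ∈ agree β k b, N.covState β k ω l i j =
      ∫ ω', N.filterErr X (fixed b) k l ω' i * N.filterErr X (fixed b) k l ω' j ∂μ := by
    intro b ω hω
    rw [N.covState_eq_of_mem_agree hω, (N.filterErr_fixed hX b k l).1.integral_mul]
  have hmeas : Measurable[N.estInfo X β k l] fun ω => N.covState β k ω l i j :=
    @Measurable.comp _ _ _ (N.estInfo X β k l) ⊤ _ (fun P : Matrix (Fin n) (Fin n) ℝ => P i j) _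
        measurable_from_top
      (@measurable_covState_apply_top L n m N Ω (N.estInfo X β k l) β k l fun t ht =>
        N.measurable_arrival_estInfo X β ht l)
  have hcint : Integrable (fun ω => N.covState β k ω l i j) μ := by
    rw [← integrableOn_univ, ← iUnion_agree β k]
    refine integrableOn_finite_iUnion.2 fun h => ?_
    rw [integrableOn_congr_fun (fun ω hω => hc _ ω hω)
      (N.coordInfo_le hX he k _ (N.measurableSet_agree X β k _))]
    exact integrableOn_const
  have h1 : (fun ω => N.covState β k ω l i j) =ᵐ[μ]
      μ[fun ω => N.filterErr X β k l ω i * N.filterErr X β k l ω j | N.estInfo X β k l] := by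
    refine ae_eq_condExp_of_forall_setIntegral_eq hle hmul (fun s _ _ => hcint.integrableOn)
      (fun s hs _ => ?_) hmeas.stronglyMeasurable.aestronglyMeasurable
    exact (N.setIntegral_filterErr hX hκ he (k := k) (l := l) (φ := fun z => z i * z j)
      (Continuous.stronglyMeasurable (by fun_prop))
      (fun b => (N.filterErr_fixed hX b k l).1.integrable_mul i j) hc
      (N.estInfo_le_coordInfo X β k l _ hs)).symm
  -- The conditional expectation inside the covariance may be replaced by the Kalman estimate, which
  -- turns the deviation into the filtering error.
  refine h1.trans (condExp_congr_ae ?_)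
  filter_upwards [N.kalman_ae_eq_condExp hX hκ he k l] with ω hω
  rw [← hω]
  rfl

lemma integral_wnormSq_filterErr (k : ℕ) (l : Fin L) :
    ∫ ω, wnormSq (N.Θ k l) (N.filterErr X β k l ω) ∂μ =
      ∫ ω, (N.Θ k l * N.covState β k ω l).trace ∂μ := by
  have := N.setIntegral_filterErr hX hκ he (k := k) (l := l) (φ := wnormSq (N.Θ k l))
    (continuous_wnormSq _).stronglyMeasurable
    (fun b => integrable_wnormSq (N.filterErr_fixed hX b k l).1.gauss.memLp_two _)
    (c := fun ω => (N.Θ k l * N.covState β k ω l).trace) (fun b ω hω => by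
      rw [N.covState_eq_of_mem_agree hω, (N.filterErr_fixed hX b k l).1.integral_wnormSq]
      exact N.posSemidef_covState _ k () l) MeasurableSet.univ
  simpa using this

lemma meanSqErr_kalman (k : ℕ) (l : Fin L) :
    N.meanSqErr X μ k l (N.kalman X β k l) =
      ∫⁻ ω, ENNReal.ofReal (N.Θ k l * N.covState β k ω l).trace ∂μ := by
  rw [← ofReal_integral_eq_lintegral_ofReal (N.integrable_trace_covState hX he k l)
    (Filter.Eventually.of_forall fun ω => trace_mul_nonneg (N.Θ_posDef k l)
      (N.posSemidef_covState β k ω l)), ← N.integral_wnormSq_filterErr hX hκ he,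
    ofReal_integral_eq_lintegral_ofReal
      (integrable_wnormSq (N.memLp_filterErr hX hκ he k l) _)
      (Filter.Eventually.of_forall fun ω => wnormSq_nonneg (N.Θ_posDef k l) _)]
  rfl

lemma meanSqErr_kalman_ne_top (k : ℕ) (l : Fin L) :
    N.meanSqErr X μ k l (N.kalman X β k l) ≠ ⊤ := by
  rw [N.meanSqErr_kalman hX hκ he,
    ← ofReal_integral_eq_lintegral_ofReal (N.integrable_trace_covState hX he k l)
    (Filter.Eventually.of_forall fun ω => trace_mul_nonneg (N.Θ_posDef k l)
      (N.posSemidef_covState β k ω l))]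
  exact ENNReal.ofReal_ne_top

/-- Mean squared error of an arbitrary admissible estimate with finite mean squared error. -/
lemma meanSqErr_eq_add (k : ℕ) (l : Fin L) {e : Ω → EuclideanSpace ℝ (Fin n)}
    (hem : Measurable[N.estInfo X β k l] e) (hfin : N.meanSqErr X μ k l e ≠ ⊤) :
    N.meanSqErr X μ k l e = N.meanSqErr X μ k l (N.kalman X β k l) +
      ∫⁻ ω, ENNReal.ofReal (wnormSq (N.Θ k l) (N.kalman X β k l ω - e ω)) ∂μ := by
  have hle := N.estInfo_le hX he k l
  obtain ⟨B, hB, hΘ⟩ := exists_factor (N.Θ_posDef k l)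
  have hBdet : IsUnit B.det := (Matrix.isUnit_iff_isUnit_det _).1 hB
  have hxm : Measurable (N.state X k l) :=
    N.measurable_state X (hX.meas_x₀ l) fun t _ => hX.meas_w t l
  have hdm : Measurable fun ω => B.toEuclideanLin (N.state X k l ω - e ω) :=
    measurable_toEuclideanLin B (hxm.sub (hem.mono hle le_rfl))
  -- Square integrability of `e` is not assumed. A finite error yields it for `B (x - e)`, and
  -- applying `B⁻¹` yields it for `x - e`.
  have hBd : MemLp (fun ω => B.toEuclideanLin (N.state X k l ω - e ω)) 2 μ := by
    rw [memLp_two_iff_integrable_sq_norm hdm.aestronglyMeasurable]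
    refine ⟨(hdm.norm.pow_const 2).aestronglyMeasurable, ?_⟩
    rw [hasFiniteIntegral_iff_ofReal (Filter.Eventually.of_forall fun ω => by positivity)]
    simp only [meanSqErr, hΘ, wnormSq_eq_norm_sq] at hfin
    exact lt_top_iff_ne_top.2 hfin
  have hd : MemLp (fun ω => N.state X k l ω - e ω) 2 μ := by
    have h := memLp_two_toEuclideanLin B⁻¹ hBd
    refine (memLp_congr_ae (Filter.Eventually.of_forall fun ω => ?_)).1 h
    apply WithLp.ofLp_injective
    simp only [ofLp_toEuclideanLin, Matrix.mulVec_mulVec, Matrix.nonsing_inv_mul _ hBdet,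
      Matrix.one_mulVec]
  have hu : MemLp (fun ω => N.kalman X β k l ω - e ω) 2 μ := by
    have h := hd.sub (N.memLp_filterErr hX hκ he k l)
    refine (memLp_congr_ae (Filter.Eventually.of_forall fun ω => ?_)).1 h
    simp [filterErr]
  have hum : Measurable[N.estInfo X β k l] fun ω => N.kalman X β k l ω - e ω :=
    (N.isEstimator_kalman X β k l).sub hem
  have hr := N.memLp_filterErr hX hκ he k l
  have h0 : μ[fun ω => B.toEuclideanLin (N.filterErr X β k l ω) | N.estInfo X β k l] =ᵐ[μ] 0 := by
    have h1 := B.toEuclideanLin.toContinuousLinearMap.comp_condExp_comm (m := N.estInfo X β k l)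
      (hr.integrable one_le_two)
    refine h1.symm.trans ?_
    filter_upwards [N.condExp_filterErr hX hκ he k l] with ω hω
    simp [hω]
  have hpy := integral_norm_add_sq_of_condExp_eq_zero hle (memLp_two_toEuclideanLin B hr)
    (memLp_two_toEuclideanLin B hu) (measurable_toEuclideanLin B hum) h0
  have hsum : ∀ ω, B.toEuclideanLin (N.filterErr X β k l ω) +
      B.toEuclideanLin (N.kalman X β k l ω - e ω) = B.toEuclideanLin (N.state X k l ω - e ω) :=
    fun ω => by
      rw [← map_add, filterErr]
      congr 1
      abel
  simp only [hsum, ← wnormSq_eq_norm_sq, ← hΘ] at hpy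
  have hnn : ∀ f : Ω → EuclideanSpace ℝ (Fin n), 0 ≤ᵐ[μ] fun ω => wnormSq (N.Θ k l) (f ω) :=
    fun f => Filter.Eventually.of_forall fun ω => wnormSq_nonneg (N.Θ_posDef k l) _
  rw [meanSqErr, ← ofReal_integral_eq_lintegral_ofReal (integrable_wnormSq hd _) (hnn _), hpy,
    ENNReal.ofReal_add (integral_nonneg_of_ae (hnn _)) (integral_nonneg_of_ae (hnn _)),
    ofReal_integral_eq_lintegral_ofReal (integrable_wnormSq hr _) (hnn _),
    ofReal_integral_eq_lintegral_ofReal (integrable_wnormSq hu _) (hnn _)]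
  rfl

lemma meanSqErr_kalman_le (k : ℕ) (l : Fin L) {e : Ω → EuclideanSpace ℝ (Fin n)}
    (hem : Measurable[N.estInfo X β k l] e) :
    N.meanSqErr X μ k l (N.kalman X β k l) ≤ N.meanSqErr X μ k l e := by
  by_cases hfin : N.meanSqErr X μ k l e = ⊤
  · rw [hfin]
    exact le_top
  · rw [N.meanSqErr_eq_add hX hκ he k l hem hfin]
    exact le_self_add

lemma ae_eq_kalman_of_meanSqErr_eq (k : ℕ) (l : Fin L) {e : Ω → EuclideanSpace ℝ (Fin n)}
    (hem : Measurable[N.estInfo X β k l] e)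
    (heq : N.meanSqErr X μ k l e = N.meanSqErr X μ k l (N.kalman X β k l)) :
    e =ᵐ[μ] N.kalman X β k l := by
  have hfk := N.meanSqErr_kalman_ne_top hX hκ he k l
  have hle := N.estInfo_le hX he k l
  have h := N.meanSqErr_eq_add hX hκ he k l hem (heq ▸ hfk)
  rw [heq] at h
  -- The minimal error is finite and can be cancelled, so the excess term is zero.
  have h0 : ∫⁻ ω, ENNReal.ofReal (wnormSq (N.Θ k l) (N.kalman X β k l ω - e ω)) ∂μ = 0 :=
    (ENNReal.add_right_inj hfk).1 (h.symm.trans (add_zero _).symm)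
  have hm : Measurable fun ω => ENNReal.ofReal (wnormSq (N.Θ k l) (N.kalman X β k l ω - e ω)) :=
    ((continuous_wnormSq _).measurable.comp
      (((N.isEstimator_kalman X β k l).sub hem).mono hle le_rfl)).ennreal_ofReal
  rw [lintegral_eq_zero_iff hm] at h0
  filter_upwards [h0] with ω hω
  obtain ⟨B, hB, hΘ⟩ := exists_factor (N.Θ_posDef k l)
  have hBdet : IsUnit B.det := (Matrix.isUnit_iff_isUnit_det _).1 hB
  have h1 := ENNReal.ofReal_eq_zero.1 hω
  rw [hΘ, wnormSq_eq_norm_sq] at h1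
  have h2 : ‖B.toEuclideanLin (N.kalman X β k l ω - e ω)‖ = 0 := by
    nlinarith [norm_nonneg (B.toEuclideanLin (N.kalman X β k l ω - e ω))]
  have h3 := congrArg (fun z => B⁻¹ *ᵥ WithLp.ofLp z) (norm_eq_zero.1 h2)
  simp only [ofLp_toEuclideanLin, Matrix.mulVec_mulVec, Matrix.nonsing_inv_mul _ hBdet,
    Matrix.one_mulVec, WithLp.ofLp_zero, Matrix.mulVec_zero] at h3
  have h4 : N.kalman X β k l ω - e ω = 0 := WithLp.ofLp_injective _ h3
  exact (sub_eq_zero.1 h4).symm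

end Filter

end Net

lemma eq_of_tsum_eq_of_le {ι : Type*} {f g : ι → ℝ≥0∞} (hfg : ∀ i, f i ≤ g i)
    (heq : ∑' i, g i = ∑' i, f i) (hfin : ∑' i, f i ≠ ⊤) (i : ι) : f i = g i := by
  by_contra hne
  exact (ENNReal.tsum_lt_tsum hfin hfg ((hfg i).lt_of_ne hne)).ne heq.symm

namespace Net

variable {L n m : ℕ} (N : Net L n m) {Ω : Type*} [mΩ : MeasurableSpace Ω] {X : Prim Ω L n m}
  {μ : Measure Ω}

/-! ### Costs as series -/

lemma lintegral_ofReal_discounted (k : ℕ) (c : Ω → ℝ) :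
    ∫⁻ ω, ENNReal.ofReal (N.α ^ k * c ω) ∂μ =
      ENNReal.ofReal (N.α ^ k) * ∫⁻ ω, ENNReal.ofReal (c ω) ∂μ := by
  rw [← lintegral_const_mul' _ _ ENNReal.ofReal_ne_top]
  exact lintegral_congr fun ω => ENNReal.ofReal_mul (pow_nonneg N.α_pos.le k)

lemma finiteCost_eq_sum {c : ℕ → Ω → ℝ} (hc : ∀ k, Measurable (c k)) (K : ℕ) :
    N.finiteCost μ c K = ∑ k ∈ Finset.range (K + 1),
      ENNReal.ofReal (N.α ^ k) * ∫⁻ ω, ENNReal.ofReal (c k ω) ∂μ := by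
  rw [finiteCost, lintegral_finsetSum _ fun k _ => ((hc k).const_mul _).ennreal_ofReal]
  exact Finset.sum_congr rfl fun k _ => N.lintegral_ofReal_discounted k (c k)

lemma discCost_eq_tsum {c : ℕ → Ω → ℝ} (hc : ∀ k, Measurable (c k)) :
    N.discCost μ c = ∑' k, ENNReal.ofReal (N.α ^ k) * ∫⁻ ω, ENNReal.ofReal (c k ω) ∂μ := by
  -- The cost up to time `K` has `K + 1` terms, hence the shift by one.
  rw [discCost, ENNReal.tsum_eq_iSup_nat' (Filter.tendsto_add_atTop_nat 1)]
  exact iSup_congr fun K => N.finiteCost_eq_sum hc K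

lemma measurable_trace_covState {β : ℕ → Ω → Fin L → Bool}
    (hβ : ∀ k, Measurable (β k)) (k : ℕ) (l : Fin L) :
    Measurable fun ω => (N.Θ k l * N.covState β k ω l).trace :=
  @Measurable.comp _ _ _ mΩ ⊤ _
    (fun S : Fin L → Matrix (Fin n) (Fin n) ℝ => (N.Θ k l * S l).trace) _ measurable_from_top
    (N.measurable_covState_top fun t _ => hβ t)

/-- Stage costs, as expectations. -/
lemma lintegral_stage {c : Fin L → Ω → ℝ} {p : Ω → Fin L → ℝ} (hp : Measurable p)
    (hp0 : ∀ ω l, 0 ≤ p ω l) (hc : ∀ l, Measurable (c l)) (hc0 : ∀ l ω, 0 ≤ c l ω) :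
    ∫⁻ ω, ENNReal.ofReal (∑ l, (p ω l + N.lam l * c l ω)) ∂μ =
      ∑ l, (∫⁻ ω, ENNReal.ofReal (p ω l) ∂μ +
        ENNReal.ofReal (N.lam l) * ∫⁻ ω, ENNReal.ofReal (c l ω) ∂μ) := by
  have hpl : ∀ l, Measurable fun ω => p ω l := fun l => (measurable_pi_apply l).comp hp
  have h : ∀ ω, ENNReal.ofReal (∑ l, (p ω l + N.lam l * c l ω)) =
      ∑ l, (ENNReal.ofReal (p ω l) + ENNReal.ofReal (N.lam l) * ENNReal.ofReal (c l ω)) := by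
    intro ω
    rw [ENNReal.ofReal_sum_of_nonneg fun l _ =>
      add_nonneg (hp0 ω l) (mul_nonneg (N.lam_pos l).le (hc0 l ω))]
    refine Finset.sum_congr rfl fun l _ => ?_
    rw [ENNReal.ofReal_add (hp0 ω l) (mul_nonneg (N.lam_pos l).le (hc0 l ω)),
      ENNReal.ofReal_mul (N.lam_pos l).le]
  simp only [h]
  refine (lintegral_finsetSum _ fun l _ =>
    (hpl l).ennreal_ofReal.add ((hc l).ennreal_ofReal.const_mul _)).trans ?_
  refine Finset.sum_congr rfl fun l _ => ?_
  refine (lintegral_add_left (hpl l).ennreal_ofReal _).trans ?_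
  rw [lintegral_const_mul _ (hc l).ennreal_ofReal]

lemma IsPowerSchedule.measurable_psr {p : ℕ → Ω → Fin L → ℝ} {β : ℕ → Ω → Fin L → Bool}
    (h : N.IsPowerSchedule X μ p β) (k : ℕ) :
    Measurable[N.coordInfo X β k] fun ω => N.psr k (p k ω) :=
  (N.measurable_psr k).comp (h.causal k)

lemma jointCost_eq_tsum (hX : X.HasLaws N μ) {p : ℕ → Ω → Fin L → ℝ}
    {β : ℕ → Ω → Fin L → Bool} (h : N.IsPowerSchedule X μ p β)
    {est : ℕ → Fin L → Ω → EuclideanSpace ℝ (Fin n)}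
    (hest : N.IsEstimator X β est) :
    N.jointCost X μ p est = ∑' k, ENNReal.ofReal (N.α ^ k) *
      ∑ l, (∫⁻ ω, ENNReal.ofReal (p k ω l) ∂μ +
        ENNReal.ofReal (N.lam l) * N.meanSqErr X μ k l (est k l)) := by
  have hp : ∀ k, Measurable (p k) := fun k =>
    (h.causal k).mono (N.coordInfo_le hX h.erasure k) le_rfl
  have hw : ∀ k l, Measurable fun ω => wnormSq (N.Θ k l) (N.state X k l ω - est k l ω) :=
    fun k l => (continuous_wnormSq _).measurable.comp
      ((N.measurable_state X (hX.meas_x₀ l) fun t _ => hX.meas_w t l).sub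
        ((hest k l).mono (N.estInfo_le hX h.erasure k l) le_rfl))
  rw [jointCost, N.discCost_eq_tsum]
  · refine tsum_congr fun k => ?_
    rw [N.lintegral_stage (hp k) (fun ω l => (h.feasible k ω l).1) (hw k)
      fun l ω => wnormSq_nonneg (N.Θ_posDef k l) _]
    rfl
  · exact fun k => Finset.measurable_fun_sum _ fun l _ =>
      ((measurable_pi_apply l).comp (hp k)).add ((hw k l).const_mul _)

section Joint

variable [IsProbabilityMeasure μ] (hX : X.HasLaws N μ) {p : ℕ → Ω → Fin L → ℝ}
  {β : ℕ → Ω → Fin L → Bool} (h : N.IsPowerSchedule X μ p β)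
include hX h

lemma powerCost_eq_tsum :
    N.powerCost μ p β = ∑' k, ENNReal.ofReal (N.α ^ k) *
      ∑ l, (∫⁻ ω, ENNReal.ofReal (p k ω l) ∂μ +
        ENNReal.ofReal (N.lam l) * N.meanSqErr X μ k l (N.kalman X β k l)) := by
  have hp : ∀ k, Measurable (p k) := fun k =>
    (h.causal k).mono (N.coordInfo_le hX h.erasure k) le_rfl
  have hw := fun k l => N.measurable_trace_covState h.erasure.meas k l
  rw [powerCost, N.discCost_eq_tsum]
  · refine tsum_congr fun k => ?_
    simp only [powerStage]
    rw [N.lintegral_stage (hp k) (fun ω l => (h.feasible k ω l).1) (hw k)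
      fun l ω => trace_mul_nonneg (N.Θ_posDef k l) (N.posSemidef_covState β k ω l)]
    simp only [N.meanSqErr_kalman hX (fun k => IsPowerSchedule.measurable_psr N h k) h.erasure]
  · exact fun k => Finset.measurable_fun_sum _ fun l _ =>
      ((measurable_pi_apply l).comp (hp k)).add ((hw k l).const_mul _)

lemma jointCost_kalman : N.jointCost X μ p (N.kalman X β) = N.powerCost μ p β := by
  rw [N.jointCost_eq_tsum hX h (N.isEstimator_kalman X β), N.powerCost_eq_tsum hX h]

lemma joint_term_le {est : ℕ → Fin L → Ω → EuclideanSpace ℝ (Fin n)}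
    (hest : N.IsEstimator X β est) (k : ℕ) (l : Fin L) :
    ∫⁻ ω, ENNReal.ofReal (p k ω l) ∂μ +
        ENNReal.ofReal (N.lam l) * N.meanSqErr X μ k l (N.kalman X β k l) ≤
      ∫⁻ ω, ENNReal.ofReal (p k ω l) ∂μ +
        ENNReal.ofReal (N.lam l) * N.meanSqErr X μ k l (est k l) := by
  gcongr
  exact N.meanSqErr_kalman_le hX (fun k => IsPowerSchedule.measurable_psr N h k) h.erasure k l
    (hest k l)

lemma powerCost_le_jointCost {est : ℕ → Fin L → Ω → EuclideanSpace ℝ (Fin n)}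
    (hest : N.IsEstimator X β est) : N.powerCost μ p β ≤ N.jointCost X μ p est := by
  rw [N.jointCost_eq_tsum hX h hest, N.powerCost_eq_tsum hX h]
  refine ENNReal.tsum_le_tsum fun k => ?_
  gcongr with l
  exact N.meanSqErr_kalman_le hX (fun k => IsPowerSchedule.measurable_psr N h k) h.erasure k l
    (hest k l)

/-- Equality of two finite, termwise ordered series forces equality of the terms, at first for each
time and then for each link. The weights `α ^ k` and `lam l` are positive and cancel, which leaves
equal mean squared errors. -/
lemma ae_eq_kalman_of_jointCost_eq {est : ℕ → Fin L → Ω → EuclideanSpace ℝ (Fin n)}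
    (hest : N.IsEstimator X β est) (heq : N.jointCost X μ p est = N.powerCost μ p β)
    (hfin : N.powerCost μ p β ≠ ⊤) (k : ℕ) (l : Fin L) : est k l =ᵐ[μ] N.kalman X β k l := by
  rw [N.jointCost_eq_tsum hX h hest, N.powerCost_eq_tsum hX h] at heq
  rw [N.powerCost_eq_tsum hX h] at hfin
  have hα0 : ∀ k, ENNReal.ofReal (N.α ^ k) ≠ 0 := fun k =>
    (ENNReal.ofReal_pos.2 (pow_pos N.α_pos k)).ne'
  have h1 := eq_of_tsum_eq_of_le (fun k => mul_le_mul_right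
    (Finset.sum_le_sum fun l _ => N.joint_term_le hX h hest k l) _) heq hfin k
  have h2 := (ENNReal.mul_right_inj (hα0 k) ENNReal.ofReal_ne_top).1 h1
  have hfin2 := ENNReal.ne_top_of_tsum_ne_top hfin k
  have hfin3 : ∑ l, (∫⁻ ω, ENNReal.ofReal (p k ω l) ∂μ +
      ENNReal.ofReal (N.lam l) * N.meanSqErr X μ k l (N.kalman X β k l)) ≠ ⊤ := fun hs =>
    hfin2 (by rw [hs, ENNReal.mul_top (hα0 k)])
  rw [← tsum_fintype (L := .unconditional _)] at hfin3
  rw [← tsum_fintype (L := .unconditional _), ← tsum_fintype (L := .unconditional _)] at h2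
  have h3 := eq_of_tsum_eq_of_le (fun l => N.joint_term_le hX h hest k l) h2.symm hfin3 l
  have hfin4 := ENNReal.ne_top_of_tsum_ne_top hfin3 l
  have h4 := (ENNReal.add_right_inj (ENNReal.add_ne_top.1 hfin4).1).1 h3
  have h5 := (ENNReal.mul_right_inj (ENNReal.ofReal_pos.2 (N.lam_pos l)).ne'
    ENNReal.ofReal_ne_top).1 h4
  exact N.ae_eq_kalman_of_meanSqErr_eq hX (fun k => IsPowerSchedule.measurable_psr N h k)
    h.erasure k l (hest k l) h5.symm

lemma jointCost_congr {est : ℕ → Fin L → Ω → EuclideanSpace ℝ (Fin n)}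
    (hest : N.IsEstimator X β est) (heq : ∀ k l, est k l =ᵐ[μ] N.kalman X β k l) :
    N.jointCost X μ p est = N.powerCost μ p β := by
  rw [N.jointCost_eq_tsum hX h hest, N.powerCost_eq_tsum hX h]
  refine tsum_congr fun k => ?_
  congr 1
  refine Finset.sum_congr rfl fun l _ => ?_
  congr 2
  refine lintegral_congr_ae ?_
  filter_upwards [heq k l] with ω hω
  rw [hω]

end Joint

/-! ### Correspondence of power and PSR schedules -/

lemma IsPsrSchedule.isPowerSchedule {κ : ℕ → Ω → Fin L → ℝ} {β : ℕ → Ω → Fin L → Bool}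
    (h : N.IsPsrSchedule X μ κ β) : N.IsPowerSchedule X μ (fun k ω => N.Ψ k (κ k ω)) β where
  causal k := @measurable_Ψ_comp L n m N Ω (N.coordInfo X β k) k _ (h.causal k) (h.feasible k)
  feasible k ω := N.mapsTo_Ψ k (h.feasible k ω)
  erasure := by
    have : (fun k ω => N.psr k (N.Ψ k (κ k ω))) = κ := by
      funext k ω
      exact N.psr_Ψ k (h.feasible k ω)
    rw [this]
    exact h.erasure

lemma IsPowerSchedule.isPsrSchedule {p : ℕ → Ω → Fin L → ℝ} {β : ℕ → Ω → Fin L → Bool}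
    (h : N.IsPowerSchedule X μ p β) : N.IsPsrSchedule X μ (fun k ω => N.psr k (p k ω)) β where
  causal k := (N.measurable_psr k).comp (h.causal k)
  feasible k ω := N.mapsTo_psr k (h.feasible k ω)
  erasure := h.erasure

lemma powerCost_Ψ (κ : ℕ → Ω → Fin L → ℝ) (β : ℕ → Ω → Fin L → Bool) :
    N.powerCost μ (fun k ω => N.Ψ k (κ k ω)) β = N.psrCost μ κ β := rfl

lemma psrCost_psr {p : ℕ → Ω → Fin L → ℝ} {β : ℕ → Ω → Fin L → Bool}
    (h : N.IsPowerSchedule X μ p β) :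
    N.psrCost μ (fun k ω => N.psr k (p k ω)) β = N.powerCost μ p β := by
  have : p = fun k ω => N.Ψ k (N.psr k (p k ω)) := by
    funext k ω
    exact (N.Ψ_psr k fun l => (h.feasible k ω l).1).symm
  conv_rhs => rw [this]
  rfl

end Net

namespace Net

variable {L n m : ℕ} (N : Net L n m)

/-! ### Dynamic programming -/

/-- Stage cost plus discounted expected cost-to-go `V` of the action `κ` in state `S`. -/
noncomputable def actionCost (k : ℕ) (S : Fin L → Matrix (Fin n) (Fin n) ℝ)
    (V : (Fin L → Matrix (Fin n) (Fin n) ℝ) → ℝ≥0∞) (κ : Fin L → ℝ) : ℝ≥0∞ :=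
  ENNReal.ofReal (N.psrStage k S κ) + ENNReal.ofReal N.α *
    ∑ b : Fin L → Bool, ENNReal.ofReal (outcomeProb κ b) * V (N.stateStep S b)

/-- Optimal cost of `K` stages from time `k` on. -/
noncomputable def valueIter : ℕ → ℕ → (Fin L → Matrix (Fin n) (Fin n) ℝ) → ℝ≥0∞
  | 0, _, _ => 0
  | K + 1, k, S => ⨅ κ ∈ N.psrRegion k, N.actionCost k S (valueIter K (k + 1)) κ

/-- Limit of the optimal finite-horizon costs. -/
noncomputable def value (k : ℕ) (S : Fin L → Matrix (Fin n) (Fin n) ℝ) : ℝ≥0∞ :=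
  ⨆ K, N.valueIter K k S

lemma mdpFiniteCost_succ (ν : ℕ → (Fin L → Matrix (Fin n) (Fin n) ℝ) → Fin L → ℝ) (K k : ℕ)
    (S : Fin L → Matrix (Fin n) (Fin n) ℝ) :
    N.mdpFiniteCost ν (K + 1) k S = N.actionCost k S (N.mdpFiniteCost ν K (k + 1)) (ν k S) := rfl

lemma actionCost_mono (k : ℕ) (S : Fin L → Matrix (Fin n) (Fin n) ℝ) (κ : Fin L → ℝ)
    {V V' : (Fin L → Matrix (Fin n) (Fin n) ℝ) → ℝ≥0∞} (h : ∀ S, V S ≤ V' S) :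
    N.actionCost k S V κ ≤ N.actionCost k S V' κ := by
  unfold actionCost
  gcongr
  exact h _

/-- Monotone convergence through a finite sum; it carries the optimality inequality from finite
horizons to the limit. -/
lemma actionCost_iSup (k : ℕ) (S : Fin L → Matrix (Fin n) (Fin n) ℝ) (κ : Fin L → ℝ)
    {V : ℕ → (Fin L → Matrix (Fin n) (Fin n) ℝ) → ℝ≥0∞} (h : ∀ S, Monotone fun K => V K S) :
    N.actionCost k S (fun S => ⨆ K, V K S) κ = ⨆ K, N.actionCost k S (V K) κ := by
  unfold actionCost
  simp_rw [ENNReal.mul_iSup]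
  rw [ENNReal.finsetSum_iSup_of_monotone
    (f := fun b K => ENNReal.ofReal (outcomeProb κ b) * V K (N.stateStep S b))
    fun b K K' hK => mul_le_mul_right (h _ hK) _, ENNReal.mul_iSup, ENNReal.add_iSup]

lemma valueIter_monotone (k : ℕ) (S : Fin L → Matrix (Fin n) (Fin n) ℝ) :
    Monotone fun K => N.valueIter K k S := by
  refine monotone_nat_of_le_succ fun K => ?_
  induction K generalizing k S with
  | zero => exact zero_le
  | succ K ih => exact iInf₂_mono fun κ _ => N.actionCost_mono k S κ (ih (k + 1))

lemma valueIter_le_mdpFiniteCost {ν : ℕ → (Fin L → Matrix (Fin n) (Fin n) ℝ) → Fin L → ℝ}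
    (hν : ν ∈ N.mdpPolicies) (K k : ℕ) (S : Fin L → Matrix (Fin n) (Fin n) ℝ) :
    N.valueIter K k S ≤ N.mdpFiniteCost ν K k S := by
  induction K generalizing k S with
  | zero => exact le_rfl
  | succ K ih => exact (iInf₂_le (ν k S) (hν k S)).trans (N.actionCost_mono k S _ (ih (k + 1)))

lemma value_le_mdpCost {ν : ℕ → (Fin L → Matrix (Fin n) (Fin n) ℝ) → Fin L → ℝ}
    (hν : ν ∈ N.mdpPolicies) : N.value 0 N.R₀ ≤ N.mdpCost ν :=
  iSup_mono fun K => N.valueIter_le_mdpFiniteCost hν K 0 N.R₀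

lemma valueIter_ne_top (K k : ℕ) (S : Fin L → Matrix (Fin n) (Fin n) ℝ) :
    N.valueIter K k S ≠ ⊤ := by
  induction K generalizing k S with
  | zero => exact ENNReal.zero_ne_top
  | succ K ih =>
    refine ne_top_of_le_ne_top ?_ (iInf₂_le _ (N.psr_mem_psrRegion k N.zero_mem_powers))
    exact ENNReal.add_ne_top.2 ⟨ENNReal.ofReal_ne_top, ENNReal.mul_ne_top ENNReal.ofReal_ne_top
      (ENNReal.sum_ne_top.2 fun b _ => ENNReal.mul_ne_top ENNReal.ofReal_ne_top (ih _ _))⟩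

/-- Actions are parametrized by powers, which range over a compact box. There `Ψ` composed with
`psr` is the identity, so the stage cost is affine and continuity of `Ψ` is never needed. -/
lemma continuousOn_actionCost_psr (k : ℕ) (S : Fin L → Matrix (Fin n) (Fin n) ℝ)
    {V : (Fin L → Matrix (Fin n) (Fin n) ℝ) → ℝ≥0∞} (hV : ∀ S, V S ≠ ⊤) :
    ContinuousOn (fun p => N.actionCost k S V (N.psr k p)) N.powers := by
  have hst : ContinuousOn (fun p => N.psrStage k S (N.psr k p)) N.powers := by
    have : Continuous fun p : Fin L → ℝ => N.powerStage k S p := by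
      unfold powerStage
      fun_prop
    refine this.continuousOn.congr fun p hp => ?_
    simp only [psrStage, powerStage, N.Ψ_psr k fun l => (hp l).1]
  have hprob : ∀ b, Continuous fun κ : Fin L → ℝ => outcomeProb κ b := fun b => by
    unfold outcomeProb
    refine continuous_finsetProd _ fun l _ => ?_
    split_ifs <;> fun_prop
  unfold actionCost
  refine (ENNReal.continuous_ofReal.comp_continuousOn hst).add ?_
  refine (ENNReal.continuous_const_mul ENNReal.ofReal_ne_top).comp_continuousOn ?_
  refine continuousOn_finsetSum _ fun b _ => ?_
  exact (ENNReal.continuous_mul_const (hV _)).comp_continuousOn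
    (ENNReal.continuous_ofReal.comp_continuousOn
      ((hprob b).comp_continuousOn (N.continuousOn_psr k)))

/-- The value function satisfies the optimality inequality with a minimizing action. -/
lemma exists_actionCost_le_value (k : ℕ) (S : Fin L → Matrix (Fin n) (Fin n) ℝ) :
    ∃ κ ∈ N.psrRegion k, N.actionCost k S (N.value (k + 1)) κ ≤ N.value k S := by
  -- Powers whose cost with `K` further stages does not exceed the limit value. These sets are
  -- compact, nonempty and decreasing in `K`, so one power vector serves all horizons.
  let A : ℕ → Set (Fin L → ℝ) := fun K => N.powers ∩
    (fun p => N.actionCost k S (N.valueIter K (k + 1)) (N.psr k p)) ⁻¹' Set.Iic (N.value k S)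
  have hcont := fun K => N.continuousOn_actionCost_psr k S (N.valueIter_ne_top K (k + 1))
  have hclosed : ∀ K, IsClosed (A K) := fun K =>
    (hcont K).preimage_isClosed_of_isClosed N.isCompact_powers.isClosed isClosed_Iic
  have hne : ∀ K, (A K).Nonempty := fun K => by
    obtain ⟨p, hp, hmin⟩ := N.isCompact_powers.exists_isMinOn ⟨0, N.zero_mem_powers⟩ (hcont K)
    refine ⟨p, hp, le_trans (le_iInf₂ fun κ hκ => ?_)
      (le_iSup (fun K => N.valueIter K k S) (K + 1))⟩
    -- A minimizer over powers is one over PSRs, and it attains the optimal cost of `K + 1` stages,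
    -- which is at most the limit value.
    have := hmin (N.mapsTo_Ψ k hκ)
    simpa only [Set.mem_ofPred_eq, N.psr_Ψ k hκ] using this
  obtain ⟨p, hp⟩ := IsCompact.nonempty_iInter_of_sequence_nonempty_isCompact_isClosed A
    (fun K p hp => ⟨hp.1, (N.actionCost_mono k S _ fun S =>
      N.valueIter_monotone (k + 1) S K.le_succ).trans hp.2⟩) hne
    (N.isCompact_powers.of_isClosed_subset (hclosed 0) Set.inter_subset_left) hclosed
  rw [Set.mem_iInter] at hp
  refine ⟨N.psr k p, N.psr_mem_psrRegion k (hp 0).1, ?_⟩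
  unfold value
  rw [N.actionCost_iSup k S _ (N.valueIter_monotone (k + 1))]
  exact iSup_le fun K => (hp K).2

/-- The policy of minimizing actions is optimal: with zero terminal cost, induction on the horizon
keeps its finite cost below the value, and every policy costs at least the value. -/
lemma exists_mdpCost_eq_value : ∃ ν ∈ N.mdpPolicies, N.mdpCost ν = N.value 0 N.R₀ := by
  choose ν hν hle using N.exists_actionCost_le_value
  have hfin : ∀ K k S, N.mdpFiniteCost ν K k S ≤ N.value k S := by
    intro K
    induction K with
    | zero => exact fun _ _ => zero_le
    | succ K ih =>
      exact fun k S => (N.actionCost_mono k S _ (ih (k + 1))).trans (hle k S)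
  exact ⟨ν, hν, (iSup_le fun K => hfin K 0 N.R₀).antisymm (N.value_le_mdpCost hν)⟩

/-! ### Cost of a PSR schedule -/

variable {Ω : Type*}

lemma measurable_covState_comp {m' : MeasurableSpace Ω} {β : ℕ → Ω → Fin L → Bool}
    {γ : Type*} [MeasurableSpace γ] {k : ℕ}
    (hβ : ∀ t < k, Measurable[m'] (β t)) (V : (Fin L → Matrix (Fin n) (Fin n) ℝ) → γ) :
    Measurable[m'] fun ω => V (N.covState β k ω) :=
  @Measurable.comp _ _ _ m' ⊤ _ V _ measurable_from_top
    (@measurable_covState_top L n m N Ω m' β k hβ)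

variable [mΩ : MeasurableSpace Ω] {X : Prim Ω L n m} {μ : Measure Ω}
  {κ : ℕ → Ω → Fin L → ℝ} {β : ℕ → Ω → Fin L → Bool}

lemma IsPsrSchedule.measurable_psrStage (hX : X.HasLaws N μ) (h : N.IsPsrSchedule X μ κ β)
    (k : ℕ) : Measurable fun ω => N.psrStage k (N.covState β k ω) (κ k ω) := by
  have hp : Measurable fun ω => N.Ψ k (κ k ω) :=
    ((IsPsrSchedule.isPowerSchedule N h).causal k).mono (N.coordInfo_le hX h.erasure k) le_rfl
  exact Finset.measurable_fun_sum _ fun l _ => ((measurable_pi_apply l).comp hp).add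
    ((N.measurable_trace_covState h.erasure.meas k l).const_mul _)

section OneStep

variable [IsFiniteMeasure μ] (hX : X.HasLaws N μ) (h : N.IsPsrSchedule X μ κ β)
include hX h

/-- The next state is split according to the arrivals at time `k`, whose conditional probabilities
replace the indicators. The schedule need not be Markov. -/
lemma lintegral_covState_succ (k : ℕ) (V : (Fin L → Matrix (Fin n) (Fin n) ℝ) → ℝ≥0∞) :
    ∫⁻ ω, V (N.covState β (k + 1) ω) ∂μ =
      ∫⁻ ω, ∑ b : Fin L → Bool, ENNReal.ofReal (outcomeProb (κ k ω) b) *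
        V (N.stateStep (N.covState β k ω) b) ∂μ := by
  have hβ := h.erasure.meas
  have hle := fullPast_le hX hβ k
  have hV : ∀ b, Measurable[fullPast X β k] fun ω => V (N.stateStep (N.covState β k ω) b) :=
    fun b => N.measurable_covState_comp (fun t ht => measurable_arrival_fullPast X β ht)
      fun S => V (N.stateStep S b)
  have hev : ∀ b, MeasurableSet {ω | β k ω = b} := fun b => hβ k (measurableSet_singleton b)
  have hκ : Measurable (κ k) := (h.causal k).mono (N.coordInfo_le hX h.erasure k) le_rfl
  have hsplit : ∀ ω, V (N.covState β (k + 1) ω) = ∑ b : Fin L → Bool,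
      {ω | β k ω = b}.indicator (fun ω => V (N.stateStep (N.covState β k ω) b)) ω := fun ω => by
    rw [Finset.sum_eq_single (β k ω)]
    · simp [covState]
    · exact fun b _ hb => Set.indicator_of_notMem (s := {ω | β k ω = b}) (fun hω => hb hω.symm) _
    · simp
  simp_rw [hsplit]
  rw [lintegral_finsetSum _ fun b _ => ((hV b).mono hle le_rfl).indicator (hev b)]
  refine Eq.trans ?_ (lintegral_finsetSum _ fun b _ =>
    ((measurable_outcomeProb b).comp hκ).ennreal_ofReal.mul ((hV b).mono hle le_rfl)).symm
  refine Finset.sum_congr rfl fun b _ => ?_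
  rw [lintegral_indicator (hev b)]
  exact setLIntegral_eq_of_condExp_indicator hle (hev b) (h.erasure.law k b) (hV b)

lemma lintegral_actionCost (k : ℕ) (V : (Fin L → Matrix (Fin n) (Fin n) ℝ) → ℝ≥0∞) :
    ∫⁻ ω, N.actionCost k (N.covState β k ω) V (κ k ω) ∂μ =
      ∫⁻ ω, ENNReal.ofReal (N.psrStage k (N.covState β k ω) (κ k ω)) ∂μ +
        ENNReal.ofReal N.α * ∫⁻ ω, V (N.covState β (k + 1) ω) ∂μ := by
  rw [N.lintegral_covState_succ hX h k V, ← lintegral_const_mul' _ _ ENNReal.ofReal_ne_top]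
  exact lintegral_add_left (IsPsrSchedule.measurable_psrStage N hX h k).ennreal_ofReal _


end OneStep

/-- Expected discounted cost of `K` stages of a PSR schedule from time `k` on. -/
noncomputable def horizonCost (μ : Measure Ω) (κ : ℕ → Ω → Fin L → ℝ)
    (β : ℕ → Ω → Fin L → Bool) : ℕ → ℕ → ℝ≥0∞
  | 0, _ => 0
  | K + 1, k => ∫⁻ ω, ENNReal.ofReal (N.psrStage k (N.covState β k ω) (κ k ω)) ∂μ +
      ENNReal.ofReal N.α * horizonCost μ κ β K (k + 1)

lemma horizonCost_eq_sum (K k : ℕ) :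
    N.horizonCost μ κ β K k = ∑ j ∈ Finset.range K, ENNReal.ofReal (N.α ^ j) *
      ∫⁻ ω, ENNReal.ofReal (N.psrStage (k + j) (N.covState β (k + j) ω) (κ (k + j) ω)) ∂μ := by
  induction K generalizing k with
  | zero => rfl
  | succ K ih =>
    rw [Finset.sum_range_succ', horizonCost, ih, Finset.mul_sum, add_comm]
    congr 1
    · refine Finset.sum_congr rfl fun j _ => ?_
      rw [← mul_assoc, ← ENNReal.ofReal_mul N.α_pos.le, ← pow_succ', add_right_comm k 1 j,
        add_assoc]
    · simp

section Schedule

variable (hX : X.HasLaws N μ) (h : N.IsPsrSchedule X μ κ β)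
include hX h

lemma psrCost_eq_iSup : N.psrCost μ κ β = ⨆ K, N.horizonCost μ κ β K 0 := by
  rw [psrCost, N.discCost_eq_tsum fun k => IsPsrSchedule.measurable_psrStage N hX h k,
    ENNReal.tsum_eq_iSup_nat]
  refine iSup_congr fun K => ?_
  simp only [N.horizonCost_eq_sum, zero_add]

variable [IsProbabilityMeasure μ]

lemma horizonCost_eq_mdpFiniteCost
    {ν : ℕ → (Fin L → Matrix (Fin n) (Fin n) ℝ) → Fin L → ℝ} (hν : N.Follows ν κ β) (K k : ℕ) :
    N.horizonCost μ κ β K k = ∫⁻ ω, N.mdpFiniteCost ν K k (N.covState β k ω) ∂μ := by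
  induction K generalizing k with
  | zero => simp [horizonCost, mdpFiniteCost]
  | succ K ih =>
    rw [horizonCost, ih, ← N.lintegral_actionCost hX h]
    refine lintegral_congr fun ω => ?_
    rw [mdpFiniteCost_succ, hν k ω]

lemma psrCost_eq_mdpCost
    {ν : ℕ → (Fin L → Matrix (Fin n) (Fin n) ℝ) → Fin L → ℝ} (hν : N.Follows ν κ β) :
    N.psrCost μ κ β = N.mdpCost ν := by
  rw [N.psrCost_eq_iSup hX h]
  refine iSup_congr fun K => ?_
  rw [N.horizonCost_eq_mdpFiniteCost hX h hν]
  simp [covState]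

/-- At each outcome the scheduled PSR vector is one competitor in the infimum, whatever part of the
history it uses. Dependence on more than the covariances therefore brings no gain. -/
lemma lintegral_valueIter_le (K k : ℕ) :
    ∫⁻ ω, N.valueIter K k (N.covState β k ω) ∂μ ≤ N.horizonCost μ κ β K k := by
  induction K generalizing k with
  | zero => simp [valueIter]
  | succ K ih =>
    refine (lintegral_mono fun ω => iInf₂_le (κ k ω) (h.feasible k ω)).trans ?_
    rw [N.lintegral_actionCost hX h, horizonCost]
    gcongr
    exact ih (k + 1)

lemma value_le_psrCost : N.value 0 N.R₀ ≤ N.psrCost μ κ β := by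
  rw [N.psrCost_eq_iSup hX h]
  refine iSup_mono fun K => le_trans ?_ (N.lintegral_valueIter_le hX h K 0)
  simp [covState]

end Schedule

end Net

-- Realization of MDP policies by uniform random variables

namespace Prim

variable {Ω : Type*} {L n m : ℕ} {X : Prim Ω L n m} {N : Net L n m}

/-- Labels of all plant variables, and of the uniform variables of the times before `k`. -/
def pastUnif (L k : ℕ) : Set (PrimIdx L) := {i | ∀ t l, i = .unif t l → t < k}

/-- Labels of the uniform variables of time `k`. -/
def nowUnif (L k : ℕ) : Set (PrimIdx L) := Set.range (.unif k)

lemma disjoint_nowUnif_pastUnif (L k : ℕ) : Disjoint (nowUnif L k) (pastUnif L k) := by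
  refine Set.disjoint_left.2 ?_
  rintro _ ⟨l, rfl⟩ h
  exact lt_irrefl k (h k l rfl)

lemma plantSigma_le_iSup_pastUnif (k : ℕ) : X.plantSigma ≤ ⨆ i ∈ pastUnif L k, X.sigma i :=
  sup_le (sup_le
    (iSup_le fun l => Net.le_iSup_sigma X (i := .init l) fun _ _ h => nomatch h)
    (iSup_le fun t => iSup_le fun l => Net.le_iSup_sigma X (i := .state t l)
      fun _ _ h => nomatch h))
    (iSup_le fun t => iSup_le fun l => Net.le_iSup_sigma X (i := .meas t l)
      fun _ _ h => nomatch h)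

lemma measurableSet_decide_U (k : ℕ) (l : Fin L) (r : ℝ) (c : Bool) :
    MeasurableSet[X.sigma (.unif k l)] {ω | decide (X.U k l ω ≤ r) = c} := by
  refine ⟨{x | decide (x ≤ r) = c}, ?_, rfl⟩
  cases c
  · exact (measurableSet_Ioi (a := r)).congr (by ext x; simp)
  · exact (measurableSet_Iic (a := r)).congr (by ext x; simp)

lemma setOf_decide_U_eq (k : ℕ) (q : Fin L → ℝ) (b : Fin L → Bool) :
    {ω | (fun l => decide (X.U k l ω ≤ q l)) = b} =
      ⋂ l, {ω | decide (X.U k l ω ≤ q l) = b l} := by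
  ext ω
  simp [funext_iff]

variable [MeasurableSpace Ω] {μ : Measure Ω} (hX : X.HasLaws N μ)
include hX

lemma HasLaws.measure_U_le (k : ℕ) (l : Fin L) {q : ℝ} (hq : q ∈ Set.Icc (0 : ℝ) 1) :
    μ {ω | X.U k l ω ≤ q} = ENNReal.ofReal q := by
  have : {ω | X.U k l ω ≤ q} = X.U k l ⁻¹' Set.Iic q := rfl
  rw [this, ← Measure.map_apply (hX.meas_U k l) measurableSet_Iic, hX.law_U,
    Measure.restrict_apply measurableSet_Iic]
  have : Set.Iic q ∩ Set.Icc 0 1 = Set.Icc 0 q := by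
    ext x
    simp only [Set.mem_inter_iff, Set.mem_Iic, Set.mem_Icc]
    exact ⟨fun h => ⟨h.2.1, h.1⟩, fun h => ⟨h.2, h.1, h.2.trans hq.2⟩⟩
  rw [this, Real.volume_Icc, sub_zero]

lemma HasLaws.measure_decide_U [IsProbabilityMeasure μ] (k : ℕ) {q : Fin L → ℝ}
    (hq : ∀ l, q l ∈ Set.Icc (0 : ℝ) 1) (b : Fin L → Bool) :
    μ {ω | (fun l => decide (X.U k l ω ≤ q l)) = b} =
      ENNReal.ofReal (Net.outcomeProb q b) := by
  have hinj : Function.Injective fun l : Fin L => PrimIdx.unif k l := fun a b h => by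
    simpa using h
  rw [setOf_decide_U_eq, (hX.indep.precomp hinj).meas_iInter fun l =>
      measurableSet_decide_U k l (q l) (b l), Net.outcomeProb,
    ENNReal.ofReal_prod_of_nonneg]
  · refine Finset.prod_congr rfl fun l _ => ?_
    cases b l
    · have : {ω | decide (X.U k l ω ≤ q l) = false} = {ω | X.U k l ω ≤ q l}ᶜ := by
        ext ω
        simp
      rw [this, prob_compl_eq_one_sub (measurableSet_le (hX.meas_U k l) measurable_const),
        hX.measure_U_le k l (hq l)]
      simp [ENNReal.ofReal_sub _ (hq l).1]
    · simpa using hX.measure_U_le k l (hq l)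
  · intro l _
    split_ifs
    · exact (hq l).1
    · exact sub_nonneg.2 (hq l).2

end Prim

namespace Net

variable {L n m : ℕ} (N : Net L n m) {Ω : Type*} (X : Prim Ω L n m)
  (ν : ℕ → (Fin L → Matrix (Fin n) (Fin n) ℝ) → Fin L → ℝ)

/-- Covariance states when the arrivals under the policy `ν` are simulated by the uniform
variables. -/
noncomputable def simState : ℕ → Ω → Fin L → Matrix (Fin n) (Fin n) ℝ
  | 0, _ => N.R₀
  | k + 1, ω => N.stateStep (simState k ω) fun l => decide (X.U k l ω ≤ ν k (simState k ω) l)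

/-- Arrivals under the policy `ν`, simulated by the uniform variables. -/
noncomputable def simArrival (k : ℕ) (ω : Ω) : Fin L → Bool :=
  fun l => decide (X.U k l ω ≤ ν k (N.simState X ν k ω) l)

/-- Arrivals depend on the covariance state and conversely; `simState` generates both in one
recursion, and this equality ties it to the general definition. -/
lemma covState_simArrival (k : ℕ) :
    N.covState (N.simArrival X ν) k = N.simState X ν k := by
  induction k with
  | zero => rfl
  | succ k ih =>
    funext ω
    rw [covState, ih]
    rfl

lemma simArrival_apply (k : ℕ) (ω : Ω) :
    N.simArrival X ν k ω =
      fun l => decide (X.U k l ω ≤ ν k (N.covState (N.simArrival X ν) k ω) l) := by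
  rw [covState_simArrival]
  rfl

/-- Only the uniform variables up to time `k` enter, which gives independence from the later ones.
The state has finitely many values, so `ν` may be arbitrary. -/
lemma measurable_simArrival {m' : MeasurableSpace Ω} {k : ℕ}
    (hU : ∀ t ≤ k, ∀ l, Measurable (X.U t l)) : Measurable (N.simArrival X ν k) := by
  induction k using Nat.strong_induction_on with
  | _ k ih =>
    have hκ := fun l => N.measurable_covState_comp (k := k)
      (fun t ht => ih t ht fun s hs => hU s (hs.trans ht.le)) fun S => ν k S l
    refine measurable_pi_lambda _ fun l => measurable_to_bool ?_
    have : (fun ω => N.simArrival X ν k ω l) ⁻¹' {true} =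
        {ω | X.U k l ω ≤ ν k (N.covState (N.simArrival X ν) k ω) l} := by
      ext ω
      simp [simArrival_apply]
    rw [this]
    exact measurableSet_le (hU k le_rfl l) (hκ l)

variable [mΩ : MeasurableSpace Ω] {μ : Measure Ω} [IsProbabilityMeasure μ] {X}
  (hX : X.HasLaws N μ) {ν} (hν : ν ∈ N.mdpPolicies)
include hX hν

/-- On each arrival history the thresholds are constants, so the arrivals at time `k` form an event
of the uniform variables of time `k`, which are independent of the plants and the earlier arrivals.
-/
lemma isErasure_simArrival :
    IsErasure X μ (fun k ω => ν k (N.covState (N.simArrival X ν) k ω)) (N.simArrival X ν) where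
  meas k := N.measurable_simArrival X ν fun t _ l => hX.meas_U t l
  law k b := by
    let β := N.simArrival X ν
    have hβ : ∀ k, Measurable (β k) := fun k =>
      N.measurable_simArrival X ν fun t _ l => hX.meas_U t l
    have hle := fullPast_le hX hβ k
    let q : (Fin k → Fin L → Bool) → Fin L → ℝ := fun h => ν k (N.covSeq (extendHist k h) k)
    let B : (Fin k → Fin L → Bool) → Set Ω := fun h =>
      {ω | (fun l => decide (X.U k l ω ≤ q h l)) = b}
    have hagree : ∀ h, MeasurableSet[fullPast X β k] (agree β k (extendHist k h)) := fun h =>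
      N.coordInfo_le_fullPast X β k _ (N.measurableSet_agree X β k _)
    have hBnow : ∀ h, MeasurableSet[⨆ i ∈ Prim.nowUnif L k, X.sigma i] (B h) := fun h => by
      rw [show B h = _ from Prim.setOf_decide_U_eq k (q h) b]
      exact @MeasurableSet.iInter _ _ (⨆ i ∈ Prim.nowUnif L k, X.sigma i) _ _ fun l =>
        le_iSup_sigma X (i := .unif k l) (Set.mem_range_self l) _
            (Prim.measurableSet_decide_U k l _ _)
    have hnow_le : ⨆ i ∈ Prim.nowUnif L k, X.sigma i ≤ mΩ := iSup₂_le fun i _ => hX.sigma_le i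
    have hpast : fullPast X β k ≤ ⨆ i ∈ Prim.pastUnif L k, X.sigma i := by
      refine sup_le (Prim.plantSigma_le_iSup_pastUnif k) (iSup_le fun t => Measurable.comap_le ?_)
      refine @measurable_simArrival L n m N Ω X ν (⨆ i ∈ Prim.pastUnif L k, X.sigma i) t
        fun s hs l => (comap_measurable _).mono (le_iSup_sigma X (i := .unif s l) ?_) le_rfl
      rintro _ _ ⟨⟩
      exact hs.trans_lt t.2
    have hindep : Indep (⨆ i ∈ Prim.nowUnif L k, X.sigma i) (fullPast X β k) μ :=
      indep_of_indep_of_le_right (indep_iSup_of_disjoint hX.sigma_le hX.indep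
        (Prim.disjoint_nowUnif_pastUnif L k)) hpast
    have hq : ∀ h l, q h l ∈ Set.Icc (0 : ℝ) 1 := fun h l =>
      N.mem_Icc_of_mem_psrRegion (hν k _) l
    have hq0 : ∀ h, 0 ≤ outcomeProb (q h) b := fun h => Finset.prod_nonneg fun l _ => by
      split_ifs
      · exact (hq h l).1
      · exact sub_nonneg.2 (hq h l).2
    have hB1 : ∀ h, ∫ ω, (B h).indicator (fun _ => (1 : ℝ)) ω ∂μ = outcomeProb (q h) b :=
        fun h => by
      rw [integral_indicator_const _ (hnow_le _ (hBnow h)), measureReal_def,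
        hX.measure_decide_U k (hq h) b, ENNReal.toReal_ofReal (hq0 h), smul_eq_mul, mul_one]
    have hone : ∀ ω, ω ∈ agree β k (extendHist k fun t : Fin k => β t ω) := fun ω =>
      mem_agree_extendHist.2 rfl
    have hcov : ∀ ω h, ω ∈ agree β k (extendHist k h) →
        N.covState β k ω = N.covSeq (extendHist k h) k :=
      fun ω h hω => N.covState_eq_of_mem_agree hω
    have hsum : ∀ (f : (Fin k → Fin L → Bool) → Ω → ℝ) (ω : Ω),
        ∑ h, (agree β k (extendHist k h)).indicator (f h) ω = f (fun t : Fin k => β t ω) ω := by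
      intro f ω
      rw [Finset.sum_eq_single fun t : Fin k => β t ω]
      · exact Set.indicator_of_mem (hone ω) _
      · exact fun h _ hne => Set.indicator_of_notMem (fun hω => hne (mem_agree_extendHist.1 hω)) _
      · simp
    -- Each summand is an event of the past times an event of the present uniform variables, so its
    -- conditional expectation is the first indicator times a constant.
    have hdecomp : {ω | β k ω = b}.indicator (fun _ => (1 : ℝ)) = ∑ h,
        (agree β k (extendHist k h)).indicator ((B h).indicator fun _ => (1 : ℝ)) := by
      funext ω
      rw [Finset.sum_apply, hsum]
      have : ω ∈ {ω | β k ω = b} ↔ ω ∈ B fun t : Fin k => β t ω := by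
        simp only [B, q, Set.mem_ofPred_eq, ← hcov ω _ (hone ω)]
        rw [show β k ω = _ from N.simArrival_apply X ν k ω]
      simp only [Set.indicator, this]
    have hint : ∀ h, Integrable ((B h).indicator fun _ => (1 : ℝ)) μ := fun h =>
      (integrable_const 1).indicator (hnow_le _ (hBnow h))
    have hpiece : ∀ h, μ[(agree β k (extendHist k h)).indicator
        ((B h).indicator fun _ => (1 : ℝ)) | fullPast X β k] =ᵐ[μ]
        (agree β k (extendHist k h)).indicator fun _ => outcomeProb (q h) b := fun h => by
      refine (condExp_indicator (hint h) (hagree h)).trans ?_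
      have := condExp_indep_eq hnow_le hle
        ((stronglyMeasurable_const (b := (1 : ℝ))).indicator (hBnow h)) hindep
      filter_upwards [this] with ω hω
      simp only [Set.indicator]
      split_ifs
      · exact hω.trans (hB1 h)
      · rfl
    change μ[{ω | β k ω = b}.indicator (fun _ => (1 : ℝ)) | fullPast X β k] =ᵐ[μ] _
    rw [hdecomp]
    refine (condExp_finsetSum (fun h _ => (hint h).indicator (hle _ (hagree h))) _).trans ?_
    have hall := ae_all_iff.2 hpiece
    filter_upwards [hall] with ω hω
    rw [Finset.sum_apply, Finset.sum_congr rfl fun h _ => hω h, hsum]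
    simp only [q, ← hcov ω _ (hone ω)]
    rfl

lemma isPsrSchedule_simArrival :
    N.IsPsrSchedule X μ (fun k ω => ν k (N.covState (N.simArrival X ν) k ω))
      (N.simArrival X ν) where
  causal k := N.measurable_covState_comp
    (fun _ ht => N.measurable_arrival_coordInfo X (N.simArrival X ν) ht) (ν k)
  feasible k _ := hν k _
  erasure := N.isErasure_simArrival hX hν

end Net

end RemoteEst

-- Assembly of the theorem

theorem theorem1 {L n m : ℕ} (N : RemoteEst.Net L n m)
    {Ω : Type*} [MeasurableSpace Ω] (μ : Measure Ω) [IsProbabilityMeasure μ]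
    (X : RemoteEst.Prim Ω L n m) (hX : X.HasLaws N μ) :
    -- the optimal estimate, whatever the power schedule
    (∀ p β, N.IsPowerSchedule X μ p β →
      N.IsEstimator X β (N.kalman X β) ∧
      ∀ k l,
        MemLp (N.state X k l) 2 μ ∧
        N.kalman X β k l =ᵐ[μ] μ[N.state X k l | N.estInfo X β k l] ∧
        (∀ i j, (fun ω => N.covState β k ω l i j) =ᵐ[μ]
          μ[fun ω => (N.state X k l ω - (μ[N.state X k l | N.estInfo X β k l]) ω) i *
              (N.state X k l ω - (μ[N.state X k l | N.estInfo X β k l]) ω) j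
            | N.estInfo X β k l]) ∧
        N.meanSqErr X μ k l (N.kalman X β k l) =
          ∫⁻ ω, ENNReal.ofReal (N.Θ k l * N.covState β k ω l).trace ∂μ ∧
        ∀ e, Measurable[N.estInfo X β k l] e →
          N.meanSqErr X μ k l (N.kalman X β k l) ≤ N.meanSqErr X μ k l e ∧
          (N.meanSqErr X μ k l e = N.meanSqErr X μ k l (N.kalman X β k l) →
            e =ᵐ[μ] N.kalman X β k l)) ∧
    -- with the optimal estimate, the joint cost is the covariance-based cost
    (∀ p β, N.IsPowerSchedule X μ p β →
      N.jointCost X μ p (N.kalman X β) = N.powerCost μ p β ∧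
      ∀ est, N.IsEstimator X β est → N.powerCost μ p β ≤ N.jointCost X μ p est) ∧
    -- powers and PSR requirements correspond through the Foschini–Miljanic map
    (∀ k, Set.MapsTo (N.Ψ k) (N.psrRegion k) N.powers ∧
      Set.MapsTo (N.psr k) N.powers (N.psrRegion k) ∧
      Set.InvOn (N.psr k) (N.Ψ k) (N.psrRegion k) N.powers) ∧
    (∀ κ β, N.IsPsrSchedule X μ κ β →
      N.IsPowerSchedule X μ (fun k ω => N.Ψ k (κ k ω)) β ∧
      N.powerCost μ (fun k ω => N.Ψ k (κ k ω)) β = N.psrCost μ κ β) ∧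
    (∀ p β, N.IsPowerSchedule X μ p β →
      N.IsPsrSchedule X μ (fun k ω => N.psr k (p k ω)) β ∧
      (∀ k ω, p k ω = N.Ψ k (N.psr k (p k ω)))) ∧
    -- covariance-feedback schedules and the MDP
    (∀ ν ∈ N.mdpPolicies,
      (∃ κ β, N.IsPsrSchedule X μ κ β ∧ N.Follows ν κ β) ∧
      ∀ κ β, N.IsPsrSchedule X μ κ β → N.Follows ν κ β → N.psrCost μ κ β = N.mdpCost ν) ∧
    -- all the optimization problems are solvable, with one common optimal value
    ∃ V : ℝ≥0∞,
      IsLeast {c | ∃ p β est, N.IsPowerSchedule X μ p β ∧ N.IsEstimator X β est ∧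
        c = N.jointCost X μ p est} V ∧
      IsLeast {c | ∃ p β, N.IsPowerSchedule X μ p β ∧ c = N.powerCost μ p β} V ∧
      IsLeast {c | ∃ κ β, N.IsPsrSchedule X μ κ β ∧ c = N.psrCost μ κ β} V ∧
      IsLeast (N.mdpCost '' N.mdpPolicies) V ∧
      (∀ ν ∈ N.mdpPolicies, IsMinOn N.mdpCost N.mdpPolicies ν →
        ∀ κ β, N.IsPsrSchedule X μ κ β → N.Follows ν κ β →
          N.jointCost X μ (fun k ω => N.Ψ k (κ k ω)) (N.kalman X β) = V) ∧
      (V ≠ ⊤ → ∀ p β est, N.IsPowerSchedule X μ p β → N.IsEstimator X β est →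
        (N.jointCost X μ p est = V ↔
          N.powerCost μ p β = V ∧ ∀ k l, est k l =ᵐ[μ] N.kalman X β k l)) := by
  have hκ {p β} (h : N.IsPowerSchedule X μ p β) := fun k =>
    RemoteEst.Net.IsPowerSchedule.measurable_psr N h k
  refine ⟨fun p β h => ⟨N.isEstimator_kalman X β, fun k l => ⟨N.memLp_state hX k l,
      N.kalman_ae_eq_condExp hX (hκ h) h.erasure k l,
      fun i j => N.covState_ae_eq_condExp hX (hκ h) h.erasure k l i j,
      N.meanSqErr_kalman hX (hκ h) h.erasure k l, fun e he =>
        ⟨N.meanSqErr_kalman_le hX (hκ h) h.erasure k l he,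
          N.ae_eq_kalman_of_meanSqErr_eq hX (hκ h) h.erasure k l he⟩⟩⟩,
    fun p β h => ⟨N.jointCost_kalman hX h, fun est hest => N.powerCost_le_jointCost hX h hest⟩,
    fun k => ⟨N.mapsTo_Ψ k, N.mapsTo_psr k, N.invOn_psr_Ψ k⟩,
    fun κ β h => ⟨RemoteEst.Net.IsPsrSchedule.isPowerSchedule N h, N.powerCost_Ψ κ β⟩,
    fun p β h => ⟨RemoteEst.Net.IsPowerSchedule.isPsrSchedule N h,
      fun k ω => (N.Ψ_psr k fun l => (h.feasible k ω l).1).symm⟩,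
    fun ν hν => ⟨⟨_, _, N.isPsrSchedule_simArrival hX hν, fun _ _ => rfl⟩,
      fun κ β h hf => N.psrCost_eq_mdpCost hX h hf⟩, N.value 0 N.R₀, ?_⟩
  -- One simulated optimal policy attains, in all four problems, the lower bound `value 0 R₀`.
  obtain ⟨ν, hν, hνV⟩ := N.exists_mdpCost_eq_value
  have hsim := N.isPsrSchedule_simArrival hX hν
  have hsimV := (N.psrCost_eq_mdpCost hX hsim fun _ _ => rfl).trans hνV
  have hpow := RemoteEst.Net.IsPsrSchedule.isPowerSchedule N hsim
  have hpowle : ∀ p β, N.IsPowerSchedule X μ p β → N.value 0 N.R₀ ≤ N.powerCost μ p β :=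
    fun p β h => (N.value_le_psrCost hX (RemoteEst.Net.IsPowerSchedule.isPsrSchedule N h)).trans
      (N.psrCost_psr h).le
  have hmdp : IsLeast (N.mdpCost '' N.mdpPolicies) (N.value 0 N.R₀) :=
    ⟨⟨ν, hν, hνV⟩, by rintro _ ⟨ν', hν', rfl⟩; exact N.value_le_mdpCost hν'⟩
  refine ⟨⟨⟨_, _, _, hpow, N.isEstimator_kalman X _, ?_⟩, ?_⟩, ⟨⟨_, _, hpow, hsimV.symm⟩, ?_⟩,
    ⟨⟨_, _, hsim, hsimV.symm⟩, ?_⟩, hmdp, ?_, ?_⟩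
  · exact ((N.jointCost_kalman hX hpow).trans hsimV).symm
  · rintro _ ⟨p, β, est, h, hest, rfl⟩
    exact (hpowle p β h).trans (N.powerCost_le_jointCost hX h hest)
  · rintro _ ⟨p, β, h, rfl⟩
    exact hpowle p β h
  · rintro _ ⟨κ, β, h, rfl⟩
    exact N.value_le_psrCost hX h
  · intro ν' hν' hmin κ β h hf
    rw [N.jointCost_kalman hX (RemoteEst.Net.IsPsrSchedule.isPowerSchedule N h), N.powerCost_Ψ,
      N.psrCost_eq_mdpCost hX h hf]
    exact ((hmin hν).trans hνV.le).antisymm (N.value_le_mdpCost hν')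
  · intro hV p β est h hest
    constructor
    · intro heq
      -- The covariance-based cost lies between the optimal value and the joint cost. Finiteness of
      -- the value then permits recovery of the estimator from equal costs.
      have h1 : N.powerCost μ p β = N.value 0 N.R₀ :=
        ((N.powerCost_le_jointCost hX h hest).trans heq.le).antisymm (hpowle p β h)
      exact ⟨h1, fun k l => N.ae_eq_kalman_of_jointCost_eq hX h hest (heq.trans h1.symm)
        (h1.trans_ne hV) k l⟩
    · rintro ⟨h1, h2⟩
      exact (N.jointCost_congr hX h hest h2).trans h1
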